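/- Write $f(z)=\left(e^{4\pi|z|^2}-1-4\pi|z|^2\right)z$ and $F(z)=\frac1{4\pi}\left(e^{4\pi|z|^2}-1-4\pi|z|^2-8\pi^2|z|^4\right)$ for $z\in\mathbb C$. By a solution we mean a function $u\in C(\mathbb R,H^1(\mathbb R^2))\cap L^4_{loc}(\mathbb R,W^{1,4}(\mathbb R^2))$ with values in $\mathbb C$, with radial initial datum $u(0)\in H^1_{rad}(\mathbb R^2)$ and with $f(u)$ locally integrable on $\mathbb R\times\mathbb R^2$, which satisfies $$i\partial_t u+\Delta u=f(u)$$ on $\mathbb R\times\mathbb R^2$ in the sense of distributions. Its mass and Hamiltonian are those of its initial datum, $$M=\int_{\mathbb R^2}|u(0,x)|^2\,dx,\qquad H=\int_{\mathbb R^2}\left(|\nabla u(0,x)|^2+F(u(0,x))\right)dx.$$ For all real $M\ge 0$ and $0\le H\le 1$ there is a constant $C(M,H)$, depending only on $M$ and $H$, such that every solution $u$ of mass $M$ and Hamiltonian $H$ satisfies $$\int_t^{t+\tau}\int_{|x|\le 1}\left(e^{4\pi|u(s,x)|^2}-1-4\pi|u(s,x)|^2\right)|u(s,x)|^2\,dx\,ds\le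 C(M,H)\,\langle\tau\rangle$$ for all $t\in\mathbb R$ and all $\tau>0$, where $\langle\tau\rangle=(1+\tau^2)^{1/2}$. -/

import Mathlib

open MeasureTheory Set Filter Topology
open scoped ENNReal NNReal ContDiff Laplacian

noncomputable section

/-- The Euclidean plane `ℝ²`. -/
abbrev Plane : Type := EuclideanSpace ℝ (Fin 2)

/-- `g = (g₁, g₂)` is the weak (distributional) gradient of `v` on `ℝ²`:
`∫ v ∂ᵢφ dx = - ∫ gᵢ φ dx` for every `φ ∈ C_c^∞(ℝ²)` and `i = 1, 2`. -/
def IsWeakGradient (v : Plane → ℂ) (g : Plane → EuclideanSpace ℂ (Fin 2)) : Prop :=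
  LocallyIntegrable v ∧ LocallyIntegrable g ∧
    ∀ (i : Fin 2) (φ : Plane → ℝ), ContDiff ℝ ∞ φ → HasCompactSupport φ →
      ∫ x, fderiv ℝ φ x (EuclideanSpace.single i 1) • v x = - ∫ x, φ x • g x i

/-- A weak gradient is unique up to a null set. -/
theorem IsWeakGradient.ae_eq {v : Plane → ℂ} {g h : Plane → EuclideanSpace ℂ (Fin 2)}
    (hg : IsWeakGradient v g) (hh : IsWeakGradient v h) : g =ᵐ[volume] h := by
  have key : ∀ i : Fin 2, ∀ᵐ x : Plane, g x i = h x i := by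
    intro i
    have proj : ∀ k : Plane → EuclideanSpace ℂ (Fin 2), LocallyIntegrable k →
        LocallyIntegrable fun x => k x i := by
      intro k hk x
      obtain ⟨s, hs, hi⟩ := hk x
      exact ⟨s, hs, (EuclideanSpace.proj (𝕜 := ℂ) i).integrable_comp hi⟩
    have hgi := proj g hg.2.1
    have hhi := proj h hh.2.1
    refine ae_eq_of_integral_contDiff_smul_eq hgi hhi ?_
    intro φ hφ hc
    have h1 := hg.2.2 i φ hφ hc
    have h2 := hh.2.2 i φ hφ hc
    exact neg_injective (h1.symm.trans h2)
  filter_upwards [key 0, key 1] with x h0 h1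
  ext i
  fin_cases i
  · exact h0
  · exact h1

open Classical in
/-- The weak gradient `∇v` of `v` (well defined almost everywhere by `IsWeakGradient.ae_eq`);
the value `0` if there is none. -/
def weakGradient (v : Plane → ℂ) : Plane → EuclideanSpace ℂ (Fin 2) :=
  if h : ∃ g, IsWeakGradient v g then h.choose else 0

/-- `v ∈ W^{1,p}(ℝ²)`. For `p = 2` this is `H¹(ℝ²)`. -/
def MemW1 (p : ℝ≥0∞) (v : Plane → ℂ) : Prop :=
  MemLp v p ∧ (∃ g, IsWeakGradient v g) ∧ MemLp (weakGradient v) p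

/-- The norm `‖v‖_{L^p} + ‖∇v‖_{L^p}` of `v ∈ W^{1,p}(ℝ²)`. -/
def w1Norm (p : ℝ≥0∞) (v : Plane → ℂ) : ℝ≥0∞ :=
  eLpNorm v p + eLpNorm (weakGradient v) p

/-- `v` is radial: it agrees almost everywhere with a function of `|x|`. -/
def IsRadial (v : Plane → ℂ) : Prop :=
  ∃ ρ : ℝ → ℂ, v =ᵐ[volume] fun x => ρ ‖x‖

/-- The nonlinearity `f(z) = (e^{4π|z|²} - 1 - 4π|z|²) z`. -/
def nlsF (z : ℂ) : ℂ :=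
  ((Real.exp (4 * Real.pi * ‖z‖ ^ 2) - 1 - 4 * Real.pi * ‖z‖ ^ 2 : ℝ) : ℂ) * z

/-- The potential `F(z) = (e^{4π|z|²} - 1 - 4π|z|² - 8π²|z|⁴) / (4π)`, which is nonnegative. -/
def nlsPotential (z : ℂ) : ℝ :=
  1 / (4 * Real.pi) * (Real.exp (4 * Real.pi * ‖z‖ ^ 2) - 1 - 4 * Real.pi * ‖z‖ ^ 2
    - 8 * Real.pi ^ 2 * ‖z‖ ^ 4)

/-- `G(z) = (e^{4π|z|²} - 1 - 4π|z|²) |z|²`, which is nonnegative. -/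
def nlsG (z : ℂ) : ℝ :=
  (Real.exp (4 * Real.pi * ‖z‖ ^ 2) - 1 - 4 * Real.pi * ‖z‖ ^ 2) * ‖z‖ ^ 2

/-- The mass `∫ |v|² dx`, as an extended nonnegative number. -/
def mass (v : Plane → ℂ) : ℝ≥0∞ :=
  ∫⁻ x, ENNReal.ofReal (‖v x‖ ^ 2)

/-- The Hamiltonian `∫ (|∇v|² + F(v)) dx`, as an extended nonnegative number. -/
def hamiltonian (v : Plane → ℂ) : ℝ≥0∞ :=
  ∫⁻ x, ENNReal.ofReal (‖weakGradient v x‖ ^ 2 + nlsPotential (v x))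

/-- `u` is a global solution of `i ∂ₜu + Δu = f(u)` on `ℝ × ℝ²` with radial initial datum
`u(0) ∈ H¹_rad(ℝ²)`: it belongs to `C(ℝ, H¹(ℝ²)) ∩ L⁴_loc(ℝ, W^{1,4}(ℝ²))`, `f(u)` is locally
integrable, and the equation holds in the sense of distributions. -/
structure IsNLSSolution (u : ℝ → Plane → ℂ) : Prop where
  memH1 : ∀ t, MemW1 2 (u t)
  continuousH1 : ∀ t, Tendsto (fun s => w1Norm 2 (u s - u t)) (𝓝 t) (𝓝 0)
  memW14 : ∀ᵐ t : ℝ, MemW1 4 (u t)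
  locL4W14 : ∀ a b : ℝ, ∫⁻ t in Icc a b, w1Norm 4 (u t) ^ 4 < ⊤
  radial_zero : IsRadial (u 0)
  locIntegrable : ∀ (a b : ℝ) (K : Set Plane), IsCompact K →
    ∫⁻ t in Icc a b, ∫⁻ x in K, ‖nlsF (u t x)‖ₑ < ⊤
  equation : ∀ φ : ℝ × Plane → ℝ, ContDiff ℝ ∞ φ → HasCompactSupport φ →
    ∫ t, ∫ x, (-Complex.I * (deriv (fun s => φ (s, x)) t : ℂ)
        + ((Δ (fun y => φ (t, y)) x : ℝ) : ℂ)) * u t x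
      = ∫ t, ∫ x, (φ (t, x) : ℂ) * nlsF (u t x)

end

open MeasureTheory Set Filter Topology
open scoped ENNReal NNReal ContDiff Laplacian

noncomputable section

/-! The bound is a virial (Morawetz) estimate in the single direction x₀. Put b = arctan x₀, w = ∂₀b
= 1/(1 + x₀²) and V(t) = Im ∫ b ū ∂₀u. Formally V' = 2 ∫ w|∂₀u|² + Re ∫ ∂₀w ū ∂₀u + ∫ w (G(u) −
F(u)). The first term is nonnegative, the second is at most sup|∂₀w| ‖u‖ ‖∂₀u‖, and |V| ≤ sup|b| ‖u‖
‖∂₀u‖. Mass conservation gives ‖u‖ = √M; energy conservation, F ≥ 0 and H ≤ 1 give ‖∂₀u‖ ≤ 1. Hence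
the time integral of ∫ w (G − F) grows at most linearly. Since F ≤ G/2 everywhere and w ≥ 1/2 on the
unit disc, four times this integral dominates the one in the theorem. These last steps are
`virialDensity_le`, `lintegral_nlsG_le` and `IsNLSSolution.integral_virialDensity_le`.

The work lies in justifying this for a trajectory that is only continuous in H¹.

The nonlinearity must be a continuous map H¹ → L² (`continuous_nlsL2`). This rests on a
Moser–Trudinger type bound that is locally uniform on H¹ (`exists_lintegral_expExcess_near_le`):
functions small in H¹ have Gaussian tails, and every element of H¹ is a bounded test function plus a
small remainder.

The distributional equation becomes a differential equation in the dual of H¹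
(`IsNLSSolution.evolves`), so pairings ⟨u, A v⟩ with A bounded on H¹ can be differentiated in time
(`Evolves.hasDerivAt_inner`). Mass conservation follows at once. In the virial quantity and in the
kinetic energy, ∂ⱼ is replaced by a difference quotient, the identity is integrated in time, and the
step tends to 0; difference quotients of H¹ functions are bounded by and converge to the derivative
(`norm_diffQuot_le`, `tendsto_diffQuot`).

For the kinetic energy this passage needs ∇f(u) in L², integrable in time. The condition u ∈ L⁴_loc
W^{1,4} provides it by Hölder and exponential integrability (`exists_nlsL2_mem_sobolevH1`,
`exists_grad_nls`). The potential energy is not differentiated directly: convexity of F bounds its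
time increments from one side, and increments of both signs give equality (`potEnergy_sub`). -/

/-! ### Test functions, and H¹ as a closed space of pairs (v, ∇v). -/

/-- The Hilbert space `L²(ℝ²; ℂ)`. -/
abbrev PlaneL2 : Type := Lp ℂ 2 (volume : Measure Plane)

/-- The `j`-th standard basis vector of the plane. -/
def planeBasis (j : Fin 2) : Plane := EuclideanSpace.single j 1

lemma norm_planeBasis (j : Fin 2) : ‖planeBasis j‖ = 1 := by
  simp [planeBasis]

/-- Smooth compactly supported complex functions on the plane. -/
structure TestFun where
  /-- the underlying function -/
  toFun : Plane → ℂ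
  smooth : ContDiff ℝ ∞ toFun
  compact : HasCompactSupport toFun

namespace TestFun

lemma continuous (φ : TestFun) : Continuous φ.toFun := φ.smooth.continuous

lemma differentiable (φ : TestFun) : Differentiable ℝ φ.toFun :=
  φ.smooth.differentiable (by simp)

lemma memLp (φ : TestFun) (p : ℝ≥0∞) : MemLp φ.toFun p volume :=
  φ.continuous.memLp_of_hasCompactSupport φ.compact

/-- The class of a test function in `L²`. -/
def l2 (φ : TestFun) : PlaneL2 := (φ.memLp 2).toLp φ.toFun

lemma coeFn_l2 (φ : TestFun) : φ.l2 =ᵐ[volume] φ.toFun := (φ.memLp 2).coeFn_toLp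

/-- The derivative of a test function in the direction `y`. -/
def lineD (φ : TestFun) (y : Plane) : TestFun where
  toFun x := fderiv ℝ φ.toFun x y
  smooth := (φ.smooth.fderiv_right (m := ∞) (by simp)).clm_apply contDiff_const
  compact := φ.compact.fderiv_apply (𝕜 := ℝ) y

/-- The `j`-th partial derivative of a test function. -/
def d (φ : TestFun) (j : Fin 2) : TestFun := φ.lineD (planeBasis j)

/-- The translate `φ(· + y)`. -/
def shift (φ : TestFun) (y : Plane) : TestFun where
  toFun x := φ.toFun (x + y)
  smooth := φ.smooth.comp (contDiff_id.add contDiff_const)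
  compact := φ.compact.comp_homeomorph (Homeomorph.addRight y)

lemma shift_d (φ : TestFun) (y : Plane) (j : Fin 2) : (φ.shift y).d j = (φ.d j).shift y := by
  simp only [d, lineD, shift, mk.injEq]
  funext x
  rw [fderiv_comp_add_right]

/-- The product of a test function with a smooth real function. -/
def mul (φ : TestFun) (b : Plane → ℝ) (hb : ContDiff ℝ ∞ b) : TestFun where
  toFun x := b x • φ.toFun x
  smooth := hb.smul φ.smooth
  compact := HasCompactSupport.smul_left (f := b) (f' := φ.toFun) φ.compact

lemma mul_d (φ : TestFun) (b : Plane → ℝ) (hb : ContDiff ℝ ∞ b) (j : Fin 2) (x : Plane) :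
    ((φ.mul b hb).d j).toFun x
      = b x • (φ.d j).toFun x + fderiv ℝ b x (planeBasis j) • φ.toFun x := by
  have h1 : DifferentiableAt ℝ b x := hb.differentiable (by simp) x
  simp only [d, lineD, mul]
  rw [fderiv_fun_smul h1 (φ.differentiable x)]
  simp

end TestFun

/-- The space in which pairs `(v, ∇v)` live. -/
abbrev PlaneJet : Type := PlaneL2 × (Fin 2 → PlaneL2)

/-- The pair `(φ, ∇φ)` of a test function. -/
def TestFun.jet (φ : TestFun) : PlaneJet := (φ.l2, fun j => (φ.d j).l2)

/-- `H¹(ℝ²)`, as the space of pairs `(v, ∇v)`. -/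
def sobolevH1 : Submodule ℂ PlaneJet where
  carrier := {p | ∀ (φ : TestFun) (j : Fin 2), inner ℂ (φ.d j).l2 p.1 = - inner ℂ φ.l2 (p.2 j)}
  add_mem' := by
    intro p q hp hq φ j
    simp only [Prod.fst_add, Prod.snd_add, Pi.add_apply, inner_add_right, hp φ j, hq φ j]
    ring
  zero_mem' := by intro φ j; simp
  smul_mem' := by
    intro c p hp φ j
    simp only [Prod.smul_fst, Prod.smul_snd, Pi.smul_apply, inner_smul_right, hp φ j]
    ring

lemma mem_sobolevH1 {p : PlaneJet} : p ∈ sobolevH1 ↔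
    ∀ (φ : TestFun) (j : Fin 2), inner ℂ (φ.d j).l2 p.1 = - inner ℂ φ.l2 (p.2 j) := Iff.rfl

/-- Each weak-derivative condition is continuous in the pair. Closedness is how limits of smooth or
truncated approximants are shown to have weak gradients, in the chain rule and for f(v). -/
lemma isClosed_sobolevH1 : IsClosed (sobolevH1 : Set PlaneJet) := by
  have : (sobolevH1 : Set PlaneJet) = ⋂ (φ : TestFun), ⋂ (j : Fin 2),
      {p | inner ℂ (φ.d j).l2 p.1 = - inner ℂ φ.l2 (p.2 j)} := by
    ext p
    simp [mem_sobolevH1]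
  rw [this]
  refine isClosed_iInter fun φ => isClosed_iInter fun j => isClosed_eq ?_ ?_
  · exact continuous_const.inner continuous_fst
  · exact (continuous_const.inner ((continuous_apply j).comp continuous_snd)).neg

lemma inner_planeL2 (v w : PlaneL2) : inner ℂ v w = ∫ x, w x * (starRingEnd ℂ) (v x) := by
  rw [L2.inner_def]
  simp [RCLike.inner_apply]

lemma inner_testFun (φ : TestFun) (w : PlaneL2) :
    inner ℂ φ.l2 w = ∫ x, w x * (starRingEnd ℂ) (φ.toFun x) := by
  rw [inner_planeL2]
  refine integral_congr_ae ?_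
  filter_upwards [φ.coeFn_l2] with x hx
  rw [hx]

/-- Integration by parts for a `C¹` function against a test function. -/
lemma integral_testFun_by_parts (φ : TestFun) (v : Plane → ℂ) (hv : ContDiff ℝ 1 v) (y : Plane) :
    ∫ x, v x * (starRingEnd ℂ) ((φ.lineD y).toFun x)
      = - ∫ x, fderiv ℝ v x y * (starRingEnd ℂ) (φ.toFun x) := by
  have hc : Continuous fun x => fderiv ℝ v x y :=
    (hv.continuous_fderiv (by simp)).clm_apply continuous_const
  have hconj : ∀ x, fderiv ℝ (fun x => (starRingEnd ℂ) (φ.toFun x)) x y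
      = (starRingEnd ℂ) ((φ.lineD y).toFun x) := by
    intro x
    have := (Complex.conjCLE.toContinuousLinearMap.hasFDerivAt.comp x
      (φ.differentiable x).hasFDerivAt).fderiv
    have h2 : (fun x => (starRingEnd ℂ) (φ.toFun x))
      = (Complex.conjCLE.toContinuousLinearMap : ℂ → ℂ) ∘ φ.toFun := by
      funext x; simp
    rw [h2, this]
    simp [TestFun.lineD]
  have hci : ∀ (g : Plane → ℂ) (ψ : TestFun), Continuous g →
      Integrable fun x => g x * (starRingEnd ℂ) (ψ.toFun x) := by
    intro g ψ hg
    refine (hg.mul (Complex.continuous_conj.comp ψ.continuous)).integrable_of_hasCompactSupport ?_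
    exact (ψ.compact.comp_left (g := (starRingEnd ℂ)) (by simp)).mul_left
  have := integral_mul_fderiv_eq_neg_fderiv_mul_of_integrable (μ := (volume : Measure Plane))
    (f := v) (g := fun x => (starRingEnd ℂ) (φ.toFun x)) (v := y)
    (hci _ φ hc) (by simp_rw [hconj]; exact hci _ _ hv.continuous) (hci _ φ hv.continuous)
    (fun x _ => hv.differentiable (by simp) x)
    (fun x _ => (Complex.conjCLE.toContinuousLinearMap.hasFDerivAt.comp x
      (φ.differentiable x).hasFDerivAt).differentiableAt)
  simp_rw [hconj] at this
  exact this

lemma TestFun.jet_mem (φ : TestFun) : φ.jet ∈ sobolevH1 := by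
  intro ψ j
  have h := integral_testFun_by_parts ψ φ.toFun (φ.smooth.of_le (by simp)) (planeBasis j)
  rw [inner_testFun, inner_testFun]
  have h1 : ∫ x, φ.jet.1 x * (starRingEnd ℂ) ((ψ.d j).toFun x)
      = ∫ x, φ.toFun x * (starRingEnd ℂ) ((ψ.lineD (planeBasis j)).toFun x) := by
    refine integral_congr_ae ?_
    filter_upwards [φ.coeFn_l2] with x hx
    simp only [TestFun.jet]
    rw [hx]; rfl
  have h2 : ∫ x, φ.jet.2 j x * (starRingEnd ℂ) (ψ.toFun x)
      = ∫ x, fderiv ℝ φ.toFun x (planeBasis j) * (starRingEnd ℂ) (ψ.toFun x) := by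
    refine integral_congr_ae ?_
    filter_upwards [(φ.d j).coeFn_l2] with x hx
    simp only [TestFun.jet]
    rw [hx]; rfl
  rw [h1, h2, h]

/-! ### Translations and multipliers on L² and H¹. -/

/-- Translation `v ↦ v(· + y)` on `L²`. -/
def shiftL2 (y : Plane) : PlaneL2 →ₗᵢ[ℂ] PlaneL2 :=
  Lp.compMeasurePreservingₗᵢ ℂ (fun x => x + y) (measurePreserving_add_right volume y)

lemma coeFn_shiftL2 (y : Plane) (v : PlaneL2) :
    shiftL2 y v =ᵐ[volume] fun x => v (x + y) :=
  Lp.coeFn_compMeasurePreserving v (measurePreserving_add_right volume y)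

lemma ae_comp_add {P : Plane → Prop} (h : ∀ᵐ x, P x) (y : Plane) : ∀ᵐ x, P (x + y) :=
  (measurePreserving_add_right (volume : Measure Plane) y).quasiMeasurePreserving.ae h

lemma shiftL2_shiftL2 (y z : Plane) (v : PlaneL2) :
    shiftL2 y (shiftL2 z v) = shiftL2 (y + z) v := by
  refine Lp.ext ?_
  filter_upwards [coeFn_shiftL2 y (shiftL2 z v), coeFn_shiftL2 (y + z) v,
    ae_comp_add (coeFn_shiftL2 z v) y] with x h1 h2 h3
  rw [h1, h2, h3, add_assoc]

lemma shiftL2_zero (v : PlaneL2) : shiftL2 0 v = v := by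
  refine Lp.ext ?_
  filter_upwards [coeFn_shiftL2 0 v] with x h1
  rw [h1, add_zero]

lemma inner_shiftL2_left (y : Plane) (v w : PlaneL2) :
    inner ℂ (shiftL2 y v) w = inner ℂ v (shiftL2 (-y) w) := by
  rw [← (shiftL2 (-y)).inner_map_map, shiftL2_shiftL2]
  simp [shiftL2_zero]

lemma inner_shiftL2_right (y : Plane) (v w : PlaneL2) :
    inner ℂ v (shiftL2 y w) = inner ℂ (shiftL2 (-y) v) w := by
  rw [inner_shiftL2_left, neg_neg]

lemma shiftL2_testFun (y : Plane) (φ : TestFun) : shiftL2 y φ.l2 = (φ.shift y).l2 := by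
  refine Lp.ext ?_
  filter_upwards [coeFn_shiftL2 y φ.l2, (φ.shift y).coeFn_l2, ae_comp_add φ.coeFn_l2 y]
    with x h1 h2 h3
  rw [h1, h2, h3]; rfl

lemma continuous_shiftL2 (v : PlaneL2) : Continuous fun y => shiftL2 y v := by
  let g : Plane → C(Plane, Plane) := fun y => ⟨fun x => x + y, by fun_prop⟩
  have hg : Continuous g := ContinuousMap.continuous_of_continuous_uncurry _ (by
    simp only [g, Function.uncurry_def, ContinuousMap.coe_mk]; fun_prop)
  exact Continuous.compMeasurePreservingLp (f := fun _ : Plane => v) (g := g) continuous_const hg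
    (fun y => measurePreserving_add_right volume y) (by simp)

/-- Translation on `H¹`. -/
def shiftH1 (y : Plane) : sobolevH1 →L[ℂ] sobolevH1 :=
  ((((shiftL2 y).toContinuousLinearMap.prodMap
    (ContinuousLinearMap.piMap fun _ : Fin 2 => (shiftL2 y).toContinuousLinearMap)).comp
      sobolevH1.subtypeL)).codRestrict sobolevH1 (by
    rintro ⟨p, hp⟩ φ j
    have h := hp (φ.shift (-y)) j
    rw [TestFun.shift_d, ← shiftL2_testFun, ← shiftL2_testFun] at h
    change inner ℂ (φ.d j).l2 (shiftL2 y p.1) = - inner ℂ φ.l2 (shiftL2 y (p.2 j))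
    rw [inner_shiftL2_right, inner_shiftL2_right]
    exact h)

@[simp] lemma shiftH1_fst (y : Plane) (v : sobolevH1) :
    (shiftH1 y v).1.1 = shiftL2 y v.1.1 := rfl

@[simp] lemma shiftH1_snd (y : Plane) (v : sobolevH1) (j : Fin 2) :
    (shiftH1 y v).1.2 j = shiftL2 y (v.1.2 j) := rfl

lemma memLp_mul_bounded (b : BoundedContinuousFunction Plane ℝ) (v : PlaneL2) :
    MemLp (fun x => (b x : ℂ) * v x) 2 volume :=
  MemLp.of_le_mul (c := ‖b‖) (Lp.memLp v)
    ((Complex.continuous_ofReal.comp b.continuous).aestronglyMeasurable.mul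
      (Lp.aestronglyMeasurable v))
    (Eventually.of_forall fun x => by
      rw [norm_mul, Complex.norm_real]
      exact mul_le_mul_of_nonneg_right (b.norm_coe_le_norm x) (norm_nonneg _))

/-- Multiplication by a bounded continuous real function, as a linear map on `L²`. -/
def mulL2Linear (b : BoundedContinuousFunction Plane ℝ) : PlaneL2 →ₗ[ℂ] PlaneL2 where
  toFun v := (memLp_mul_bounded b v).toLp _
  map_add' v w := by
    refine Lp.ext ?_
    filter_upwards [(memLp_mul_bounded b (v + w)).coeFn_toLp, Lp.coeFn_add v w,
      (memLp_mul_bounded b v).coeFn_toLp, (memLp_mul_bounded b w).coeFn_toLp,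
      Lp.coeFn_add ((memLp_mul_bounded b v).toLp _) ((memLp_mul_bounded b w).toLp _)]
      with x h1 h2 h3 h4 h5
    rw [h5, Pi.add_apply, h1, h2, h3, h4, Pi.add_apply]
    ring
  map_smul' c v := by
    refine Lp.ext ?_
    filter_upwards [(memLp_mul_bounded b (c • v)).coeFn_toLp, Lp.coeFn_smul c v,
      (memLp_mul_bounded b v).coeFn_toLp, Lp.coeFn_smul c ((memLp_mul_bounded b v).toLp _)]
      with x h1 h2 h3 h5
    rw [RingHom.id_apply, h5, Pi.smul_apply, h1, h2, h3, Pi.smul_apply]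
    simp only [smul_eq_mul]
    ring

lemma coeFn_mulL2Linear (b : BoundedContinuousFunction Plane ℝ) (v : PlaneL2) :
    mulL2Linear b v =ᵐ[volume] fun x => (b x : ℂ) * v x :=
  (memLp_mul_bounded b v).coeFn_toLp

lemma norm_mulL2Linear_le (b : BoundedContinuousFunction Plane ℝ) (v : PlaneL2) :
    ‖mulL2Linear b v‖ ≤ ‖b‖ * ‖v‖ := by
  refine Lp.norm_le_mul_norm_of_ae_le_mul ?_
  filter_upwards [coeFn_mulL2Linear b v] with x h1
  rw [h1, norm_mul, Complex.norm_real]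
  exact mul_le_mul_of_nonneg_right (b.norm_coe_le_norm x) (norm_nonneg _)

/-- Multiplication by a bounded continuous real function on `L²`. -/
def mulL2 (b : BoundedContinuousFunction Plane ℝ) : PlaneL2 →L[ℂ] PlaneL2 :=
  (mulL2Linear b).mkContinuous ‖b‖ (norm_mulL2Linear_le b)

lemma coeFn_mulL2 (b : BoundedContinuousFunction Plane ℝ) (v : PlaneL2) :
    mulL2 b v =ᵐ[volume] fun x => (b x : ℂ) * v x :=
  coeFn_mulL2Linear b v

lemma norm_mulL2_le (b : BoundedContinuousFunction Plane ℝ) (v : PlaneL2) :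
    ‖mulL2 b v‖ ≤ ‖b‖ * ‖v‖ :=
  norm_mulL2Linear_le b v

lemma inner_mulL2 (b : BoundedContinuousFunction Plane ℝ) (v w : PlaneL2) :
    inner ℂ (mulL2 b v) w = inner ℂ v (mulL2 b w) := by
  rw [inner_planeL2, inner_planeL2]
  refine integral_congr_ae ?_
  filter_upwards [coeFn_mulL2 b v, coeFn_mulL2 b w] with x h1 h2
  rw [h1, h2]
  simp
  ring

/-- A smooth bounded real multiplier with bounded continuous gradient. -/
structure Multiplier where
  /-- the multiplier -/
  fn : BoundedContinuousFunction Plane ℝ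
  /-- its gradient -/
  grad : Fin 2 → BoundedContinuousFunction Plane ℝ
  smooth : ContDiff ℝ ∞ fn
  fderiv_eq : ∀ x j, fderiv ℝ fn x (planeBasis j) = grad j x

lemma inner_mul_testFun (φ : TestFun) (b : BoundedContinuousFunction Plane ℝ)
    (hb : ContDiff ℝ ∞ b) (w : PlaneL2) :
    inner ℂ (φ.mul b hb).l2 w = inner ℂ φ.l2 (mulL2 b w) := by
  rw [inner_testFun, inner_testFun]
  refine integral_congr_ae ?_
  filter_upwards [coeFn_mulL2 b w] with x h1
  rw [h1]
  simp [TestFun.mul]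
  ring

/-- Multiplication on `H¹`. -/
def Multiplier.mulH1 (b : Multiplier) : sobolevH1 →L[ℂ] sobolevH1 :=
  ((ContinuousLinearMap.prod ((mulL2 b.fn).comp (ContinuousLinearMap.fst ℂ _ _))
    (ContinuousLinearMap.pi fun j : Fin 2 =>
      ((mulL2 b.fn).comp ((ContinuousLinearMap.proj j).comp (ContinuousLinearMap.snd ℂ _ _)))
      + (mulL2 (b.grad j)).comp (ContinuousLinearMap.fst ℂ _ _))).comp
      sobolevH1.subtypeL).codRestrict sobolevH1 (by
    rintro ⟨p, hp⟩ φ j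
    -- Testing the original pair with bφ and expanding ∂ⱼ(bφ) yields the weak product rule for bv.
    have h := hp (φ.mul b.fn b.smooth) j
    simp only [ContinuousLinearMap.comp_apply, Submodule.subtypeL_apply,
      ContinuousLinearMap.prod_apply, ContinuousLinearMap.coe_fst', ContinuousLinearMap.coe_snd',
      ContinuousLinearMap.pi_apply, add_apply, ContinuousLinearMap.proj_apply]
    rw [inner_mul_testFun] at h
    have h3 : ((φ.mul b.fn b.smooth).d j).l2
        = mulL2 b.fn (φ.d j).l2 + mulL2 (b.grad j) φ.l2 := by
      refine Lp.ext ?_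
      filter_upwards [((φ.mul b.fn b.smooth).d j).coeFn_l2, coeFn_mulL2 b.fn (φ.d j).l2,
        coeFn_mulL2 (b.grad j) φ.l2, (φ.d j).coeFn_l2, φ.coeFn_l2,
        Lp.coeFn_add (mulL2 b.fn (φ.d j).l2) (mulL2 (b.grad j) φ.l2)] with x h1 h2 h3 h4 h5 h6
      rw [h6, Pi.add_apply, h1, h2, h3, h4, h5, TestFun.mul_d, b.fderiv_eq]
      simp
    rw [h3, inner_add_left, inner_mulL2, inner_mulL2] at h
    rw [inner_add_right, neg_add, ← h]
    ring)

@[simp] lemma Multiplier.mulH1_fst (b : Multiplier) (v : sobolevH1) :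
    (b.mulH1 v).1.1 = mulL2 b.fn v.1.1 := rfl

@[simp] lemma Multiplier.mulH1_snd (b : Multiplier) (v : sobolevH1) (j : Fin 2) :
    (b.mulH1 v).1.2 j = mulL2 b.fn (v.1.2 j) + mulL2 (b.grad j) v.1.1 := rfl

/-! ### Cauchy–Schwarz and convergence criteria in L². -/

/-- Cauchy–Schwarz with a weight. -/
lemma lintegral_mul_sq_le {α : Type*} [MeasurableSpace α] {μ : Measure α} {f g : α → ℝ≥0∞}
    (hf : AEMeasurable f μ) (hg : AEMeasurable g μ) :
    (∫⁻ x, f x * g x ∂μ) ^ 2 ≤ (∫⁻ x, f x ∂μ) * ∫⁻ x, f x * g x ^ 2 ∂μ := by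
  have hpq : (2 : ℝ).HolderConjugate 2 := Real.HolderConjugate.two_two
  -- The product is factored as f^{1/2} · (f^{1/2} g).
  have h := ENNReal.lintegral_mul_le_Lp_mul_Lq μ hpq (f := fun x => f x ^ (1 / 2 : ℝ))
    (g := fun x => f x ^ (1 / 2 : ℝ) * g x) (hf.pow_const _) ((hf.pow_const _).mul hg)
  have e1 : ∀ x, f x ^ (1 / 2 : ℝ) * f x ^ (1 / 2 : ℝ) = f x := fun x => by
    rw [← ENNReal.rpow_add_of_nonneg _ _ (by norm_num) (by norm_num)]; norm_num
  have e2 : ∀ x, (f x ^ (1 / 2 : ℝ)) ^ (2 : ℝ) = f x := fun x => by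
    rw [← ENNReal.rpow_mul]; norm_num
  have e3 : ∀ x, (f x ^ (1 / 2 : ℝ) * g x) ^ (2 : ℝ) = f x * g x ^ 2 := fun x => by
    rw [ENNReal.mul_rpow_of_nonneg _ _ (by norm_num), e2]; norm_num
  simp only [Pi.mul_apply, ← mul_assoc, e1, e2, e3] at h
  calc (∫⁻ x, f x * g x ∂μ) ^ 2
      ≤ ((∫⁻ x, f x ∂μ) ^ (1 / 2 : ℝ) * (∫⁻ x, f x * g x ^ 2 ∂μ) ^ (1 / 2 : ℝ)) ^ 2 := by
        gcongr
    _ = _ := by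
        rw [← ENNReal.rpow_natCast, ENNReal.mul_rpow_of_nonneg _ _ (by norm_num),
          ← ENNReal.rpow_mul, ← ENNReal.rpow_mul]
        norm_num

lemma eLpNorm_two_sq {α E : Type*} [MeasurableSpace α] [NormedAddCommGroup E] {μ : Measure α}
    (f : α → E) : eLpNorm f 2 μ ^ 2 = ∫⁻ x, ‖f x‖ₑ ^ 2 ∂μ := by
  have := eLpNorm_nnreal_pow_eq_lintegral (μ := μ) (f := f) (p := 2) (by norm_num)
  simpa using this

lemma enorm_sq_planeL2 (v : PlaneL2) : ‖v‖ₑ ^ 2 = ∫⁻ x, ‖v x‖ₑ ^ 2 := by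
  rw [Lp.enorm_def, eLpNorm_two_sq]

lemma enorm_sub_toLp_sq {f : Plane → ℂ} (hf : MemLp f 2 volume) (v : PlaneL2) :
    ‖hf.toLp f - v‖ₑ ^ 2 = ∫⁻ x, ‖f x - v x‖ₑ ^ 2 := by
  rw [enorm_sq_planeL2]
  refine lintegral_congr_ae ?_
  filter_upwards [Lp.coeFn_sub (hf.toLp f) v, hf.coeFn_toLp] with x h1 h2
  rw [h1, Pi.sub_apply, h2]

lemma tendsto_planeL2_iff {ι : Type*} {l : Filter ι} {F : ι → PlaneL2} {f : PlaneL2} :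
    Tendsto F l (𝓝 f) ↔ Tendsto (fun n => ∫⁻ x, ‖F n x - f x‖ₑ ^ 2) l (𝓝 0) := by
  have e : ∀ n, ∫⁻ x, ‖F n x - f x‖ₑ ^ 2 = ‖F n - f‖ₑ ^ 2 := fun n => by
    rw [enorm_sq_planeL2]
    refine lintegral_congr_ae ?_
    filter_upwards [Lp.coeFn_sub (F n) f] with x h1
    rw [h1, Pi.sub_apply]
  simp_rw [e]
  rw [tendsto_iff_edist_tendsto_0]
  simp_rw [edist_eq_enorm_sub]
  constructor
  · intro h
    simpa [Function.comp_def] using ((ENNReal.continuous_pow 2).tendsto 0).comp h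
  · intro h
    have := ((ENNReal.continuous_rpow_const (y := (1 / 2 : ℝ))).tendsto 0).comp h
    simp only [Function.comp_def, one_div, ENNReal.zero_rpow_of_pos (by norm_num : (0:ℝ) < 2⁻¹)]
      at this
    refine this.congr fun n => ?_
    rw [← ENNReal.rpow_natCast, ← ENNReal.rpow_mul]
    norm_num

/-- Dominated convergence in `L²`. -/
lemma tendsto_planeL2_of_dominated {F : ℕ → PlaneL2} {f : PlaneL2} {g : Plane → ℝ≥0∞}
    (hg : ∫⁻ x, g x ^ 2 ≠ ⊤) (hF : ∀ n, ∀ᵐ x, ‖F n x‖ₑ ≤ g x)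
    (hlim : ∀ᵐ x, Tendsto (fun n => F n x) atTop (𝓝 (f x))) : Tendsto F atTop (𝓝 f) := by
  rw [tendsto_planeL2_iff]
  have key := tendsto_lintegral_of_dominated_convergence' (μ := (volume : Measure Plane))
    (F := fun n x => ‖F n x - f x‖ₑ ^ 2) (f := fun _ => 0) (fun x => (2 * g x) ^ 2)
    (fun n => (((Lp.aestronglyMeasurable (F n)).sub (Lp.aestronglyMeasurable f)).enorm.pow_const 2))
    ?_ ?_ ?_
  · simpa using key
  · intro n
    have hall : ∀ᵐ x, ∀ n, ‖F n x‖ₑ ≤ g x := ae_all_iff.2 hF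
    filter_upwards [hall, hlim] with x h1 h2
    have h3 : ‖f x‖ₑ ≤ g x := le_of_tendsto h2.enorm (Eventually.of_forall h1)
    have h4 : ‖F n x - f x‖ₑ ≤ 2 * g x := by
      refine (enorm_sub_le).trans ?_
      rw [two_mul]
      exact add_le_add (h1 n) h3
    gcongr
  · simp_rw [mul_pow]
    rw [lintegral_const_mul' _ _ (by simp)]
    exact ENNReal.mul_ne_top (by simp) hg
  · filter_upwards [hlim] with x h2
    have h3 : Tendsto (fun n => F n x - f x) atTop (𝓝 0) := by
      simpa using h2.sub (tendsto_const_nhds (x := f x))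
    have := ((ENNReal.continuous_pow 2).tendsto _).comp h3.enorm
    simpa [Function.comp_def] using this

/-! ### Mollification, truncation and density of test functions in H¹. -/

open scoped Convolution

/-- Mollification `ρ ⋆ v`. -/
def mollify (ρ : Plane → ℝ) (v : PlaneL2) : Plane → ℂ :=
  ρ ⋆[ContinuousLinearMap.lsmul ℝ ℝ, volume] v

lemma locallyIntegrable_planeL2 (v : PlaneL2) : LocallyIntegrable v volume :=
  (Lp.memLp v).locallyIntegrable (by norm_num)

lemma mollify_apply (ρ : Plane → ℝ) (v : PlaneL2) (x : Plane) :
    mollify ρ v x = ∫ t, ρ t • v (x - t) := rfl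

lemma contDiff_mollify {ρ : Plane → ℝ} (hρ : ContDiff ℝ ∞ ρ) (hc : HasCompactSupport ρ)
    (v : PlaneL2) : ContDiff ℝ ∞ (mollify ρ v) :=
  hc.contDiff_convolution_left _ hρ (locallyIntegrable_planeL2 v)

/-- ρ ⋆ v − v is the average of v(· − t) − v against the probability density ρ. Cauchy–Schwarz with
weight ρ moves the square inside the average, and Tonelli reduces the claim to the translation
errors on the support of ρ. -/
lemma enorm_mollify_sub_le {ρ : Plane → ℝ} (hρ : Continuous ρ) (hc : HasCompactSupport ρ)
    (h0 : ∀ x, 0 ≤ ρ x) (h1 : ∫ x, ρ x = 1) (v : PlaneL2) {ε : ℝ≥0∞}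
    (hε : ∀ y ∈ Function.support ρ, ‖shiftL2 (-y) v - v‖ₑ ≤ ε) :
    ∫⁻ x, ‖mollify ρ v x - v x‖ₑ ^ 2 ≤ ε ^ 2 := by
  have hint : Integrable ρ := hρ.integrable_of_hasCompactSupport hc
  have hl1 : ∫⁻ x, ‖ρ x‖ₑ = 1 := by
    have : ∀ x, ‖ρ x‖ₑ = ENNReal.ofReal (ρ x) := fun x => by
      rw [Real.enorm_eq_ofReal (h0 x)]
    simp_rw [this]
    rw [← ofReal_integral_eq_lintegral_ofReal hint (Eventually.of_forall h0), h1]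
    simp
  have hsm : Measurable (v : Plane → ℂ) := (Lp.stronglyMeasurable v).measurable
  have hpt : ∀ x, ‖mollify ρ v x - v x‖ₑ ^ 2 ≤ ∫⁻ t, ‖ρ t‖ₑ * ‖v (x - t) - v x‖ₑ ^ 2 := by
    intro x
    have hex : Integrable fun t => ρ t • v (x - t) :=
      hc.convolutionExists_left (ContinuousLinearMap.lsmul ℝ ℝ) hρ (locallyIntegrable_planeL2 v) x
    have e : mollify ρ v x - v x = ∫ t, ρ t • (v (x - t) - v x) := by
      simp_rw [smul_sub]
      rw [integral_sub hex (hint.smul_const _), integral_smul_const, h1, one_smul, mollify_apply]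
    have h2 : ‖mollify ρ v x - v x‖ₑ ≤ ∫⁻ t, ‖ρ t‖ₑ * ‖v (x - t) - v x‖ₑ := by
      rw [e]
      refine (enorm_integral_le_lintegral_enorm _).trans_eq ?_
      simp_rw [enorm_smul]
    calc ‖mollify ρ v x - v x‖ₑ ^ 2 ≤ (∫⁻ t, ‖ρ t‖ₑ * ‖v (x - t) - v x‖ₑ) ^ 2 := by gcongr
      _ ≤ (∫⁻ t, ‖ρ t‖ₑ) * ∫⁻ t, ‖ρ t‖ₑ * ‖v (x - t) - v x‖ₑ ^ 2 :=
        lintegral_mul_sq_le hρ.measurable.enorm.aemeasurable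
          ((hsm.comp (measurable_const.sub measurable_id)).sub measurable_const).enorm.aemeasurable
      _ = _ := by rw [hl1, one_mul]
  calc ∫⁻ x, ‖mollify ρ v x - v x‖ₑ ^ 2
      ≤ ∫⁻ x, ∫⁻ t, ‖ρ t‖ₑ * ‖v (x - t) - v x‖ₑ ^ 2 := lintegral_mono hpt
    _ = ∫⁻ t, ∫⁻ x, ‖ρ t‖ₑ * ‖v (x - t) - v x‖ₑ ^ 2 := by
        refine lintegral_lintegral_swap (Measurable.aemeasurable ?_)
        exact (hρ.measurable.comp measurable_snd).enorm.mul
          (((hsm.comp (measurable_fst.sub measurable_snd)).sub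
            (hsm.comp measurable_fst)).enorm.pow_const 2)
    _ ≤ ∫⁻ t, ‖ρ t‖ₑ * ε ^ 2 := by
        refine lintegral_mono fun t => ?_
        rw [lintegral_const_mul' _ _ (by simp)]
        by_cases ht : ρ t = 0
        · simp [ht]
        · have h3 := hε t ht
          have e : ∫⁻ x, ‖v (x - t) - v x‖ₑ ^ 2 = ‖shiftL2 (-t) v - v‖ₑ ^ 2 := by
            rw [enorm_sq_planeL2]
            refine lintegral_congr_ae ?_
            filter_upwards [Lp.coeFn_sub (shiftL2 (-t) v) v, coeFn_shiftL2 (-t) v] with x h4 h5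
            rw [h4, Pi.sub_apply, h5, sub_eq_add_neg x t]
          dsimp only
          rw [e]
          gcongr
    _ = ε ^ 2 := by
        rw [lintegral_mul_const _ hρ.measurable.enorm, hl1, one_mul]

/-- A test function from a real test function. -/
def TestFun.ofReal (φ : Plane → ℝ) (h : ContDiff ℝ ∞ φ) (hc : HasCompactSupport φ) : TestFun where
  toFun x := (φ x : ℂ)
  smooth := Complex.ofRealCLM.contDiff.comp h
  compact := hc.comp_left (g := fun r : ℝ => (r : ℂ)) (by simp)

lemma TestFun.ofReal_d (φ : Plane → ℝ) (h : ContDiff ℝ ∞ φ) (hc : HasCompactSupport φ)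
    (j : Fin 2) (x : Plane) :
    ((TestFun.ofReal φ h hc).d j).toFun x = (fderiv ℝ φ x (planeBasis j) : ℂ) := by
  have := (Complex.ofRealCLM.hasFDerivAt.comp x
    ((h.differentiable (by simp)) x).hasFDerivAt).fderiv
  have h2 : (TestFun.ofReal φ h hc).toFun = Complex.ofRealCLM ∘ φ := by
    funext x; simp [TestFun.ofReal]
  simp only [TestFun.d, TestFun.lineD]
  rw [h2, this]
  simp

lemma sobolevH1_integral_real {p : PlaneJet} (hp : p ∈ sobolevH1) {φ : Plane → ℝ}
    (h : ContDiff ℝ ∞ φ) (hc : HasCompactSupport φ) (j : Fin 2) :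
    ∫ x, fderiv ℝ φ x (planeBasis j) • p.1 x = - ∫ x, φ x • p.2 j x := by
  have := hp (TestFun.ofReal φ h hc) j
  rw [inner_testFun, inner_testFun] at this
  simp_rw [TestFun.ofReal_d] at this
  simp only [TestFun.ofReal, Complex.conj_ofReal] at this
  simpa [mul_comm] using this

/-- The derivative falls on ρ(x − ·), which is an admissible real test function; the weak-gradient
identity then moves it onto v. -/
lemma fderiv_mollify {p : PlaneJet} (hp : p ∈ sobolevH1) {ρ : Plane → ℝ}
    (hρ : ContDiff ℝ ∞ ρ) (hc : HasCompactSupport ρ) (j : Fin 2) (x : Plane) :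
    fderiv ℝ (mollify ρ p.1) x (planeBasis j) = mollify ρ (p.2 j) x := by
  have h1 := hc.hasFDerivAt_convolution_left (ContinuousLinearMap.lsmul ℝ ℝ)
    (hρ.of_le (by simp)) (locallyIntegrable_planeL2 p.1) x
  have h2 : fderiv ℝ (mollify ρ p.1) x = _ := h1.fderiv
  have hd : ContDiff ℝ ∞ (fderiv ℝ ρ) := hρ.fderiv_right (m := ∞) (by simp)
  rw [h2, convolution_def, ContinuousLinearMap.integral_apply]
  · simp only [ContinuousLinearMap.precompL_apply, ContinuousLinearMap.lsmul_apply]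
    have hshift : ContDiff ℝ ∞ fun t => ρ (x - t) := hρ.comp (contDiff_const.sub contDiff_id)
    have hcs : HasCompactSupport fun t => ρ (x - t) := hc.comp_homeomorph (Homeomorph.subLeft x)
    have key := sobolevH1_integral_real hp hshift hcs j
    have hf : ∀ t, fderiv ℝ (fun t => ρ (x - t)) t (planeBasis j)
        = - fderiv ℝ ρ (x - t) (planeBasis j) := by
      intro t
      have h3 := (((hρ.differentiable (by simp)) (x - t)).hasFDerivAt.comp t
        ((hasFDerivAt_id t).const_sub x)).fderiv
      rw [show (fun t => ρ (x - t)) = ρ ∘ HSub.hSub x from rfl, h3]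
      simp
    simp_rw [hf, neg_smul, integral_neg, neg_inj] at key
    rw [← integral_sub_left_eq_self _ volume x, mollify_apply,
      ← integral_sub_left_eq_self (fun t => ρ t • p.2 j (x - t)) volume x]
    simpa using key
  · exact (hc.fderiv (𝕜 := ℝ)).convolutionExists_left _ hd.continuous
      (locallyIntegrable_planeL2 p.1) x

/-- A fixed smooth cutoff, equal to `1` on the unit ball. -/
def cutoffBump (E : Type*) [NormedAddCommGroup E] [InnerProductSpace ℝ E] : ContDiffBump (0 : E) :=
  ⟨1, 2, by norm_num, by norm_num⟩

/-- The cutoff at scale `n + 1`. -/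
def cutoff (E : Type*) [NormedAddCommGroup E] [InnerProductSpace ℝ E] (n : ℕ) (x : E) : ℝ :=
  cutoffBump E (((n : ℝ) + 1)⁻¹ • x)

section cutoff

variable {E : Type*} [NormedAddCommGroup E] [InnerProductSpace ℝ E] [FiniteDimensional ℝ E]

lemma contDiff_cutoff (n : ℕ) : ContDiff ℝ ∞ (cutoff E n) :=
  (cutoffBump E).contDiff.comp (contDiff_const.smul contDiff_id)

lemma cutoff_nonneg (n : ℕ) (x : E) : 0 ≤ cutoff E n x := (cutoffBump E).nonneg

lemma cutoff_le_one (n : ℕ) (x : E) : cutoff E n x ≤ 1 := (cutoffBump E).le_one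

lemma cutoff_eq_one {n : ℕ} {x : E} (h : ‖x‖ ≤ n + 1) : cutoff E n x = 1 := by
  have hn : (0 : ℝ) < n + 1 := by positivity
  refine (cutoffBump E).one_of_mem_closedBall ?_
  rw [mem_closedBall_zero_iff, norm_smul, norm_inv, Real.norm_of_nonneg hn.le]
  change _ ≤ (1 : ℝ)
  rw [inv_mul_le_iff₀ hn]
  simpa using h

lemma hasCompactSupport_cutoff (n : ℕ) : HasCompactSupport (cutoff E n) := by
  have hn : ((n : ℝ) + 1)⁻¹ ≠ 0 := by positivity
  exact (cutoffBump E).hasCompactSupport.comp_homeomorph (Homeomorph.smulOfNeZero _ hn)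

lemma tendsto_cutoff (x : E) : Tendsto (fun n => cutoff E n x) atTop (𝓝 1) := by
  obtain ⟨N, hN⟩ := exists_nat_ge ‖x‖
  refine tendsto_const_nhds.congr' ?_
  filter_upwards [eventually_ge_atTop N] with n hn
  rw [cutoff_eq_one]
  have : (N : ℝ) ≤ n := by exact_mod_cast hn
  linarith

-- Scaling gains a factor 1/(n + 1). It kills the commutator when a function is cut off in space,
-- and it makes the derivatives of the truncated nonlinearities bounded uniformly in n.
variable (E) in
lemma exists_norm_fderiv_cutoff_le :
    ∃ C : ℝ, 0 ≤ C ∧ ∀ (n : ℕ) (x : E), ‖fderiv ℝ (cutoff E n) x‖ ≤ C * ((n : ℝ) + 1)⁻¹ := by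
  have hc : ContDiff ℝ 1 (cutoffBump E : E → ℝ) := (cutoffBump E).contDiff
  obtain ⟨C, hC⟩ := ((cutoffBump E).hasCompactSupport.fderiv (𝕜 := ℝ)).exists_bound_of_continuous
    (hc.continuous_fderiv (by simp))
  refine ⟨C, (norm_nonneg _).trans (hC 0), fun n x => ?_⟩
  have hn : (0 : ℝ) < ((n : ℝ) + 1)⁻¹ := by positivity
  have h := (((hc.differentiable (by simp)) (((n : ℝ) + 1)⁻¹ • x)).hasFDerivAt.comp x
    ((hasFDerivAt_id x).const_smul ((n : ℝ) + 1)⁻¹)).fderiv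
  have e : cutoff E n = (cutoffBump E : E → ℝ) ∘ HSMul.hSMul ((n : ℝ) + 1)⁻¹ := rfl
  rw [e, h]
  rw [ContinuousLinearMap.comp_smul, ContinuousLinearMap.comp_id, norm_smul,
    Real.norm_of_nonneg hn.le, mul_comm]
  exact mul_le_mul_of_nonneg_right (hC _) hn.le

end cutoff

/-- Multiplying m by the cutoffs suffices: in the product rule the term carrying the derivative of
the cutoff is O(1/n)|m|, and dominated convergence handles the rest. -/
lemma exists_testFun_near_smooth {m : Plane → ℂ} (hm : ContDiff ℝ ∞ m) (h0 : MemLp m 2 volume)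
    (hj : ∀ j, MemLp (fun x => fderiv ℝ m x (planeBasis j)) 2 volume) {ε : ℝ} (hε : 0 < ε) :
    ∃ φ : TestFun, ‖φ.jet - (h0.toLp m, fun j => (hj j).toLp _)‖ < ε := by
  let φ : ℕ → TestFun := fun n =>
    ⟨fun x => cutoff Plane n x • m x, (contDiff_cutoff n).smul hm,
      HasCompactSupport.smul_right (f := cutoff Plane n) (f' := m) (hasCompactSupport_cutoff n)⟩
  obtain ⟨C, hC0, hC⟩ := exists_norm_fderiv_cutoff_le Plane
  have hφ0 : Tendsto (fun n => (φ n).l2) atTop (𝓝 (h0.toLp m)) := by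
    refine tendsto_planeL2_of_dominated (g := fun x => ‖m x‖ₑ) ?_ ?_ ?_
    · rw [← eLpNorm_two_sq]
      exact ENNReal.pow_ne_top h0.eLpNorm_ne_top
    · intro n
      filter_upwards [(φ n).coeFn_l2] with x hx
      rw [hx]
      simp only [φ, enorm_smul]
      refine mul_le_of_le_one_left zero_le ?_
      rw [Real.enorm_eq_ofReal (cutoff_nonneg n x)]
      simpa using cutoff_le_one n x
    · have hall : ∀ᵐ x, ∀ n, (φ n).l2 x = (φ n).toFun x := ae_all_iff.2 fun n => (φ n).coeFn_l2
      filter_upwards [hall, h0.coeFn_toLp] with x h1 h2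
      simp_rw [h1, h2]
      simpa [φ] using (tendsto_cutoff x).smul_const (m x)
  have hφj : ∀ j, Tendsto (fun n => ((φ n).d j).l2) atTop (𝓝 ((hj j).toLp _)) := by
    intro j
    have hd : ∀ n x, ((φ n).d j).toFun x = cutoff Plane n x • fderiv ℝ m x (planeBasis j)
        + fderiv ℝ (cutoff Plane n) x (planeBasis j) • m x := by
      intro n x
      simp only [TestFun.d, TestFun.lineD, φ]
      rw [fderiv_fun_smul ((contDiff_cutoff n).differentiable (by simp) x)
        (hm.differentiable (by simp) x)]
      simp
    have hDle : ∀ n x, ‖fderiv ℝ (cutoff Plane n) x (planeBasis j)‖ ≤ C * ((n : ℝ) + 1)⁻¹ := by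
      intro n x
      refine ((fderiv ℝ (cutoff Plane n) x).le_opNorm _).trans ?_
      rw [norm_planeBasis, mul_one]
      exact hC n x
    refine tendsto_planeL2_of_dominated
      (g := fun x => ‖‖fderiv ℝ m x (planeBasis j)‖ + C * ‖m x‖‖ₑ) ?_ ?_ ?_
    · rw [← eLpNorm_two_sq]
      exact ENNReal.pow_ne_top ((hj j).norm.add (h0.norm.const_mul C)).eLpNorm_ne_top
    · intro n
      filter_upwards [((φ n).d j).coeFn_l2] with x hx
      rw [hx, hd]
      refine enorm_le_iff_norm_le.2 ?_
      rw [Real.norm_of_nonneg (by positivity)]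
      refine (norm_add_le _ _).trans (add_le_add ?_ ?_)
      · rw [norm_smul, Real.norm_of_nonneg (cutoff_nonneg n x)]
        exact mul_le_of_le_one_left (norm_nonneg _) (cutoff_le_one n x)
      · rw [norm_smul]
        refine mul_le_mul_of_nonneg_right ((hDle n x).trans ?_) (norm_nonneg _)
        refine mul_le_of_le_one_right hC0 (inv_le_one_of_one_le₀ ?_)
        simp
    · have hall : ∀ᵐ x, ∀ n, ((φ n).d j).l2 x = ((φ n).d j).toFun x :=
        ae_all_iff.2 fun n => ((φ n).d j).coeFn_l2
      filter_upwards [hall, (hj j).coeFn_toLp] with x h1 h2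
      simp_rw [h1, h2, hd]
      have h3 : Tendsto (fun n => fderiv ℝ (cutoff Plane n) x (planeBasis j)) atTop (𝓝 0) := by
        refine squeeze_zero_norm (fun n => hDle n x) ?_
        simpa using (tendsto_one_div_add_atTop_nhds_zero_nat (𝕜 := ℝ)).const_mul C
      simpa using ((tendsto_cutoff x).smul_const (fderiv ℝ m x (planeBasis j))).add
        (h3.smul_const (m x))
  have hlim : Tendsto (fun n => (φ n).jet) atTop (𝓝 (h0.toLp m, fun j => (hj j).toLp _)) :=
    hφ0.prodMk_nhds (tendsto_pi_nhds.2 hφj)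
  obtain ⟨n, hn⟩ := (Metric.tendsto_nhds.1 hlim ε hε).exists
  exact ⟨φ n, by rwa [dist_eq_norm] at hn⟩

lemma jet_norm_lt {p : PlaneJet} {ε : ℝ} (hε : 0 < ε) (h0 : ‖p.1‖ < ε) (h : ∀ j, ‖p.2 j‖ < ε) :
    ‖p‖ < ε := by
  rw [Prod.norm_def]
  exact max_lt h0 ((pi_norm_lt_iff hε).2 h)

/-- Test functions are dense in `H¹`. -/
lemma exists_testFun_near (v : sobolevH1) {ε : ℝ} (hε : 0 < ε) :
    ∃ φ : TestFun, ‖φ.jet - v.1‖ < ε := by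
  have hcont : ∀ w : PlaneL2, ∃ δ > 0, ∀ y : Plane, ‖y‖ < δ → ‖shiftL2 (-y) w - w‖ ≤ ε / 4 := by
    intro w
    have h := ((continuous_shiftL2 w).comp continuous_neg).tendsto 0
    simp only [Function.comp_def, neg_zero, shiftL2_zero] at h
    obtain ⟨δ, hδ, h⟩ := Metric.tendsto_nhds_nhds.1 h (ε / 4) (by positivity)
    refine ⟨δ, hδ, fun y hy => ?_⟩
    have := h (x := y) (by simpa using hy)
    rw [dist_eq_norm] at this
    exact this.le
  obtain ⟨δ0, hδ0, H0⟩ := hcont v.1.1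
  choose δ hδ H using fun j => hcont (v.1.2 j)
  -- A common mollification radius for v and its two derivatives. Mollifying costs less than ε/2 (at
  -- most ε/4 in each component), and cutting off costs the other ε/2.
  let r : ℝ := min δ0 (min (δ 0) (δ 1))
  have hr : 0 < r := lt_min hδ0 (lt_min (hδ 0) (hδ 1))
  let b : ContDiffBump (0 : Plane) := ⟨r / 2, r, by positivity, by linarith⟩
  let ρ : Plane → ℝ := b.normed volume
  have hρs : ContDiff ℝ ∞ ρ := b.contDiff_normed
  have hρc : HasCompactSupport ρ := b.hasCompactSupport_normed
  have hsupp : ∀ y ∈ Function.support ρ, ‖y‖ < r := by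
    intro y hy
    rw [show ρ = b.normed volume from rfl, b.support_normed_eq] at hy
    simpa using hy
  have hrj : ∀ j, r ≤ δ j := by
    intro j
    fin_cases j
    · exact (min_le_right _ _).trans (min_le_left _ _)
    · exact (min_le_right _ _).trans (min_le_right _ _)
  have hmol : ∀ w : PlaneL2, (∀ y : Plane, ‖y‖ < r → ‖shiftL2 (-y) w - w‖ ≤ ε / 4) →
      ∃ h : MemLp (mollify ρ w) 2 volume, ‖h.toLp _ - w‖ < ε / 2 := by
    intro w hw
    have h1 := enorm_mollify_sub_le hρs.continuous hρc (fun x => b.nonneg_normed x)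
      b.integral_normed w (ε := ENNReal.ofReal (ε / 4)) (fun y hy => by
        rw [← ofReal_norm]
        exact ENNReal.ofReal_le_ofReal (hw y (hsupp y hy)))
    have h2 : MemLp (fun x => mollify ρ w x - w x) 2 volume := by
      refine ⟨(contDiff_mollify hρs hρc w).continuous.aestronglyMeasurable.sub
        (Lp.aestronglyMeasurable w), ?_⟩
      have : eLpNorm (fun x => mollify ρ w x - w x) 2 volume ^ 2 < ⊤ := by
        rw [eLpNorm_two_sq]
        exact h1.trans_lt (by simp)
      exact lt_top_iff_ne_top.2 fun h => by simp [h] at this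
    have h3 : MemLp (mollify ρ w) 2 volume := by
      refine (memLp_congr_ae (Eventually.of_forall fun x => ?_)).1 (h2.add (Lp.memLp w))
      simp
    refine ⟨h3, ?_⟩
    have h4 : ‖h3.toLp _ - w‖ₑ ^ 2 ≤ ENNReal.ofReal (ε / 4) ^ 2 := by
      rw [enorm_sub_toLp_sq]; exact h1
    have h5 : ‖h3.toLp _ - w‖ₑ ≤ ENNReal.ofReal (ε / 4) :=
      (ENNReal.pow_le_pow_left_iff (by norm_num)).1 h4
    rw [← ofReal_norm, ENNReal.ofReal_le_ofReal_iff (by positivity)] at h5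
    linarith
  obtain ⟨m0, h0⟩ := hmol v.1.1 (fun y hy => H0 y (hy.trans_le (min_le_left _ _)))
  choose m hm using fun j => hmol (v.1.2 j) (fun y hy => H j y (hy.trans_le (hrj j)))
  have hfd : ∀ j, (fun x => fderiv ℝ (mollify ρ v.1.1) x (planeBasis j)) = mollify ρ (v.1.2 j) :=
    fun j => funext fun x => fderiv_mollify v.2 hρs hρc j x
  have hj : ∀ j, MemLp (fun x => fderiv ℝ (mollify ρ v.1.1) x (planeBasis j)) 2 volume :=
    fun j => by rw [hfd j]; exact m j
  obtain ⟨φ, hφ⟩ := exists_testFun_near_smooth (contDiff_mollify hρs hρc v.1.1) m0 hj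
    (half_pos hε)
  refine ⟨φ, ?_⟩
  have hclose : ‖((m0.toLp _, fun j => (hj j).toLp _) : PlaneJet) - v.1‖ < ε / 2 := by
    refine jet_norm_lt (half_pos hε) h0 fun j => ?_
    have e : (hj j).toLp _ = (m j).toLp _ := by
      congr 1
      exact hfd j
    change ‖(hj j).toLp _ - v.1.2 j‖ < _
    rw [e]
    exact hm j
  calc ‖φ.jet - v.1‖ = ‖(φ.jet - (m0.toLp _, fun j => (hj j).toLp _))
        + (((m0.toLp _, fun j => (hj j).toLp _) : PlaneJet) - v.1)‖ := by
        rw [sub_add_sub_cancel]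
    _ < ε / 2 + ε / 2 := (norm_add_le _ _).trans_lt (add_lt_add hφ hclose)
    _ = ε := by ring

/-- The element of `H¹` given by a test function. -/
def TestFun.h1 (φ : TestFun) : sobolevH1 := ⟨φ.jet, φ.jet_mem⟩

lemma denseRange_testFun : DenseRange TestFun.h1 := by
  intro v
  rw [Metric.mem_closure_iff]
  intro ε hε
  obtain ⟨φ, hφ⟩ := exists_testFun_near v hε
  refine ⟨φ.h1, mem_range_self _, ?_⟩
  rw [dist_comm, dist_eq_norm]
  exact hφ

lemma exists_seq_testFun (v : sobolevH1) : ∃ φ : ℕ → TestFun,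
    Tendsto (fun n => (φ n).h1) atTop (𝓝 v) := by
  choose φ hφ using fun n : ℕ => exists_testFun_near v (Nat.one_div_pos_of_nat (α := ℝ) (n := n))
  refine ⟨φ, tendsto_iff_norm_sub_tendsto_zero.2 ?_⟩
  exact squeeze_zero (fun _ => norm_nonneg _) (fun n => (hφ n).le)
    tendsto_one_div_add_atTop_nhds_zero_nat

/-! ### Difference quotients of H¹ functions. -/

lemma continuous_h1_fst : Continuous fun v : sobolevH1 => v.1.1 :=
  continuous_fst.comp continuous_subtype_val

lemma continuous_h1_snd (j : Fin 2) : Continuous fun v : sobolevH1 => v.1.2 j :=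
  (continuous_apply j).comp (continuous_snd.comp continuous_subtype_val)

lemma continuous_shiftL2_uncurry : Continuous fun p : Plane × PlaneL2 => shiftL2 p.1 p.2 := by
  let g : Plane × PlaneL2 → C(Plane, Plane) := fun p => ⟨fun x => x + p.1, by fun_prop⟩
  have hg : Continuous g := ContinuousMap.continuous_of_continuous_uncurry _ (by
    simp only [g, Function.uncurry_def, ContinuousMap.coe_mk]; fun_prop)
  exact Continuous.compMeasurePreservingLp (f := fun p : Plane × PlaneL2 => p.2) (g := g)
    continuous_snd hg (fun p => measurePreserving_add_right volume p.1) (by simp)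

/-- The difference quotient in the direction `j`. -/
def diffQuot (j : Fin 2) (h : ℝ) (v : PlaneL2) : PlaneL2 :=
  h⁻¹ • (shiftL2 (h • planeBasis j) v - v)

lemma coeFn_diffQuot (j : Fin 2) (h : ℝ) (v : PlaneL2) :
    diffQuot j h v =ᵐ[volume] fun x => h⁻¹ • (v (x + h • planeBasis j) - v x) := by
  filter_upwards [Lp.coeFn_smul h⁻¹ (shiftL2 (h • planeBasis j) v - v),
    Lp.coeFn_sub (shiftL2 (h • planeBasis j) v) v, coeFn_shiftL2 (h • planeBasis j) v]
    with x e1 e2 e3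
  rw [diffQuot, e1, Pi.smul_apply, e2, Pi.sub_apply, e3]

lemma coeFn_diffQuot_testFun (j : Fin 2) (h : ℝ) (φ : TestFun) :
    diffQuot j h φ.l2 =ᵐ[volume]
      fun x => h⁻¹ • (φ.toFun (x + h • planeBasis j) - φ.toFun x) := by
  filter_upwards [coeFn_diffQuot j h φ.l2, φ.coeFn_l2,
    ae_comp_add φ.coeFn_l2 (h • planeBasis j)] with x e1 e2 e3
  rw [e1, e2, e3]

/-- Along any sequence of steps, dominated convergence applies: once |h| ≤ 1 the quotients are
supported in a ball slightly larger than one containing the support of φ, and there they are bounded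
by sup|∂ⱼφ|. -/
lemma tendsto_diffQuot_testFun (φ : TestFun) (j : Fin 2) :
    Tendsto (fun h => diffQuot j h φ.l2) (𝓝[≠] 0) (𝓝 (φ.d j).l2) := by
  refine tendsto_of_seq_tendsto fun t ht => ?_
  have ht0 : Tendsto t atTop (𝓝 0) := ht.mono_right nhdsWithin_le_nhds
  have hne : ∀ᶠ n in atTop, t n ≠ 0 := ht.eventually self_mem_nhdsWithin
  have hle : ∀ᶠ n in atTop, |t n| ≤ 1 := by
    filter_upwards [Metric.tendsto_nhds.1 ht0 1 one_pos] with n hn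
    simpa using hn.le
  -- An initial segment is dropped so that all steps are nonzero and at most 1 in size.
  obtain ⟨N, hN⟩ := eventually_atTop.1 (hne.and hle)
  rw [← tendsto_add_atTop_iff_nat N]
  obtain ⟨C, hC⟩ := (φ.d j).compact.exists_bound_of_continuous (φ.d j).continuous
  have hC0 : 0 ≤ C := (norm_nonneg _).trans (hC 0)
  obtain ⟨R, hR⟩ := φ.compact.isCompact.isBounded.subset_closedBall 0
  have hvan : ∀ x : Plane, R < ‖x‖ → φ.toFun x = 0 := fun x hx => by
    by_contra h
    have := hR (subset_tsupport _ h)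
    rw [mem_closedBall_zero_iff] at this
    linarith
  have hline : ∀ (x : Plane) (s : ℝ), HasDerivAt (fun s : ℝ => φ.toFun (x + s • planeBasis j))
      ((φ.d j).toFun (x + s • planeBasis j)) s := by
    intro x s
    have h1 := (φ.differentiable (x + s • planeBasis j)).hasFDerivAt.comp_hasDerivAt s
      ((((hasDerivAt_id s).smul_const (planeBasis j)).const_add x))
    simpa [TestFun.d, TestFun.lineD, Function.comp_def] using h1
  refine tendsto_planeL2_of_dominated
    (g := (Metric.closedBall (0 : Plane) (R + 1)).indicator fun _ => ENNReal.ofReal C) ?_ ?_ ?_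
  · have : ∀ x, (Metric.closedBall (0 : Plane) (R + 1)).indicator
        (fun _ => ENNReal.ofReal C) x ^ 2
        = (Metric.closedBall (0 : Plane) (R + 1)).indicator (fun _ => ENNReal.ofReal C ^ 2) x := by
      intro x
      by_cases hx : x ∈ Metric.closedBall (0 : Plane) (R + 1) <;> simp [hx]
    simp_rw [this]
    rw [lintegral_indicator Metric.isClosed_closedBall.measurableSet, setLIntegral_const]
    exact ENNReal.mul_ne_top (by simp) (isCompact_closedBall _ _).measure_lt_top.ne
  · intro n
    obtain ⟨h0, h1⟩ := hN (n + N) (by omega)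
    set s := t (n + N)
    filter_upwards [coeFn_diffQuot_testFun j s φ] with x e1
    rw [Function.comp_apply, e1]
    by_cases hx : x ∈ Metric.closedBall (0 : Plane) (R + 1)
    · rw [indicator_of_mem hx, ← ofReal_norm]
      refine ENNReal.ofReal_le_ofReal ?_
      have := Convex.norm_image_sub_le_of_norm_hasDerivWithin_le (s := univ)
        (f := fun s : ℝ => φ.toFun (x + s • planeBasis j)) (C := C) (x := 0) (y := s)
        (fun r _ => (hline x r).hasDerivWithinAt) (fun r _ => hC _) convex_univ
        (mem_univ _) (mem_univ _)
      simp only [zero_smul, add_zero, sub_zero] at this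
      rw [norm_smul, norm_inv, inv_mul_le_iff₀ (norm_pos_iff.2 h0), mul_comm]
      exact this
    · rw [indicator_of_notMem hx]
      rw [mem_closedBall_zero_iff, not_le] at hx
      have h2 : R < ‖x + s • planeBasis j‖ := by
        have h3 : ‖x‖ ≤ ‖x + s • planeBasis j‖ + ‖s • planeBasis j‖ := by
          simpa using norm_sub_le (x + s • planeBasis j) (s • planeBasis j)
        rw [norm_smul, norm_planeBasis, mul_one, Real.norm_eq_abs] at h3
        linarith
      rw [hvan _ h2, hvan x (by linarith)]
      simp
  · have hall : ∀ᵐ x, ∀ n, diffQuot j (t (n + N)) φ.l2 x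
        = (t (n + N))⁻¹ • (φ.toFun (x + t (n + N) • planeBasis j) - φ.toFun x) :=
      ae_all_iff.2 fun n => coeFn_diffQuot_testFun j _ φ
    filter_upwards [hall, (φ.d j).coeFn_l2] with x h1 h2
    simp only [Function.comp_apply, h1, h2]
    have h3 := hasDerivAt_iff_tendsto_slope_zero.1 (hline x 0)
    simp only [zero_add, zero_smul, add_zero] at h3
    exact h3.comp (ht.comp (tendsto_add_atTop_nat N))

lemma continuous_integral_shiftL2 (j : Fin 2) (h : ℝ) :
    Continuous fun w : PlaneL2 => ∫ s in (0 : ℝ)..h, shiftL2 (s • planeBasis j) w := by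
  refine intervalIntegral.continuous_parametric_intervalIntegral_of_continuous' ?_ 0 h
  have h1 : Continuous fun p : PlaneL2 × ℝ => (p.2 • planeBasis j, p.1) := by fun_prop
  have h2 := continuous_shiftL2_uncurry.comp h1
  simp only [Function.comp_def] at h2
  exact h2

lemma shiftL2_real_smul (y : Plane) (c : ℝ) (v : PlaneL2) :
    shiftL2 y (c • v) = c • shiftL2 y v :=
  (shiftL2 y).toLinearMap.map_smul_of_tower c v

/-- The group law of translations reduces the derivative at s to the one at 0. -/
lemma hasDerivAt_shift_testFun (φ : TestFun) (j : Fin 2) (s : ℝ) :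
    HasDerivAt (fun h : ℝ => shiftL2 (h • planeBasis j) φ.l2)
      (shiftL2 (s • planeBasis j) (φ.d j).l2) s := by
  rw [hasDerivAt_iff_tendsto_slope_zero]
  refine (((shiftL2 (s • planeBasis j)).continuous.tendsto _).comp
    (tendsto_diffQuot_testFun φ j)).congr fun h => ?_
  rw [Function.comp_apply, diffQuot, shiftL2_real_smul, map_sub, shiftL2_shiftL2, ← add_smul]

/-- The fundamental theorem of calculus along translations, in `H¹`. -/
lemma shiftL2_sub_eq_integral (v : sobolevH1) (j : Fin 2) (h : ℝ) :
    shiftL2 (h • planeBasis j) v.1.1 - v.1.1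
      = ∫ s in (0 : ℝ)..h, shiftL2 (s • planeBasis j) (v.1.2 j) := by
  -- Both sides are continuous in v for the H¹ norm, so test functions suffice.
  refine denseRange_testFun.induction_on (p := fun v : sobolevH1 =>
    shiftL2 (h • planeBasis j) v.1.1 - v.1.1
      = ∫ s in (0 : ℝ)..h, shiftL2 (s • planeBasis j) (v.1.2 j)) v ?_ fun φ => ?_
  · refine isClosed_eq (((shiftL2 _).continuous.comp continuous_h1_fst).sub continuous_h1_fst) ?_
    exact (continuous_integral_shiftL2 j h).comp (continuous_h1_snd j)
  · change shiftL2 (h • planeBasis j) φ.l2 - φ.l2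
      = ∫ s in (0 : ℝ)..h, shiftL2 (s • planeBasis j) (φ.d j).l2
    rw [intervalIntegral.integral_eq_sub_of_hasDerivAt
      (fun s _ => hasDerivAt_shift_testFun φ j s)]
    · rw [zero_smul, shiftL2_zero]
    · exact ((continuous_shiftL2 _).comp
        (continuous_id.smul continuous_const)).intervalIntegrable _ _

/-- The quotient is an average of translates of ∂ⱼv, and translations are isometries. For h = 0 the
convention 0⁻¹ = 0 makes the quotient vanish. -/
lemma norm_diffQuot_le (v : sobolevH1) (j : Fin 2) (h : ℝ) :
    ‖diffQuot j h v.1.1‖ ≤ ‖v.1.2 j‖ := by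
  by_cases hh : h = 0
  · simp [diffQuot, hh]
  rw [diffQuot, shiftL2_sub_eq_integral, norm_smul, norm_inv,
    inv_mul_le_iff₀ (norm_pos_iff.2 hh), mul_comm, Real.norm_eq_abs]
  refine (intervalIntegral.norm_integral_le_of_norm_le_const (C := ‖v.1.2 j‖) fun s _ => ?_).trans
    (by simp)
  rw [LinearIsometry.norm_map]

/-- The quotient is the slope at 0 of the primitive of s ↦ τ_s ∂ⱼv, where τ_s is translation by s in
direction j; this integrand is continuous in L². Every passage from difference quotients to
derivatives below uses this limit. -/
lemma tendsto_diffQuot (v : sobolevH1) (j : Fin 2) :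
    Tendsto (fun h => diffQuot j h v.1.1) (𝓝[≠] 0) (𝓝 (v.1.2 j)) := by
  have hc : Continuous fun s : ℝ => shiftL2 (s • planeBasis j) (v.1.2 j) :=
    (continuous_shiftL2 _).comp (continuous_id.smul continuous_const)
  have hd := intervalIntegral.integral_hasDerivAt_right (hc.intervalIntegrable 0 0)
    (hc.stronglyMeasurableAtFilter _ _) hc.continuousAt
  rw [hasDerivAt_iff_tendsto_slope_zero] at hd
  simp only [zero_smul, shiftL2_zero, zero_add, intervalIntegral.integral_same, sub_zero] at hd
  refine hd.congr fun h => ?_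
  rw [diffQuot, shiftL2_sub_eq_integral]

/-! ### Polar coordinates and the kernels |y|⁻¹ and |y|⁻². -/

/-- The arclength measure on the unit circle. -/
abbrev circleMeasure : Measure (Metric.sphere (0 : Plane) 1) := (volume : Measure Plane).toSphere

/-- The total arclength. -/
def circleLength : ℝ≥0∞ := circleMeasure univ

lemma circleLength_ne_top : circleLength ≠ ⊤ := measure_ne_top _ _

lemma circleLength_ne_zero : circleLength ≠ 0 := by
  rw [circleLength, Measure.measure_univ_ne_zero]
  exact Measure.toSphere_ne_zero _

/-- Integration in polar coordinates. -/
lemma lintegral_polar {F : Plane → ℝ≥0∞} (hF : Measurable F) :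
    ∫⁻ y, F y
      = ∫⁻ θ, (∫⁻ r in Ioi (0 : ℝ), ENNReal.ofReal r * F (r • (θ : Plane))) ∂circleMeasure := by
  have h1 : ∫⁻ y, F y = ∫⁻ y : ({0}ᶜ : Set Plane), F y ∂(volume.comap Subtype.val) := by
    rw [lintegral_subtype_comap (MeasurableSet.singleton 0).compl, restrict_compl_singleton]
  have hmp := (volume : Measure Plane).measurePreserving_homeomorphUnitSphereProd
  have h2 := hmp.lintegral_comp_emb (homeomorphUnitSphereProd Plane).measurableEmbedding
    (fun p : Metric.sphere (0 : Plane) 1 × Ioi (0 : ℝ) => F ((p.2 : ℝ) • (p.1 : Plane)))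
  have h3 : ∀ y : ({0}ᶜ : Set Plane), F (((homeomorphUnitSphereProd Plane y).2 : ℝ) •
      ((homeomorphUnitSphereProd Plane y).1 : Plane)) = F y := by
    intro y
    have hy : ‖(y : Plane)‖ ≠ 0 := norm_ne_zero_iff.2 y.2
    simp [smul_smul, hy]
  simp_rw [h3] at h2
  have hFm : Measurable fun p : Metric.sphere (0 : Plane) 1 × Ioi (0 : ℝ) =>
      F ((p.2 : ℝ) • (p.1 : Plane)) :=
    hF.comp ((measurable_subtype_coe.comp measurable_snd).smul
      (measurable_subtype_coe.comp measurable_fst))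
  rw [h1, h2, lintegral_prod _ hFm.aemeasurable]
  refine lintegral_congr fun θ => ?_
  have hdim : Module.finrank ℝ Plane - 1 = 1 := by simp
  have hm2 : Measurable fun r : ℝ => F (r • (θ : Plane)) :=
    hF.comp (measurable_id.smul measurable_const)
  rw [hdim, Measure.volumeIoiPow, ← lintegral_subtype_comap measurableSet_Ioi]
  refine (lintegral_withDensity_eq_lintegral_mul _ (by fun_prop)
    (g := fun r : Ioi (0 : ℝ) => F ((r : ℝ) • (θ : Plane)))
    (hm2.comp measurable_subtype_coe)).trans ?_
  simp

lemma lintegral_polar_radial {k : ℝ → ℝ≥0∞} (hk : Measurable k) :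
    ∫⁻ y : Plane, k ‖y‖ = circleLength * ∫⁻ r in Ioi (0 : ℝ), ENNReal.ofReal r * k r := by
  rw [lintegral_polar (F := fun y : Plane => k ‖y‖) (hk.comp measurable_norm)]
  have : ∀ θ : Metric.sphere (0 : Plane) 1,
      ∫⁻ r in Ioi (0 : ℝ), ENNReal.ofReal r * k ‖r • (θ : Plane)‖
        = ∫⁻ r in Ioi (0 : ℝ), ENNReal.ofReal r * k r := by
    intro θ
    refine setLIntegral_congr_fun measurableSet_Ioi fun r hr => ?_
    have hθ : ‖(θ : Plane)‖ = 1 := by simp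
    simp [norm_smul, hθ, abs_of_pos (mem_Ioi.1 hr)]
  simp_rw [this]
  rw [lintegral_const, mul_comm, circleLength]

/-- The kernel `|y|⁻¹` on the ball of radius `r`. -/
lemma lintegral_inv_norm_ball (r : ℝ) :
    ∫⁻ y : Plane, (Iio r).indicator (fun s => ENNReal.ofReal s⁻¹) ‖y‖
      = circleLength * ENNReal.ofReal r := by
  rw [lintegral_polar_radial (by measurability)]
  congr 1
  have : ∀ s ∈ Ioi (0 : ℝ), ENNReal.ofReal s * (Iio r).indicator (fun s => ENNReal.ofReal s⁻¹) s
      = (Iio r).indicator (fun _ => 1) s := by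
    intro s hs
    by_cases h : s ∈ Iio r
    · rw [indicator_of_mem h, indicator_of_mem h, ← ENNReal.ofReal_mul (le_of_lt hs),
        mul_inv_cancel₀ (ne_of_gt hs), ENNReal.ofReal_one]
    · simp [h]
  rw [setLIntegral_congr_fun measurableSet_Ioi this, lintegral_indicator measurableSet_Iio,
    lintegral_one, Measure.restrict_apply_univ, Measure.restrict_apply measurableSet_Iio,
    Iio_inter_Ioi, Real.volume_Ioo, sub_zero]

/-- The kernel `|y|⁻²` on an annulus. -/
lemma lintegral_inv_norm_sq_annulus {r : ℝ} (hr : 0 < r) (hr1 : r ≤ 1) :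
    ∫⁻ y : Plane, (Icc r 1).indicator (fun s => ENNReal.ofReal (s⁻¹ ^ 2)) ‖y‖
      = circleLength * ENNReal.ofReal (Real.log (1 / r)) := by
  rw [lintegral_polar_radial (by measurability)]
  congr 1
  have : ∀ s ∈ Ioi (0 : ℝ), ENNReal.ofReal s *
      (Icc r 1).indicator (fun s => ENNReal.ofReal (s⁻¹ ^ 2)) s
      = (Icc r 1).indicator (fun s => ENNReal.ofReal s⁻¹) s := by
    intro s hs
    by_cases h : s ∈ Icc r 1
    · rw [indicator_of_mem h, indicator_of_mem h, ← ENNReal.ofReal_mul (le_of_lt hs)]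
      congr 1
      have : s ≠ 0 := ne_of_gt hs
      field_simp
    · simp [h]
  rw [setLIntegral_congr_fun measurableSet_Ioi this, lintegral_indicator measurableSet_Icc,
    Measure.restrict_restrict measurableSet_Icc,
    inter_eq_self_of_subset_left (show Icc r 1 ⊆ Ioi 0 from fun s hs => lt_of_lt_of_le hr hs.1)]
  rw [← ofReal_integral_eq_lintegral_ofReal, integral_Icc_eq_integral_Ioc,
    ← intervalIntegral.integral_of_le hr1, integral_inv_of_pos hr one_pos]
  · refine ContinuousOn.integrableOn_Icc fun s hs => ?_
    exact (continuousAt_inv₀ (hr.trans_le hs.1).ne').continuousWithinAt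
  · filter_upwards [ae_restrict_mem measurableSet_Icc] with s hs
    exact inv_nonneg.2 (hr.le.trans hs.1)

/-! ### Pointwise potential estimate and tails of the distribution function. -/

namespace TestFun

/-- `|φ| + |∂₀φ| + |∂₁φ|`. -/
def size (φ : TestFun) (x : Plane) : ℝ :=
  ‖φ.toFun x‖ + ‖(φ.d 0).toFun x‖ + ‖(φ.d 1).toFun x‖

lemma continuous_size (φ : TestFun) : Continuous φ.size :=
  (φ.continuous.norm.add (φ.d 0).continuous.norm).add (φ.d 1).continuous.norm

lemma size_nonneg (φ : TestFun) (x : Plane) : 0 ≤ φ.size x := by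
  unfold size; positivity

lemma measurable_size (φ : TestFun) : Measurable fun x => ENNReal.ofReal (φ.size x) :=
  φ.continuous_size.measurable.ennreal_ofReal

lemma norm_fderiv_apply_le (φ : TestFun) (x y : Plane) (hy : ‖y‖ ≤ 1) :
    ‖fderiv ℝ φ.toFun x y‖ ≤ ‖(φ.d 0).toFun x‖ + ‖(φ.d 1).toFun x‖ := by
  have hdec : y = y 0 • planeBasis 0 + y 1 • planeBasis 1 := by
    ext i
    fin_cases i <;> simp [planeBasis]
  have hle : ∀ i, |y i| ≤ 1 := fun i => (PiLp.norm_apply_le y i).trans hy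
  have h1 : fderiv ℝ φ.toFun x y = y 0 • (φ.d 0).toFun x + y 1 • (φ.d 1).toFun x := by
    conv_lhs => rw [hdec]
    simp [d, lineD]
  rw [h1]
  refine (norm_add_le _ _).trans (add_le_add ?_ ?_) <;>
  · rw [norm_smul, Real.norm_eq_abs]
    exact mul_le_of_le_one_left (norm_nonneg _) (hle _)

/-- Integrating along a ray. -/
lemma enorm_le_lintegral_ray (φ : TestFun) (x θ : Plane) (hθ : ‖θ‖ = 1) :
    ‖φ.toFun x‖ₑ ≤ ∫⁻ r in Ioc (0 : ℝ) 1, ENNReal.ofReal (φ.size (x + r • θ)) := by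
  have hline : ∀ r : ℝ, HasDerivAt (fun r : ℝ => φ.toFun (x + r • θ))
      (fderiv ℝ φ.toFun (x + r • θ) θ) r := by
    intro r
    have h1 := (φ.differentiable (x + r • θ)).hasFDerivAt.comp_hasDerivAt r
      ((((hasDerivAt_id r).smul_const θ).const_add x))
    simpa [Function.comp_def] using h1
  -- The factor 1 − r vanishes at r = 1, so integration over [0, 1] leaves only the boundary value
  -- φ(x). Its derivative produces the zeroth-order term in `size`.
  have hk : ∀ r : ℝ, HasDerivAt (fun r : ℝ => (1 - r) • φ.toFun (x + r • θ))
      ((1 - r) • fderiv ℝ φ.toFun (x + r • θ) θ + (-1 : ℝ) • φ.toFun (x + r • θ)) r :=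
    fun r => ((hasDerivAt_id r).const_sub 1).smul (hline r)
  have hcont : Continuous fun r : ℝ => (1 - r) • fderiv ℝ φ.toFun (x + r • θ) θ
      + (-1 : ℝ) • φ.toFun (x + r • θ) := by
    have h1 := (φ.lineD θ).continuous
    simp only [lineD] at h1
    have h2 := φ.continuous
    fun_prop
  have h := intervalIntegral.integral_eq_sub_of_hasDerivAt (a := 0) (b := 1) (fun r _ => hk r)
    (hcont.intervalIntegrable _ _)
  simp only [sub_self, zero_smul, zero_sub, sub_zero, one_smul, add_zero] at h
  rw [← enorm_neg, ← h, intervalIntegral.integral_of_le zero_le_one]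
  refine (enorm_integral_le_lintegral_enorm _).trans ?_
  refine setLIntegral_mono' measurableSet_Ioc fun r hr => ?_
  rw [← ofReal_norm]
  refine ENNReal.ofReal_le_ofReal ?_
  refine (norm_add_le _ _).trans ?_
  rw [norm_smul, norm_smul, Real.norm_of_nonneg (by linarith [hr.2] : (0 : ℝ) ≤ 1 - r)]
  have h3 := φ.norm_fderiv_apply_le (x + r • θ) θ hθ.le
  have h4 : (1 - r) * ‖fderiv ℝ φ.toFun (x + r • θ) θ‖ ≤ ‖fderiv ℝ φ.toFun (x + r • θ) θ‖ :=
    mul_le_of_le_one_left (norm_nonneg _) (by linarith [hr.1])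
  simp only [norm_neg, norm_one, one_mul, size]
  linarith

/-- The potential estimate. -/
lemma enorm_le_lintegral_kernel (φ : TestFun) (x : Plane) :
    circleLength * ‖φ.toFun x‖ₑ ≤ ∫⁻ y : Plane,
      (Iic (1 : ℝ)).indicator (fun s => ENNReal.ofReal s⁻¹) ‖y‖
        * ENNReal.ofReal (φ.size (x + y)) := by
  have hm : Measurable fun y : Plane => (Iic (1 : ℝ)).indicator (fun s => ENNReal.ofReal s⁻¹) ‖y‖
        * ENNReal.ofReal (φ.size (x + y)) := by
    refine Measurable.mul ?_ (φ.measurable_size.comp (measurable_const.add measurable_id))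
    exact (Measurable.indicator (by fun_prop) measurableSet_Iic).comp measurable_norm
  -- The ray estimate is integrated over all directions; the Jacobian r cancels the kernel r⁻¹.
  rw [lintegral_polar hm, mul_comm, circleLength, ← lintegral_const]
  refine lintegral_mono fun θ => ?_
  have hθ : ‖(θ : Plane)‖ = 1 := by simp
  refine (φ.enorm_le_lintegral_ray x θ hθ).trans ?_
  rw [← lintegral_indicator measurableSet_Ioc, ← lintegral_indicator measurableSet_Ioi]
  refine lintegral_mono fun r => ?_
  by_cases hr : r ∈ Ioc (0 : ℝ) 1
  · have h0 : r ∈ Ioi (0 : ℝ) := hr.1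
    rw [indicator_of_mem hr, indicator_of_mem h0]
    have hn : ‖r • (θ : Plane)‖ = r := by rw [norm_smul, hθ, mul_one, Real.norm_of_nonneg hr.1.le]
    rw [hn, indicator_of_mem (show r ∈ Iic (1 : ℝ) from hr.2), ← mul_assoc,
      ← ENNReal.ofReal_mul hr.1.le, mul_inv_cancel₀ hr.1.ne', ENNReal.ofReal_one, one_mul]
  · rw [indicator_of_notMem hr]; exact zero_le

end TestFun

namespace TestFun

lemma enorm_l2 (φ : TestFun) : ‖φ.l2‖ₑ = eLpNorm φ.toFun 2 volume := by
  rw [l2, Lp.enorm_toLp]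

lemma enorm_l2_le (φ : TestFun) : ‖φ.l2‖ₑ ≤ ‖φ.h1‖ₑ := by
  refine enorm_le_iff_norm_le.2 ?_
  exact norm_fst_le φ.jet

lemma enorm_d_le (φ : TestFun) (j : Fin 2) : ‖(φ.d j).l2‖ₑ ≤ ‖φ.h1‖ₑ := by
  refine enorm_le_iff_norm_le.2 ?_
  exact (norm_le_pi_norm φ.jet.2 j).trans (norm_snd_le φ.jet)

/-- The squared `L²` norm of `φ.size`. -/
def sizeSq (φ : TestFun) : ℝ≥0∞ := ∫⁻ x, ENNReal.ofReal (φ.size x) ^ 2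

lemma sizeSq_le (φ : TestFun) : φ.sizeSq ≤ 9 * ‖φ.h1‖ₑ ^ 2 := by
  have e : φ.sizeSq = eLpNorm φ.size 2 volume ^ 2 := by
    rw [eLpNorm_two_sq]
    refine lintegral_congr fun x => ?_
    rw [Real.enorm_eq_ofReal (φ.size_nonneg x)]
  have h : eLpNorm φ.size 2 volume ≤ 3 * ‖φ.h1‖ₑ := by
    have m0 := φ.continuous.norm.aestronglyMeasurable (μ := (volume : Measure Plane))
    have m1 := (φ.d 0).continuous.norm.aestronglyMeasurable (μ := (volume : Measure Plane))
    have m2 := (φ.d 1).continuous.norm.aestronglyMeasurable (μ := (volume : Measure Plane))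
    have h1 := eLpNorm_add_le (m0.add m1) m2 (p := 2) (by norm_num)
    have h2 := eLpNorm_add_le m0 m1 (p := 2) (by norm_num)
    rw [eLpNorm_norm] at h1 h2
    rw [eLpNorm_norm] at h2
    rw [← enorm_l2] at h1 h2
    rw [← enorm_l2] at h2
    calc eLpNorm φ.size 2 volume ≤ _ := h1
      _ ≤ ‖φ.l2‖ₑ + ‖(φ.d 0).l2‖ₑ + ‖(φ.d 1).l2‖ₑ := by gcongr
      _ ≤ ‖φ.h1‖ₑ + ‖φ.h1‖ₑ + ‖φ.h1‖ₑ :=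
        add_le_add (add_le_add φ.enorm_l2_le (φ.enorm_d_le 0)) (φ.enorm_d_le 1)
      _ = 3 * ‖φ.h1‖ₑ := by ring
  rw [e]
  calc eLpNorm φ.size 2 volume ^ 2 ≤ (3 * ‖φ.h1‖ₑ) ^ 2 := by gcongr
    _ = 9 * ‖φ.h1‖ₑ ^ 2 := by rw [mul_pow]; norm_num

lemma lintegral_size_add (φ : TestFun) (x : Plane) :
    ∫⁻ y, ENNReal.ofReal (φ.size (x + y)) ^ 2 = φ.sizeSq :=
  lintegral_add_left_eq_self (fun y => ENNReal.ofReal (φ.size y) ^ 2) x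

/-- A tail estimate for the distribution function. -/
lemma volume_lt_norm_mul_le (φ : TestFun) {r s : ℝ} (hr : 0 < r) (hr1 : r ≤ 1) (hs : 0 < s)
    (h : circleLength * ENNReal.ofReal (Real.log (1 / r)) * φ.sizeSq
      ≤ (circleLength * ENNReal.ofReal s) ^ 2) :
    volume {x | 2 * s < ‖φ.toFun x‖} * ENNReal.ofReal s ^ 2
      ≤ ENNReal.ofReal r ^ 2 * φ.sizeSq := by
  set L := circleLength
  have hL0 : L ≠ 0 := circleLength_ne_zero
  have hLt : L ≠ ⊤ := circleLength_ne_top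
  let k1 : Plane → ℝ≥0∞ := fun y => (Iio r).indicator (fun s => ENNReal.ofReal s⁻¹) ‖y‖
  let k2 : Plane → ℝ≥0∞ := fun y => (Icc r 1).indicator (fun s => ENNReal.ofReal s⁻¹) ‖y‖
  let g : Plane → Plane → ℝ≥0∞ := fun x y => ENNReal.ofReal (φ.size (x + y))
  have hk1 : Measurable k1 :=
    (Measurable.indicator (by fun_prop) measurableSet_Iio).comp measurable_norm
  have hk2 : Measurable k2 :=
    (Measurable.indicator (by fun_prop) measurableSet_Icc).comp measurable_norm
  have hg : ∀ x, Measurable (g x) := fun x =>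
    φ.measurable_size.comp (measurable_const.add measurable_id)
  let H : Plane → ℝ≥0∞ := fun x => ∫⁻ y, k1 y * g x y
  let Q : Plane → ℝ≥0∞ := fun x => ∫⁻ y, k2 y * g x y
  have hjm : Measurable (Function.uncurry g) :=
    φ.measurable_size.comp (measurable_fst.add measurable_snd)
  have hHm : Measurable H :=
    Measurable.lintegral_prod_right (f := fun x y => k1 y * g x y)
      ((hk1.comp measurable_snd).mul hjm)
  -- The kernel is split at |y| = r: H is the near part, controlled in L², and Q is the far part,
  -- controlled pointwise.
  have hsplit : ∀ x, L * ‖φ.toFun x‖ₑ ≤ H x + Q x := by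
    intro x
    refine (φ.enorm_le_lintegral_kernel x).trans ?_
    refine le_trans (lintegral_mono fun y => ?_)
      (lintegral_add_left (hk1.mul (hg x)) fun y => k2 y * g x y).le
    rw [Pi.mul_apply, ← add_mul]
    refine mul_le_mul_left ?_ _
    by_cases h1 : ‖y‖ ≤ 1
    · rw [indicator_of_mem (show ‖y‖ ∈ Iic (1 : ℝ) from h1)]
      by_cases h2 : ‖y‖ < r
      · simp only [k1]
        rw [indicator_of_mem (show ‖y‖ ∈ Iio r from h2)]
        exact le_self_add
      · simp only [k2]
        rw [indicator_of_mem (show ‖y‖ ∈ Icc r 1 from ⟨not_lt.1 h2, h1⟩)]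
        exact le_add_self
    · rw [indicator_of_notMem (show ‖y‖ ∉ Iic (1 : ℝ) from h1)]
      exact zero_le
  have hQ : ∀ x, Q x ≤ L * ENNReal.ofReal s := by
    intro x
    let k3 : Plane → ℝ≥0∞ := fun y => (Icc r 1).indicator (fun s => ENNReal.ofReal (s⁻¹ ^ 2)) ‖y‖
    have hk3 : Measurable k3 :=
      (Measurable.indicator (by fun_prop) measurableSet_Icc).comp measurable_norm
    let n : Plane → ℝ≥0∞ := fun y => ENNReal.ofReal ‖y‖ * g x y
    have hn : Measurable n := measurable_norm.ennreal_ofReal.mul (hg x)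
    -- Written as |y|⁻² · (|y| g), the far part admits Cauchy–Schwarz with weight |y|⁻², whose mass
    -- on the annulus is L log(1/r). The hypothesis `h` is exactly what this requires.
    have e1 : ∀ y, k2 y * g x y = k3 y * n y := by
      intro y
      simp only [k2, k3, n]
      by_cases hy : ‖y‖ ∈ Icc r 1
      · have hy0 : 0 < ‖y‖ := hr.trans_le hy.1
        have h1 : ‖y‖⁻¹ = ‖y‖⁻¹ ^ 2 * ‖y‖ := by field_simp
        rw [indicator_of_mem hy, indicator_of_mem hy, ← mul_assoc]
        congr 1
        rw [← ENNReal.ofReal_mul (by positivity), ← h1]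
      · rw [indicator_of_notMem hy, indicator_of_notMem hy, zero_mul, zero_mul]
    have e2 : ∀ y, k3 y * n y ^ 2 ≤ g x y ^ 2 := by
      intro y
      simp only [k3, n]
      by_cases hy : ‖y‖ ∈ Icc r 1
      · have hy0 : 0 < ‖y‖ := hr.trans_le hy.1
        rw [indicator_of_mem hy, mul_pow, ← mul_assoc, ← ENNReal.ofReal_pow hy0.le,
          ← ENNReal.ofReal_mul (by positivity), ← mul_pow, inv_mul_cancel₀ hy0.ne']
        simp
      · rw [indicator_of_notMem hy, zero_mul]
        exact zero_le
    have h3 : Q x ^ 2 ≤ (L * ENNReal.ofReal s) ^ 2 := by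
      calc Q x ^ 2 = (∫⁻ y, k3 y * n y) ^ 2 := by simp only [Q, e1]
        _ ≤ (∫⁻ y, k3 y) * ∫⁻ y, k3 y * n y ^ 2 :=
          lintegral_mul_sq_le hk3.aemeasurable hn.aemeasurable
        _ ≤ (L * ENNReal.ofReal (Real.log (1 / r))) * φ.sizeSq := by
          refine mul_le_mul' (lintegral_inv_norm_sq_annulus hr hr1).le ?_
          exact (lintegral_mono e2).trans (φ.lintegral_size_add x).le
        _ ≤ _ := h
    exact (ENNReal.pow_le_pow_left_iff (by norm_num)).1 h3
  -- Young's inequality L¹ ⋆ L² ⊆ L²: the near kernel has mass L r.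
  have hHint : ∫⁻ x, H x ^ 2 ≤ (L * ENNReal.ofReal r) ^ 2 * φ.sizeSq := by
    calc ∫⁻ x, H x ^ 2
        ≤ ∫⁻ x, (L * ENNReal.ofReal r) * ∫⁻ y, k1 y * g x y ^ 2 := by
          refine lintegral_mono fun x => ?_
          refine (lintegral_mul_sq_le hk1.aemeasurable (hg x).aemeasurable).trans ?_
          exact mul_le_mul' (lintegral_inv_norm_ball r).le le_rfl
      _ = (L * ENNReal.ofReal r) * ∫⁻ x, ∫⁻ y, k1 y * g x y ^ 2 := by
          rw [lintegral_const_mul' _ _ (ENNReal.mul_ne_top hLt (by simp))]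
      _ = (L * ENNReal.ofReal r) * ∫⁻ y, ∫⁻ x, k1 y * g x y ^ 2 := by
          rw [lintegral_lintegral_swap]
          exact ((hk1.comp measurable_snd).mul (hjm.pow_const 2)).aemeasurable
      _ = (L * ENNReal.ofReal r) * ∫⁻ y, k1 y * φ.sizeSq := by
          congr 1
          refine lintegral_congr fun y => ?_
          have hmy : Measurable fun x => g x y ^ 2 :=
            (φ.measurable_size.comp (measurable_id.add measurable_const)).pow_const 2
          refine (lintegral_const_mul (k1 y) hmy).trans ?_
          congr 1
          exact lintegral_add_right_eq_self (fun x => ENNReal.ofReal (φ.size x) ^ 2) y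
      _ = (L * ENNReal.ofReal r) * ((L * ENNReal.ofReal r) * φ.sizeSq) := by
          rw [lintegral_mul_const _ hk1, lintegral_inv_norm_ball r]
      _ = _ := by ring
  -- Where |φ| > 2s the far part accounts for at most half, so the near part is at least L s and
  -- Chebyshev applies.
  have hsub : {x | 2 * s < ‖φ.toFun x‖} ⊆ {x | (L * ENNReal.ofReal s) ^ 2 ≤ H x ^ 2} := by
    intro x hx
    have h1 : ENNReal.ofReal s + ENNReal.ofReal s ≤ ‖φ.toFun x‖ₑ := by
      rw [← ENNReal.ofReal_add hs.le hs.le, ← ofReal_norm]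
      refine ENNReal.ofReal_le_ofReal ?_
      have : 2 * s < ‖φ.toFun x‖ := hx
      linarith
    have h2 : L * ENNReal.ofReal s + L * ENNReal.ofReal s ≤ H x + L * ENNReal.ofReal s := by
      rw [← mul_add]
      exact (mul_le_mul_right h1 L).trans ((hsplit x).trans (add_le_add le_rfl (hQ x)))
    have h3 := ENNReal.le_of_add_le_add_right (ENNReal.mul_ne_top hLt (by simp)) h2
    change (L * ENNReal.ofReal s) ^ 2 ≤ H x ^ 2
    gcongr
  have hcheb := mul_meas_ge_le_lintegral (μ := (volume : Measure Plane)) (hHm.pow_const 2)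
    ((L * ENNReal.ofReal s) ^ 2)
  have hfin : L ^ 2 * (volume {x | 2 * s < ‖φ.toFun x‖} * ENNReal.ofReal s ^ 2)
      ≤ L ^ 2 * (ENNReal.ofReal r ^ 2 * φ.sizeSq) := by
    calc L ^ 2 * (volume {x | 2 * s < ‖φ.toFun x‖} * ENNReal.ofReal s ^ 2)
        = (L * ENNReal.ofReal s) ^ 2 * volume {x | 2 * s < ‖φ.toFun x‖} := by ring
      _ ≤ (L * ENNReal.ofReal s) ^ 2 * volume {x | (L * ENNReal.ofReal s) ^ 2 ≤ H x ^ 2} := by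
          gcongr
      _ ≤ ∫⁻ x, H x ^ 2 := hcheb
      _ ≤ (L * ENNReal.ofReal r) ^ 2 * φ.sizeSq := hHint
      _ = _ := by ring
  exact (ENNReal.mul_le_mul_iff_right (pow_ne_zero 2 hL0) (ENNReal.pow_ne_top hLt)).1 hfin

end TestFun

/-! ### Exponential integrability, locally uniform on H¹. -/

/-- `e^{β|z|²} - 1`. -/
def expExcess (β : ℝ) (z : ℂ) : ℝ := Real.exp (β * ‖z‖ ^ 2) - 1

lemma expExcess_nonneg {β : ℝ} (hβ : 0 ≤ β) (z : ℂ) : 0 ≤ expExcess β z := by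
  have := Real.add_one_le_exp (β * ‖z‖ ^ 2)
  have h2 : 0 ≤ β * ‖z‖ ^ 2 := by positivity
  unfold expExcess
  linarith

lemma continuous_expExcess (β : ℝ) : Continuous (expExcess β) := by
  unfold expExcess; fun_prop

lemma expExcess_le_of_norm_le_one {β : ℝ} (hβ : 0 ≤ β) {z : ℂ} (hz : ‖z‖ ≤ 1) :
    expExcess β z ≤ β * Real.exp β * ‖z‖ ^ 2 := by
  unfold expExcess
  set s := β * ‖z‖ ^ 2
  have hs : s ≤ β := mul_le_of_le_one_right hβ (pow_le_one₀ (norm_nonneg _) hz)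
  have h0 : 0 ≤ s := by positivity
  have h1 : Real.exp s - 1 ≤ s * Real.exp s := by
    have h2 := Real.add_one_le_exp (-s)
    have h3 : Real.exp s * Real.exp (-s) = 1 := by rw [← Real.exp_add]; simp
    nlinarith [Real.exp_pos s]
  calc Real.exp s - 1 ≤ s * Real.exp s := h1
    _ ≤ s * Real.exp β := by gcongr
    _ = _ := by simp only [s]; ring

/-- An exponential integrability estimate for small test functions. -/
lemma exists_lintegral_expExcess_testFun_le {β : ℝ} (hβ : 0 < β) :
    ∃ δ > 0, ∃ B : ℝ≥0∞, B ≠ ⊤ ∧ ∀ φ : TestFun, ‖φ.h1‖ ≤ δ →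
      ∫⁻ x, ENNReal.ofReal (expExcess β (φ.toFun x)) ≤ B := by
  -- At level n + 1 the kernel is split at radius e^{−γ(n+1)²}. With 2γ = 4β + 1 and (n + 2)² ≤ 4(n
  -- + 1)², the tail e^{−2γ(n+1)²} beats e^{β(n+2)²} by a factor e^{−n}.
  set γ : ℝ := (4 * β + 1) / 2
  have hγ : 0 < γ := by positivity
  set L := circleLength.toReal
  have hL : 0 < L := ENNReal.toReal_pos circleLength_ne_zero circleLength_ne_top
  have hLe : circleLength = ENNReal.ofReal L := (ENNReal.ofReal_toReal circleLength_ne_top).symm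
  -- D solves L γ(n+1)² D = (L(n+1)/2)², the hypothesis of the tail estimate with s = (n+1)/2. The 9
  -- in δ² = D/9 is the constant of `sizeSq_le`.
  set D : ℝ := L / (4 * γ)
  have hD : 0 < D := by positivity
  refine ⟨√(D / 9), Real.sqrt_pos.2 (by positivity),
    ENNReal.ofReal (β * Real.exp β) * ENNReal.ofReal (D / 9)
      + ∑' n : ℕ, 4 * ENNReal.ofReal D * ENNReal.ofReal (Real.exp (-1)) ^ n, ?_, ?_⟩
  · refine ENNReal.add_ne_top.2 ⟨ENNReal.mul_ne_top (by simp) (by simp), ?_⟩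
    rw [ENNReal.tsum_mul_left]
    refine ENNReal.mul_ne_top (ENNReal.mul_ne_top (by simp) (by simp)) ?_
    rw [ENNReal.tsum_geometric]
    refine ENNReal.inv_ne_top.2 (tsub_pos_of_lt ?_).ne'
    rw [← ENNReal.ofReal_one]
    exact (ENNReal.ofReal_lt_ofReal_iff one_pos).2 (by simp)
  intro φ hφ
  have hφ2 : ‖φ.h1‖ₑ ^ 2 ≤ ENNReal.ofReal (D / 9) := by
    rw [← ofReal_norm, ← ENNReal.ofReal_pow (norm_nonneg _)]
    refine ENNReal.ofReal_le_ofReal ?_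
    calc ‖φ.h1‖ ^ 2 ≤ √(D / 9) ^ 2 := by gcongr
      _ = D / 9 := Real.sq_sqrt (by positivity)
  have hA : φ.sizeSq ≤ ENNReal.ofReal D := by
    refine φ.sizeSq_le.trans ((mul_le_mul_right hφ2 9).trans_eq ?_)
    rw [show (9 : ℝ≥0∞) = ENNReal.ofReal 9 by simp, ← ENNReal.ofReal_mul (by norm_num)]
    congr 1
    ring
  have htail : ∀ n : ℕ, volume {x | (n : ℝ) + 1 < ‖φ.toFun x‖}
      ≤ 4 * (ENNReal.ofReal (Real.exp (-(2 * γ * (n + 1) ^ 2))) * ENNReal.ofReal D) := by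
    intro n
    have hn : (0 : ℝ) < (n : ℝ) + 1 := by positivity
    have h := φ.volume_lt_norm_mul_le (r := Real.exp (-(γ * (n + 1) ^ 2))) (s := ((n : ℝ) + 1) / 2)
      (Real.exp_pos _) (Real.exp_le_one_iff.2 (by have : 0 ≤ γ * ((n : ℝ) + 1) ^ 2 := by positivity
                                                  linarith)) (by positivity) (by
        rw [one_div, ← Real.exp_neg, Real.log_exp, neg_neg]
        refine (mul_le_mul_right hA _).trans ?_
        rw [hLe, ← ENNReal.ofReal_mul hL.le, ← ENNReal.ofReal_mul (by positivity),
          ← ENNReal.ofReal_mul hL.le, ← ENNReal.ofReal_pow (by positivity)]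
        refine ENNReal.ofReal_le_ofReal (le_of_eq ?_)
        simp only [D]
        field_simp
        ring)
    rw [mul_div_cancel₀ _ (two_ne_zero' ℝ), ← ENNReal.ofReal_pow (Real.exp_pos _).le,
      ← Real.exp_nat_mul] at h
    -- Since s ≥ 1/2, the factor s² in the tail estimate can be dropped at the cost of 4.
    have h4 : 1 ≤ 4 * ENNReal.ofReal (((n : ℝ) + 1) / 2) ^ 2 := by
      rw [← ENNReal.ofReal_pow (by positivity), show (4 : ℝ≥0∞) = ENNReal.ofReal 4 by simp,
        ← ENNReal.ofReal_mul (by norm_num), ENNReal.one_le_ofReal]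
      have : (0 : ℝ) ≤ n := Nat.cast_nonneg n
      nlinarith
    calc volume {x | (n : ℝ) + 1 < ‖φ.toFun x‖}
        ≤ volume {x | (n : ℝ) + 1 < ‖φ.toFun x‖} * (4 * ENNReal.ofReal (((n : ℝ) + 1) / 2) ^ 2) :=
          le_mul_of_one_le_right zero_le h4
      _ = 4 * (volume {x | (n : ℝ) + 1 < ‖φ.toFun x‖} * ENNReal.ofReal (((n : ℝ) + 1) / 2) ^ 2) := by
          ring
      _ ≤ 4 * (ENNReal.ofReal (Real.exp ((2 : ℕ) * -(γ * (n + 1) ^ 2))) * φ.sizeSq) :=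
          mul_le_mul_right h 4
      _ ≤ _ := by
          refine mul_le_mul_right (mul_le_mul' (le_of_eq ?_) hA) 4
          congr 2
          push_cast
          ring
  have hmeas : ∀ n : ℕ, MeasurableSet {x | (n : ℝ) + 1 < ‖φ.toFun x‖} := fun n =>
    (isOpen_lt continuous_const φ.continuous.norm).measurableSet
  have hpt : ∀ x, ENNReal.ofReal (expExcess β (φ.toFun x))
      ≤ ENNReal.ofReal (β * Real.exp β) * ‖φ.toFun x‖ₑ ^ 2
        + ∑' n : ℕ, {x | (n : ℝ) + 1 < ‖φ.toFun x‖}.indicator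
          (fun _ => ENNReal.ofReal (Real.exp (β * (n + 2) ^ 2))) x := by
    intro x
    by_cases hx : ‖φ.toFun x‖ ≤ 1
    · refine le_trans ?_ le_self_add
      rw [← ofReal_norm, ← ENNReal.ofReal_pow (norm_nonneg _), ← ENNReal.ofReal_mul (by positivity)]
      exact ENNReal.ofReal_le_ofReal (expExcess_le_of_norm_le_one hβ.le hx)
    · rw [not_le] at hx
      refine le_trans ?_ le_add_self
      -- The layer containing x is n + 1 < |φ(x)| ≤ n + 2; a single term of the series dominates
      -- there.
      obtain ⟨n, hn⟩ : ∃ n : ℕ, ⌈‖φ.toFun x‖⌉₊ = n + 2 :=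
        Nat.exists_eq_add_of_le' (by
          have := Nat.lt_ceil.2 (show ((1 : ℕ) : ℝ) < ‖φ.toFun x‖ by simpa using hx)
          omega)
      refine le_trans ?_ (ENNReal.le_tsum n)
      have h1 : (n : ℝ) + 1 < ‖φ.toFun x‖ := by
        have := Nat.lt_ceil.1 (show n + 1 < ⌈‖φ.toFun x‖⌉₊ by omega)
        exact_mod_cast this
      have h2 : ‖φ.toFun x‖ ≤ n + 2 := by
        have := Nat.le_ceil ‖φ.toFun x‖
        rw [hn] at this
        exact_mod_cast this
      rw [indicator_of_mem (show x ∈ {x | (n : ℝ) + 1 < ‖φ.toFun x‖} from h1)]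
      refine ENNReal.ofReal_le_ofReal ?_
      unfold expExcess
      have : Real.exp (β * ‖φ.toFun x‖ ^ 2) ≤ Real.exp (β * (n + 2) ^ 2) := by gcongr
      linarith
  refine (lintegral_mono hpt).trans ?_
  rw [lintegral_add_left ((φ.continuous.measurable.enorm.pow_const 2).const_mul _),
    lintegral_const_mul' _ _ (by simp)]
  refine add_le_add ?_ ?_
  · refine mul_le_mul_right ?_ _
    rw [← eLpNorm_two_sq, ← φ.enorm_l2]
    refine le_trans ?_ hφ2
    gcongr
    exact φ.enorm_l2_le
  · rw [lintegral_tsum fun n => (measurable_const.indicator (hmeas n)).aemeasurable]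
    refine ENNReal.tsum_le_tsum fun n => ?_
    rw [lintegral_indicator (hmeas n), setLIntegral_const]
    refine (mul_le_mul_right (htail n) _).trans ?_
    calc ENNReal.ofReal (Real.exp (β * (n + 2) ^ 2))
          * (4 * (ENNReal.ofReal (Real.exp (-(2 * γ * (n + 1) ^ 2))) * ENNReal.ofReal D))
        = 4 * ENNReal.ofReal D * (ENNReal.ofReal (Real.exp (β * (n + 2) ^ 2))
          * ENNReal.ofReal (Real.exp (-(2 * γ * (n + 1) ^ 2)))) := by ring
      _ ≤ _ := by
        refine mul_le_mul_right ?_ _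
        rw [← ENNReal.ofReal_mul (Real.exp_pos _).le, ← Real.exp_add,
          ← ENNReal.ofReal_pow (Real.exp_pos _).le, ← Real.exp_nat_mul]
        refine ENNReal.ofReal_le_ofReal (Real.exp_le_exp.2 ?_)
        simp only [γ]
        have : (0 : ℝ) ≤ n := Nat.cast_nonneg n
        nlinarith [mul_nonneg hβ.le this, mul_nonneg (mul_nonneg hβ.le this) this]

lemma exists_subseq_tendsto_ae {F : ℕ → PlaneL2} {f : PlaneL2} (h : Tendsto F atTop (𝓝 f)) :
    ∃ ns : ℕ → ℕ, StrictMono ns ∧ ∀ᵐ x, Tendsto (fun n => F (ns n) x) atTop (𝓝 (f x)) :=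
  (tendstoInMeasure_of_tendsto_Lp h).exists_seq_tendsto_ae

lemma measurable_planeL2 (v : PlaneL2) : Measurable (v : Plane → ℂ) :=
  (Lp.stronglyMeasurable v).measurable

/-- Fatou's lemma along an almost everywhere convergent sequence of test functions. The strict
inequality on ‖v‖ keeps the approximants eventually in the ball where the bound is known. -/
lemma exists_lintegral_expExcess_small_le {β : ℝ} (hβ : 0 < β) :
    ∃ δ > 0, ∃ B : ℝ≥0∞, B ≠ ⊤ ∧ ∀ v : sobolevH1, ‖v‖ < δ →
      ∫⁻ x, ENNReal.ofReal (expExcess β (v.1.1 x)) ≤ B := by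
  obtain ⟨δ, hδ, B, hB, H⟩ := exists_lintegral_expExcess_testFun_le hβ
  refine ⟨δ, hδ, B, hB, fun v hv => ?_⟩
  obtain ⟨φ, hφ⟩ := exists_seq_testFun v
  have hev : ∀ᶠ n in atTop, ‖(φ n).h1‖ < δ := hφ.norm.eventually (gt_mem_nhds hv)
  obtain ⟨N, hN⟩ := eventually_atTop.1 hev
  have h1 : Tendsto (fun n => (φ (n + N)).l2) atTop (𝓝 v.1.1) :=
    (continuous_h1_fst.tendsto v).comp (hφ.comp (tendsto_add_atTop_nat N))
  obtain ⟨ns, -, hns⟩ := exists_subseq_tendsto_ae h1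
  have hall : ∀ᵐ x, ∀ n, (φ (ns n + N)).l2 x = (φ (ns n + N)).toFun x :=
    ae_all_iff.2 fun n => (φ _).coeFn_l2
  have hlim : ∀ᵐ x, ENNReal.ofReal (expExcess β (v.1.1 x))
      = liminf (fun n => ENNReal.ofReal (expExcess β ((φ (ns n + N)).toFun x))) atTop := by
    filter_upwards [hns, hall] with x hx hx2
    simp_rw [hx2] at hx
    exact ((ENNReal.continuous_ofReal.tendsto _).comp
      (((continuous_expExcess β).tendsto _).comp hx)).liminf_eq.symm
  rw [lintegral_congr_ae hlim]
  refine (lintegral_liminf_le fun n => ?_).trans ?_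
  · exact ((continuous_expExcess β).comp (φ _).continuous).measurable.ennreal_ofReal
  · refine liminf_le_of_le (by isBoundedDefault) fun b hb => ?_
    obtain ⟨n, hn⟩ := hb.exists
    exact hn.trans (H _ (hN _ (by omega)).le)

/-- From |z + w|² ≤ 2|z|² + 2|w|²: a sum is handled by doubling β, which allows splitting into a
bounded part z and a small part w. -/
lemma expExcess_add_le {β : ℝ} (hβ : 0 ≤ β) (z w : ℂ) :
    expExcess β (z + w) ≤ Real.exp (2 * β * ‖z‖ ^ 2) * expExcess (2 * β) w
      + expExcess (2 * β) z := by
  unfold expExcess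
  have h1 : ‖z + w‖ ^ 2 ≤ 2 * ‖z‖ ^ 2 + 2 * ‖w‖ ^ 2 := by
    have := norm_add_le z w
    have h0 := norm_nonneg (z + w)
    nlinarith [sq_nonneg (‖z‖ - ‖w‖), norm_nonneg z, norm_nonneg w]
  have h2 : Real.exp (β * ‖z + w‖ ^ 2)
      ≤ Real.exp (2 * β * ‖z‖ ^ 2) * Real.exp (2 * β * ‖w‖ ^ 2) := by
    rw [← Real.exp_add]
    refine Real.exp_le_exp.2 ?_
    nlinarith [mul_le_mul_of_nonneg_left h1 hβ]
  linarith

/-- Exponential integrability, locally uniformly on `H¹`. -/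
lemma exists_lintegral_expExcess_near_le {β : ℝ} (hβ : 0 < β) (v₀ : sobolevH1) :
    ∃ δ > 0, ∃ B : ℝ≥0∞, B ≠ ⊤ ∧ ∀ v : sobolevH1, ‖v - v₀‖ < δ →
      ∫⁻ x, ENNReal.ofReal (expExcess β (v.1.1 x)) ≤ B := by
  obtain ⟨δ, hδ, B, hB, H⟩ := exists_lintegral_expExcess_small_le (β := 2 * β) (by positivity)
  -- Every v near v₀ is the fixed bounded function φ plus a remainder of norm less than δ. No
  -- smallness of v₀ is needed.
  obtain ⟨φ, hφ⟩ := exists_testFun_near v₀ (half_pos hδ)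
  obtain ⟨C, hC⟩ := φ.compact.exists_bound_of_continuous φ.continuous
  have hE : Integrable fun x => expExcess (2 * β) (φ.toFun x) := by
    refine ((continuous_expExcess _).comp φ.continuous).integrable_of_hasCompactSupport ?_
    exact φ.compact.comp_left (by simp [expExcess])
  refine ⟨δ / 2, half_pos hδ, ENNReal.ofReal (Real.exp (2 * β * C ^ 2)) * B
    + ∫⁻ x, ENNReal.ofReal (expExcess (2 * β) (φ.toFun x)), ?_, fun v hv => ?_⟩
  · refine ENNReal.add_ne_top.2 ⟨ENNReal.mul_ne_top (by simp) hB, ?_⟩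
    exact hE.lintegral_lt_top.ne
  have hsmall : ‖v - φ.h1‖ < δ := by
    have h1 : ‖v₀ - φ.h1‖ < δ / 2 := by rw [norm_sub_rev]; exact hφ
    calc ‖v - φ.h1‖ = ‖(v - v₀) + (v₀ - φ.h1)‖ := by rw [sub_add_sub_cancel]
      _ < δ / 2 + δ / 2 := (norm_add_le _ _).trans_lt (add_lt_add hv h1)
      _ = δ := by ring
  have hw := H _ hsmall
  refine (lintegral_mono_ae (g := fun x => ENNReal.ofReal (Real.exp (2 * β * C ^ 2))
    * ENNReal.ofReal (expExcess (2 * β) ((v - φ.h1).1.1 x))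
    + ENNReal.ofReal (expExcess (2 * β) (φ.toFun x))) ?_).trans ?_
  · filter_upwards [Lp.coeFn_sub v.1.1 φ.l2, φ.coeFn_l2] with x h1 h2
    have h3 : (v - φ.h1).1.1 x = v.1.1 x - φ.toFun x := by
      rw [← h2]; exact h1
    have h4 : v.1.1 x = φ.toFun x + (v - φ.h1).1.1 x := by rw [h3]; ring
    have h0 := expExcess_nonneg (β := 2 * β) (by positivity) ((v - φ.h1).1.1 x)
    rw [← ENNReal.ofReal_mul (Real.exp_pos _).le, ← ENNReal.ofReal_add
      (mul_nonneg (Real.exp_pos _).le h0) (expExcess_nonneg (by positivity) _)]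
    refine ENNReal.ofReal_le_ofReal ?_
    conv_lhs => rw [h4]
    refine (expExcess_add_le hβ.le _ _).trans (add_le_add (mul_le_mul_of_nonneg_right ?_ h0) le_rfl)
    have := hC x
    gcongr
  · have hm : Measurable fun x => ENNReal.ofReal (expExcess (2 * β) (φ.toFun x)) :=
      ((continuous_expExcess _).comp φ.continuous).measurable.ennreal_ofReal
    rw [lintegral_add_right _ hm, lintegral_const_mul' _ _ (by simp)]
    gcongr

lemma lintegral_expExcess_ne_top {β : ℝ} (hβ : 0 < β) (v : sobolevH1) :
    ∫⁻ x, ENNReal.ofReal (expExcess β (v.1.1 x)) ≠ ⊤ := by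
  obtain ⟨δ, hδ, B, hB, H⟩ := exists_lintegral_expExcess_near_le hβ v
  exact ((H v (by simpa using hδ)).trans_lt hB.lt_top).ne

/-! ### The nonlinearity as a continuous map H¹ → L². -/

/-- The scalar factor `e^{4πs} - 1 - 4πs` of the nonlinearity. -/
def nlsC (s : ℝ) : ℝ := Real.exp (4 * Real.pi * s) - 1 - 4 * Real.pi * s

lemma nlsC_nonneg (s : ℝ) : 0 ≤ nlsC s := by
  have := Real.add_one_le_exp (4 * Real.pi * s)
  unfold nlsC; linarith

lemma one_le_four_pi : 1 ≤ 4 * Real.pi := by linarith [Real.pi_gt_three]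

lemma four_pi_mul_le (s : ℝ) : 4 * Real.pi * s ≤ Real.exp (4 * Real.pi * s) - 1 := by
  linarith [Real.add_one_le_exp (4 * Real.pi * s)]

lemma le_exp_sub_one {s : ℝ} (hs : 0 ≤ s) : s ≤ Real.exp (4 * Real.pi * s) - 1 :=
  (le_mul_of_one_le_left hs one_le_four_pi).trans (four_pi_mul_le s)

lemma nlsC_le {s : ℝ} (hs : 0 ≤ s) : nlsC s ≤ Real.exp (4 * Real.pi * s) - 1 := by
  have : 0 ≤ 4 * Real.pi * s := by positivity
  unfold nlsC; linarith

lemma nlsF_eq (z : ℂ) : nlsF z = nlsC (‖z‖ ^ 2) • z := by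
  simp only [nlsF, nlsC, Complex.real_smul]

lemma nlsF_zero : nlsF 0 = 0 := by simp [nlsF]

lemma norm_nlsF (z : ℂ) : ‖nlsF z‖ = nlsC (‖z‖ ^ 2) * ‖z‖ := by
  rw [nlsF_eq, norm_smul, Real.norm_of_nonneg (nlsC_nonneg _)]

lemma contDiff_nlsC {n : WithTop ℕ∞} : ContDiff ℝ n nlsC := by
  unfold nlsC; fun_prop

lemma contDiff_nlsF {n : WithTop ℕ∞} : ContDiff ℝ n nlsF := by
  have : nlsF = fun z => nlsC (‖z‖ ^ 2) • z := funext nlsF_eq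
  rw [this]
  exact (contDiff_nlsC.comp (contDiff_norm_sq ℝ)).smul contDiff_id

lemma exp_pow_sub_one (k : ℕ) (z : ℂ) :
    expExcess (k * (4 * Real.pi)) z = Real.exp (4 * Real.pi * ‖z‖ ^ 2) ^ k - 1 := by
  rw [expExcess, ← Real.exp_nat_mul]
  ring_nf

lemma one_le_exp_sq (z : ℂ) : 1 ≤ Real.exp (4 * Real.pi * ‖z‖ ^ 2) :=
  Real.one_le_exp (by positivity)

lemma norm_nlsF_sq_le (z : ℂ) : ‖nlsF z‖ ^ 2 ≤ expExcess (4 * (4 * Real.pi)) z := by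
  have h := exp_pow_sub_one 4 z
  push_cast at h
  rw [h, norm_nlsF]
  have h1 := nlsC_le (sq_nonneg ‖z‖)
  have h0 := nlsC_nonneg (‖z‖ ^ 2)
  have h2 := le_exp_sub_one (sq_nonneg ‖z‖)
  have h3 := one_le_exp_sq z
  set a := Real.exp (4 * Real.pi * ‖z‖ ^ 2)
  calc (nlsC (‖z‖ ^ 2) * ‖z‖) ^ 2 = nlsC (‖z‖ ^ 2) ^ 2 * ‖z‖ ^ 2 := by ring
    _ ≤ (a - 1) ^ 2 * (a - 1) := by gcongr
    _ ≤ a ^ 4 - 1 := by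
        nlinarith [mul_nonneg (sub_nonneg.2 h3) (sub_nonneg.2 h3),
          mul_nonneg (mul_nonneg (sub_nonneg.2 h3) (sub_nonneg.2 h3)) (sub_nonneg.2 h3),
          pow_nonneg (sub_nonneg.2 h3) 4]

/-- With a = e^{4π|z|²} the left side is at most (a − 1)⁴. The extra factor |z| is what gives the
truncation error its decay in n. -/
lemma norm_nlsF_mul_sq_le (z : ℂ) : (‖nlsF z‖ * ‖z‖) ^ 2 ≤ expExcess (4 * (4 * Real.pi)) z := by
  have h := exp_pow_sub_one 4 z
  push_cast at h
  rw [h, norm_nlsF]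
  have h1 := nlsC_le (sq_nonneg ‖z‖)
  have h0 := nlsC_nonneg (‖z‖ ^ 2)
  have h2 := le_exp_sub_one (sq_nonneg ‖z‖)
  have h3 := one_le_exp_sq z
  set a := Real.exp (4 * Real.pi * ‖z‖ ^ 2)
  calc (nlsC (‖z‖ ^ 2) * ‖z‖ * ‖z‖) ^ 2 = nlsC (‖z‖ ^ 2) ^ 2 * (‖z‖ ^ 2) ^ 2 := by ring
    _ ≤ (a - 1) ^ 2 * (a - 1) ^ 2 := by gcongr
    _ ≤ a ^ 4 - 1 := by
        nlinarith [mul_nonneg (sub_nonneg.2 h3) (sub_nonneg.2 h3),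
          mul_nonneg (mul_nonneg (sub_nonneg.2 h3) (sub_nonneg.2 h3)) (sub_nonneg.2 h3)]

/-- The truncated nonlinearity. -/
def nlsTrunc (n : ℕ) (z : ℂ) : ℂ := cutoff ℂ n z • nlsF z

lemma contDiff_nlsTrunc (n : ℕ) : ContDiff ℝ ∞ (nlsTrunc n) :=
  (contDiff_cutoff n).smul contDiff_nlsF

lemma hasCompactSupport_nlsTrunc (n : ℕ) : HasCompactSupport (nlsTrunc n) :=
  HasCompactSupport.smul_right (f := cutoff ℂ n) (f' := nlsF) (hasCompactSupport_cutoff n)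

lemma nlsTrunc_zero (n : ℕ) : nlsTrunc n 0 = 0 := by simp [nlsTrunc, nlsF_zero]

/-- The difference vanishes unless |z| > n + 1, and there 1 ≤ |z|/(n + 1). -/
lemma norm_nlsTrunc_sub_le (n : ℕ) (z : ℂ) :
    ‖nlsTrunc n z - nlsF z‖ ≤ ((n : ℝ) + 1)⁻¹ * (‖nlsF z‖ * ‖z‖) := by
  have hn : (0 : ℝ) < n + 1 := by positivity
  by_cases h : ‖z‖ ≤ n + 1
  · rw [nlsTrunc, cutoff_eq_one h, one_smul, sub_self, norm_zero]
    positivity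
  · rw [not_le] at h
    have h1 : nlsTrunc n z - nlsF z = (cutoff ℂ n z - 1) • nlsF z := by
      rw [nlsTrunc, sub_smul, one_smul]
    have h2 : |cutoff ℂ n z - 1| ≤ 1 := by
      rw [abs_le]
      exact ⟨by linarith [cutoff_nonneg n z], by linarith [cutoff_le_one n z]⟩
    rw [h1, norm_smul, Real.norm_eq_abs, ← div_eq_inv_mul, le_div_iff₀ hn]
    calc |cutoff ℂ n z - 1| * ‖nlsF z‖ * (n + 1) ≤ 1 * ‖nlsF z‖ * ‖z‖ := by gcongr
      _ = _ := by ring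

lemma exists_lipschitz_nlsTrunc (n : ℕ) : ∃ C, LipschitzWith C (nlsTrunc n) :=
  (contDiff_nlsTrunc n).lipschitzWith_of_hasCompactSupport (hasCompactSupport_nlsTrunc n)
    (by simp)

/-- The truncated nonlinearity on `L²`. -/
def truncL2 (n : ℕ) (v : PlaneL2) : PlaneL2 :=
  (exists_lipschitz_nlsTrunc n).choose_spec.compLp (nlsTrunc_zero n) v

lemma continuous_truncL2 (n : ℕ) : Continuous (truncL2 n) :=
  LipschitzWith.continuous_compLp (exists_lipschitz_nlsTrunc n).choose_spec (nlsTrunc_zero n)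

lemma coeFn_truncL2 (n : ℕ) (v : PlaneL2) : truncL2 n v =ᵐ[volume] fun x => nlsTrunc n (v x) :=
  LipschitzWith.coeFn_compLp _ _ _

lemma memLp_nlsF (v : sobolevH1) : MemLp (fun x => nlsF (v.1.1 x)) 2 volume := by
  refine ⟨((contDiff_nlsF (n := 0)).continuous.measurable.comp
    (measurable_planeL2 _)).aestronglyMeasurable, ?_⟩
  have : eLpNorm (fun x => nlsF (v.1.1 x)) 2 volume ^ 2 < ⊤ := by
    rw [eLpNorm_two_sq]
    refine (lintegral_mono fun x => ?_).trans_lt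
      (lintegral_expExcess_ne_top (β := 4 * (4 * Real.pi)) (by positivity) v).lt_top
    rw [← ofReal_norm, ← ENNReal.ofReal_pow (norm_nonneg _)]
    exact ENNReal.ofReal_le_ofReal (norm_nlsF_sq_le _)
  exact lt_top_iff_ne_top.2 fun h => by simp [h] at this

/-- The nonlinearity as a map `H¹ → L²`. -/
def nlsL2 (v : sobolevH1) : PlaneL2 := (memLp_nlsF v).toLp _

lemma coeFn_nlsL2 (v : sobolevH1) : nlsL2 v =ᵐ[volume] fun x => nlsF (v.1.1 x) :=
  (memLp_nlsF v).coeFn_toLp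

lemma enorm_truncL2_sub_sq_le (n : ℕ) (v : sobolevH1) :
    ‖nlsL2 v - truncL2 n v.1.1‖ₑ ^ 2 ≤ ENNReal.ofReal ((n : ℝ) + 1)⁻¹ ^ 2
      * ∫⁻ x, ENNReal.ofReal (expExcess (4 * (4 * Real.pi)) (v.1.1 x)) := by
  rw [nlsL2, enorm_sub_toLp_sq, ← lintegral_const_mul' _ _ (by simp)]
  refine lintegral_mono_ae ?_
  filter_upwards [coeFn_truncL2 n v.1.1] with x hx
  have hn : (0 : ℝ) ≤ ((n : ℝ) + 1)⁻¹ := by positivity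
  rw [hx, ← ofReal_norm, ← ENNReal.ofReal_pow (norm_nonneg _), ← ENNReal.ofReal_pow hn,
    ← ENNReal.ofReal_mul (by positivity)]
  refine ENNReal.ofReal_le_ofReal ?_
  rw [norm_sub_rev]
  calc ‖nlsTrunc n (v.1.1 x) - nlsF (v.1.1 x)‖ ^ 2
      ≤ (((n : ℝ) + 1)⁻¹ * (‖nlsF (v.1.1 x)‖ * ‖v.1.1 x‖)) ^ 2 := by
        have := norm_nlsTrunc_sub_le n (v.1.1 x)
        gcongr
    _ = ((n : ℝ) + 1)⁻¹ ^ 2 * (‖nlsF (v.1.1 x)‖ * ‖v.1.1 x‖) ^ 2 := by ring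
    _ ≤ _ := by
        have := norm_nlsF_mul_sq_le (v.1.1 x)
        gcongr

/-- The superposition operators of the Lipschitz truncations are continuous on L². The truncation
error is O(1/n) times the square root of an exponential integral that is bounded near each point of
H¹, so they converge locally uniformly. -/
lemma continuous_nlsL2 : Continuous nlsL2 := by
  refine TendstoLocallyUniformly.continuous (F := fun n v => truncL2 n v.1.1) (p := atTop) ?_
    (Frequently.of_forall fun n => ?_)
  swap
  · exact (continuous_truncL2 n).comp continuous_h1_fst
  rw [Metric.tendstoLocallyUniformly_iff]
  intro ε hε v
  obtain ⟨δ, hδ, B, hB, H⟩ := exists_lintegral_expExcess_near_le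
    (β := 4 * (4 * Real.pi)) (by positivity) v
  refine ⟨Metric.ball v δ, Metric.ball_mem_nhds _ hδ, ?_⟩
  have hlim : Tendsto (fun n : ℕ => ENNReal.ofReal ((n : ℝ) + 1)⁻¹ ^ 2 * B) atTop (𝓝 0) := by
    have h1 : Tendsto (fun n : ℕ => ENNReal.ofReal ((n : ℝ) + 1)⁻¹ ^ 2) atTop (𝓝 0) := by
      have := (ENNReal.continuous_pow 2).tendsto _ |>.comp ((ENNReal.continuous_ofReal.tendsto _).comp
        (tendsto_one_div_add_atTop_nhds_zero_nat (𝕜 := ℝ)))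
      simpa [Function.comp_def] using this
    simpa using ENNReal.Tendsto.mul_const h1 (Or.inr hB)
  have hpos : 0 < ENNReal.ofReal ε ^ 2 := by
    have : ENNReal.ofReal ε ≠ 0 := by simpa using hε
    exact pos_iff_ne_zero.2 (pow_ne_zero 2 this)
  filter_upwards [hlim.eventually (gt_mem_nhds hpos)] with n hn w hw
  have h1 : ‖nlsL2 w - truncL2 n w.1.1‖ₑ ^ 2 < ENNReal.ofReal ε ^ 2 := by
    refine (enorm_truncL2_sub_sq_le n w).trans_lt (lt_of_le_of_lt ?_ hn)
    refine mul_le_mul_right (H w ?_) _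
    rwa [mem_ball_iff_norm] at hw
  have h2 : ‖nlsL2 w - truncL2 n w.1.1‖ₑ < ENNReal.ofReal ε := by
    by_contra h
    exact absurd h1 (not_lt.2 ((ENNReal.pow_le_pow_left_iff (by norm_num)).2 (not_lt.1 h)))
  rw [← ofReal_norm, ENNReal.ofReal_lt_ofReal_iff hε] at h2
  rw [dist_eq_norm]
  exact h2

/-! ### The potential: convexity, continuity and integration by parts. -/

lemma integrable_inner_real (v w : PlaneL2) : Integrable fun x => inner ℝ (v x) (w x) := by
  have h := (L2.integrable_inner (𝕜 := ℂ) v w).re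
  refine h.congr (Eventually.of_forall fun x => ?_)
  simp [RCLike.inner_apply, Complex.inner, mul_comm]

lemma re_inner_planeL2 (v w : PlaneL2) :
    (inner ℂ v w).re = ∫ x, inner ℝ (v x) (w x) := by
  have h := integral_re (𝕜 := ℂ) (L2.integrable_inner (𝕜 := ℂ) v w)
  rw [L2.inner_def]
  refine h.symm.trans (integral_congr_ae (Eventually.of_forall fun x => ?_))
  simp [RCLike.inner_apply, Complex.inner, mul_comm]

lemma integrable_norm_mul_norm (v w : PlaneL2) : Integrable fun x => ‖v x‖ * ‖w x‖ :=
  (Lp.memLp v).norm.integrable_mul (Lp.memLp w).norm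

lemma integral_norm_mul_norm_le (v w : PlaneL2) : ∫ x, ‖v x‖ * ‖w x‖ ≤ ‖v‖ * ‖w‖ := by
  have h := eLpNorm_smul_le_mul_eLpNorm (p := 2) (q := 2) (r := 1) (μ := (volume : Measure Plane))
    (Lp.aestronglyMeasurable w) (Lp.aestronglyMeasurable v)
  rw [eLpNorm_one_eq_lintegral_enorm, ← Lp.enorm_def, ← Lp.enorm_def] at h
  rw [integral_eq_lintegral_of_nonneg_ae (Eventually.of_forall fun x => by positivity)
    (integrable_norm_mul_norm v w).aestronglyMeasurable]
  refine ENNReal.toReal_le_of_le_ofReal (by positivity) ?_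
  rw [ENNReal.ofReal_mul (norm_nonneg _), ofReal_norm, ofReal_norm]
  refine le_trans (lintegral_mono fun x => ?_) h
  rw [ENNReal.ofReal_mul (norm_nonneg _), ofReal_norm, ofReal_norm, Pi.smul_apply', enorm_smul]

/-- The potential as a function of `|z|²`. -/
def nlsPot (s : ℝ) : ℝ :=
  1 / (4 * Real.pi) * (Real.exp (4 * Real.pi * s) - 1 - 4 * Real.pi * s - 8 * Real.pi ^ 2 * s ^ 2)

lemma nlsPotential_eq (z : ℂ) : nlsPotential z = nlsPot (‖z‖ ^ 2) := by
  unfold nlsPotential nlsPot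
  ring

lemma hasDerivAt_nlsPot (s : ℝ) : HasDerivAt nlsPot (nlsC s) s := by
  have h1 : HasDerivAt (fun s : ℝ => 4 * Real.pi * s) (4 * Real.pi) s := by
    simpa using (hasDerivAt_id s).const_mul (4 * Real.pi)
  have h := ((((h1.exp.sub_const 1).sub h1).sub
    (((hasDerivAt_pow 2 s).const_mul (8 * Real.pi ^ 2)))).const_mul (1 / (4 * Real.pi)))
  refine h.congr_deriv ?_
  unfold nlsC
  have := Real.pi_ne_zero
  field_simp
  push_cast
  ring

lemma nlsC_mono {s t : ℝ} (hs : 0 ≤ s) (hst : s ≤ t) : nlsC s ≤ nlsC t := by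
  unfold nlsC
  have hp := Real.pi_pos
  have h1 := Real.add_one_le_exp (4 * Real.pi * (t - s))
  have h2 : 1 ≤ Real.exp (4 * Real.pi * s) := Real.one_le_exp (by positivity)
  have h3 : Real.exp (4 * Real.pi * t)
      = Real.exp (4 * Real.pi * s) * Real.exp (4 * Real.pi * (t - s)) := by
    rw [← Real.exp_add]; ring_nf
  have h4 : 0 ≤ 4 * Real.pi * (t - s) := mul_nonneg (by positivity) (by linarith)
  nlinarith

/-- `nlsC` is the derivative of `nlsPot` and is increasing on [0, ∞), so `nlsPot` lies above its
tangents there, by the mean value theorem. -/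
lemma nlsPot_sub_ge {s t : ℝ} (hs : 0 ≤ s) (ht : 0 ≤ t) :
    nlsC s * (t - s) ≤ nlsPot t - nlsPot s := by
  rcases lt_trichotomy s t with h | h | h
  · obtain ⟨ξ, hξ, e⟩ := exists_hasDerivAt_eq_slope nlsPot nlsC h
      (fun x _ => (hasDerivAt_nlsPot x).continuousAt.continuousWithinAt)
      (fun x _ => hasDerivAt_nlsPot x)
    rw [eq_div_iff (by linarith)] at e
    rw [← e]
    exact mul_le_mul_of_nonneg_right (nlsC_mono hs hξ.1.le) (by linarith)
  · simp [h]
  · obtain ⟨ξ, hξ, e⟩ := exists_hasDerivAt_eq_slope nlsPot nlsC h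
      (fun x _ => (hasDerivAt_nlsPot x).continuousAt.continuousWithinAt)
      (fun x _ => hasDerivAt_nlsPot x)
    rw [eq_div_iff (by linarith)] at e
    have := mul_le_mul_of_nonneg_right (nlsC_mono (ht.trans hξ.1.le) hξ.2.le)
      (show 0 ≤ s - t by linarith)
    linarith

/-- Convexity of the potential. -/
lemma nlsPotential_sub_ge (z w : ℂ) :
    2 * inner ℝ (nlsF z) (w - z) ≤ nlsPotential w - nlsPotential z := by
  rw [nlsPotential_eq, nlsPotential_eq]
  refine le_trans ?_ (nlsPot_sub_ge (sq_nonneg _) (sq_nonneg _))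
  -- The tangent inequality in the variable |z|² also produces the nonnegative term c(|z|²)|w − z|²,
  -- which is discarded; the cross term explains the factor 2.
  have h1 : ‖w‖ ^ 2 = ‖z‖ ^ 2 + 2 * inner ℝ z (w - z) + ‖w - z‖ ^ 2 := by
    rw [← norm_add_sq_real, add_sub_cancel]
  rw [nlsF_eq, real_inner_smul_left, h1]
  have h2 := mul_nonneg (nlsC_nonneg (‖z‖ ^ 2)) (sq_nonneg ‖w - z‖)
  nlinarith

lemma nlsPotential_zero : nlsPotential 0 = 0 := by simp [nlsPotential]

lemma nlsPotential_nonneg (z : ℂ) : 0 ≤ nlsPotential z := by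
  have := nlsPotential_sub_ge 0 z
  simpa [nlsF_zero, nlsPotential_zero] using this

lemma nlsPotential_le (z : ℂ) : nlsPotential z ≤ expExcess (4 * Real.pi) z := by
  unfold nlsPotential expExcess
  have h0 : 0 ≤ Real.exp (4 * Real.pi * ‖z‖ ^ 2) - 1 := by linarith [one_le_exp_sq z]
  have hp := Real.pi_pos
  have h1 : 1 / (4 * Real.pi) ≤ 1 := by
    rw [div_le_one (by positivity)]; exact one_le_four_pi
  calc _ ≤ 1 / (4 * Real.pi) * (Real.exp (4 * Real.pi * ‖z‖ ^ 2) - 1) := by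
        have h2 : 0 ≤ 4 * Real.pi * ‖z‖ ^ 2 := by positivity
        have h3 : 0 ≤ 8 * Real.pi ^ 2 * ‖z‖ ^ 4 := by positivity
        refine mul_le_mul_of_nonneg_left (by linarith) (by positivity)
    _ ≤ _ := mul_le_of_le_one_left h0 h1

/-- The convexity inequality used in both orders; it makes weighted potential integrals continuous
on H¹ through the L² bounds on f. -/
lemma abs_nlsPotential_sub_le (z w : ℂ) :
    |nlsPotential w - nlsPotential z| ≤ 2 * (‖nlsF w‖ + ‖nlsF z‖) * ‖w - z‖ := by
  have h1 := nlsPotential_sub_ge z w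
  have h2 := nlsPotential_sub_ge w z
  have h3 := abs_le.1 (abs_real_inner_le_norm (nlsF z) (w - z))
  have h4 := abs_le.1 (abs_real_inner_le_norm (nlsF w) (z - w))
  rw [norm_sub_rev z w] at h4
  have h5 := mul_nonneg (norm_nonneg (nlsF z)) (norm_nonneg (w - z))
  have h6 := mul_nonneg (norm_nonneg (nlsF w)) (norm_nonneg (w - z))
  rw [abs_le]
  constructor <;> nlinarith

lemma contDiff_nlsPot {n : WithTop ℕ∞} : ContDiff ℝ n nlsPot := by
  unfold nlsPot; fun_prop

lemma contDiff_nlsPotential {n : WithTop ℕ∞} : ContDiff ℝ n nlsPotential := by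
  have : nlsPotential = fun z => nlsPot (‖z‖ ^ 2) := funext nlsPotential_eq
  rw [this]
  exact contDiff_nlsPot.comp (contDiff_norm_sq ℝ)

lemma fderiv_nlsPotential (z w : ℂ) : fderiv ℝ nlsPotential z w = 2 * inner ℝ (nlsF z) w := by
  have e : nlsPotential = fun z => nlsPot (‖z‖ ^ 2) := funext nlsPotential_eq
  have h := (hasDerivAt_nlsPot (‖z‖ ^ 2)).comp_hasFDerivAt z
    (hasStrictFDerivAt_norm_sq z).hasFDerivAt
  have h2 : fderiv ℝ nlsPotential z = nlsC (‖z‖ ^ 2) • 2 • innerSL ℝ z := by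
    rw [e]; exact h.fderiv
  rw [h2, nlsF_eq, real_inner_smul_left]
  simp
  ring

lemma integrable_nlsPotential (v : sobolevH1) : Integrable fun x => nlsPotential (v.1.1 x) := by
  refine ⟨((contDiff_nlsPotential (n := 0)).continuous.measurable.comp
    (measurable_planeL2 _)).aestronglyMeasurable, ?_⟩
  refine (lintegral_mono fun x => ?_).trans_lt
    (lintegral_expExcess_ne_top (β := 4 * Real.pi) (by positivity) v).lt_top
  rw [← ofReal_norm, Real.norm_of_nonneg (nlsPotential_nonneg _)]
  exact ENNReal.ofReal_le_ofReal (nlsPotential_le _)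

/-- A weighted integral of the potential. -/
def potWeighted (g : BoundedContinuousFunction Plane ℝ) (v : sobolevH1) : ℝ :=
  ∫ x, g x * nlsPotential (v.1.1 x)

lemma integrable_potWeighted (g : BoundedContinuousFunction Plane ℝ) (v : sobolevH1) :
    Integrable fun x => g x * nlsPotential (v.1.1 x) :=
  Integrable.bdd_mul (c := ‖g‖) (integrable_nlsPotential v)
    g.continuous.aestronglyMeasurable (Eventually.of_forall fun x => g.norm_coe_le_norm x)

lemma abs_potWeighted_sub_le (g : BoundedContinuousFunction Plane ℝ) (v w : sobolevH1) :
    |potWeighted g w - potWeighted g v|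
      ≤ ‖g‖ * 2 * ((‖nlsL2 w‖ + ‖nlsL2 v‖) * ‖w.1.1 - v.1.1‖) := by
  rw [potWeighted, potWeighted, ← integral_sub (integrable_potWeighted g w)
    (integrable_potWeighted g v)]
  have hi1 := integrable_norm_mul_norm (nlsL2 w) (w.1.1 - v.1.1)
  have hi2 := integrable_norm_mul_norm (nlsL2 v) (w.1.1 - v.1.1)
  calc |∫ x, (g x * nlsPotential (w.1.1 x) - g x * nlsPotential (v.1.1 x))|
      ≤ ∫ x, ‖g‖ * 2 * (‖nlsL2 w x‖ * ‖(w.1.1 - v.1.1) x‖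
          + ‖nlsL2 v x‖ * ‖(w.1.1 - v.1.1) x‖) := by
        rw [← Real.norm_eq_abs]
        refine norm_integral_le_of_norm_le ((hi1.add hi2).const_mul _) ?_
        filter_upwards [coeFn_nlsL2 w, coeFn_nlsL2 v, Lp.coeFn_sub w.1.1 v.1.1] with x h1 h2 h3
        rw [h1, h2, h3, Pi.sub_apply, ← mul_sub, norm_mul, ← add_mul, mul_assoc]
        refine mul_le_mul (g.norm_coe_le_norm x) ?_ (norm_nonneg _) (norm_nonneg _)
        rw [Real.norm_eq_abs, ← mul_assoc]
        exact abs_nlsPotential_sub_le _ _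
    _ = ‖g‖ * 2 * ((∫ x, ‖nlsL2 w x‖ * ‖(w.1.1 - v.1.1) x‖)
          + ∫ x, ‖nlsL2 v x‖ * ‖(w.1.1 - v.1.1) x‖) := by
        rw [integral_const_mul, integral_add hi1 hi2]
    _ ≤ _ := by
        rw [add_mul]
        gcongr
        · exact integral_norm_mul_norm_le _ _
        · exact integral_norm_mul_norm_le _ _

lemma continuous_potWeighted (g : BoundedContinuousFunction Plane ℝ) :
    Continuous (potWeighted g) := by
  rw [continuous_iff_continuousAt]
  intro v
  rw [ContinuousAt, tendsto_iff_norm_sub_tendsto_zero]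
  refine squeeze_zero (fun _ => norm_nonneg _) (fun w => abs_potWeighted_sub_le g v w) ?_
  have h1 : Continuous fun w : sobolevH1 =>
      ‖g‖ * 2 * ((‖nlsL2 w‖ + ‖nlsL2 v‖) * ‖w.1.1 - v.1.1‖) := by
    have := continuous_nlsL2
    have := continuous_h1_fst
    fun_prop
  simpa using h1.tendsto v

/-- The potential energy. -/
def potEnergy (v : sobolevH1) : ℝ := ∫ x, nlsPotential (v.1.1 x)

lemma potEnergy_eq (v : sobolevH1) :
    potEnergy v = potWeighted (BoundedContinuousFunction.const Plane 1) v := by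
  simp [potEnergy, potWeighted]

lemma continuous_potEnergy : Continuous potEnergy := by
  have : potEnergy = potWeighted (BoundedContinuousFunction.const Plane 1) := funext potEnergy_eq
  rw [this]
  exact continuous_potWeighted _

/-- Integrated convexity. Being one-sided is enough, because it will be applied to forward and
backward time increments alike. -/
lemma potEnergy_sub_ge (v w : sobolevH1) :
    2 * (inner ℂ (nlsL2 v) (w.1.1 - v.1.1)).re ≤ potEnergy w - potEnergy v := by
  rw [re_inner_planeL2, potEnergy, potEnergy, ← integral_sub (integrable_nlsPotential w)
    (integrable_nlsPotential v), ← integral_const_mul]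
  refine integral_mono_ae ((integrable_inner_real _ _).const_mul 2)
    ((integrable_nlsPotential w).sub (integrable_nlsPotential v)) ?_
  filter_upwards [coeFn_nlsL2 v, Lp.coeFn_sub w.1.1 v.1.1] with x h1 h2
  rw [h1, h2]
  exact nlsPotential_sub_ge _ _

/-- `2 ∫ b Re(conj f(v) ∂ⱼv) = - ∫ ∂ⱼb F(v)`. -/
lemma two_mul_re_inner_nlsL2 (b : Multiplier) (v : sobolevH1) (j : Fin 2) :
    2 * (inner ℂ (nlsL2 v) (mulL2 b.fn (v.1.2 j))).re = - potWeighted (b.grad j) v := by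
  -- Both sides are continuous on H¹. For a test function, ∂ⱼF(φ) = 2 Re(conj f(φ) ∂ⱼφ) and the
  -- claim is an integration by parts.
  refine denseRange_testFun.induction_on (p := fun v : sobolevH1 =>
    2 * (inner ℂ (nlsL2 v) (mulL2 b.fn (v.1.2 j))).re = - potWeighted (b.grad j) v) v ?_ fun φ => ?_
  · refine isClosed_eq ?_ (continuous_potWeighted _).neg
    have h1 : Continuous fun v : sobolevH1 => mulL2 b.fn (v.1.2 j) :=
      (mulL2 b.fn).continuous.comp (continuous_h1_snd j)
    exact (Complex.continuous_re.comp (continuous_nlsL2.inner h1)).const_mul 2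
  · rw [re_inner_planeL2, potWeighted, ← integral_const_mul]
    have hd : ∀ x, fderiv ℝ (fun y => nlsPotential (φ.toFun y)) x (planeBasis j)
        = 2 * inner ℝ (nlsF (φ.toFun x)) ((φ.d j).toFun x) := by
      intro x
      have h := ((contDiff_nlsPotential (n := 1)).differentiable (by simp)
        (φ.toFun x)).hasFDerivAt.comp x (φ.differentiable x).hasFDerivAt
      have e : fderiv ℝ (fun y => nlsPotential (φ.toFun y)) x = _ := h.fderiv
      rw [e, ContinuousLinearMap.comp_apply, fderiv_nlsPotential]
      rfl
    have hs : ContDiff ℝ 1 fun y => nlsPotential (φ.toFun y) :=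
      contDiff_nlsPotential.comp (φ.smooth.of_le (by simp))
    have hc : HasCompactSupport fun y => nlsPotential (φ.toFun y) :=
      φ.compact.comp_left nlsPotential_zero
    have hcd : Continuous fun x => fderiv ℝ (fun y => nlsPotential (φ.toFun y)) x (planeBasis j) :=
      (hs.continuous_fderiv (by simp)).clm_apply continuous_const
    have key := integral_mul_fderiv_eq_neg_fderiv_mul_of_integrable
      (μ := (volume : Measure Plane)) (f := (b.fn : Plane → ℝ))
      (g := fun y => nlsPotential (φ.toFun y)) (v := planeBasis j)
      (by simp_rw [b.fderiv_eq]
          exact ((b.grad j).continuous.mul hs.continuous).integrable_of_hasCompactSupport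
            hc.mul_left)
      ((b.fn.continuous.mul hcd).integrable_of_hasCompactSupport
        (hc.fderiv_apply (𝕜 := ℝ) _).mul_left)
      ((b.fn.continuous.mul hs.continuous).integrable_of_hasCompactSupport hc.mul_left)
      (fun x _ => b.smooth.differentiable (by simp) x)
      (fun x _ => hs.differentiable (by simp) x)
    simp_rw [b.fderiv_eq, hd] at key
    refine Eq.trans (integral_congr_ae ?_) (key.trans (congrArg _ (integral_congr_ae ?_)))
    · filter_upwards [coeFn_nlsL2 φ.h1, coeFn_mulL2 b.fn (φ.d j).l2, φ.coeFn_l2,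
        (φ.d j).coeFn_l2] with x h1 h2 h3 h4
      change 2 * inner ℝ (nlsL2 φ.h1 x) (mulL2 b.fn (φ.d j).l2 x) = _
      rw [h1, h2]
      change 2 * inner ℝ (nlsF (φ.l2 x)) _ = _
      rw [h3, h4, ← Complex.real_smul, real_inner_smul_right]
      ring
    · filter_upwards [φ.coeFn_l2] with x h3
      change _ = b.grad j x * nlsPotential (φ.l2 x)
      rw [h3]

/-! ### Chain rule, and f(v) ∈ H¹ when ∇v ∈ L⁴. -/

lemma lintegral_mul_sq_le_mul {α : Type*} [MeasurableSpace α] {μ : Measure α} {f g : α → ℝ≥0∞}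
    (hf : AEMeasurable f μ) (hg : AEMeasurable g μ) :
    (∫⁻ x, f x * g x ∂μ) ^ 2 ≤ (∫⁻ x, f x ^ 2 ∂μ) * ∫⁻ x, g x ^ 2 ∂μ := by
  have h := ENNReal.lintegral_mul_le_Lp_mul_Lq μ Real.HolderConjugate.two_two hf hg
  have e : ∀ x : ℝ≥0∞, (x ^ (1 / 2 : ℝ)) ^ 2 = x := fun x => by
    rw [← ENNReal.rpow_natCast, ← ENNReal.rpow_mul]; norm_num
  calc (∫⁻ x, f x * g x ∂μ) ^ 2 ≤ _ := pow_le_pow_left' h 2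
    _ = _ := by
      rw [mul_pow, e, e]
      simp only [ENNReal.rpow_two]

/-- Composition of a test function with a smooth compactly supported map fixing `0`. -/
def TestFun.comp (φ : TestFun) (Φ : ℂ → ℂ) (hΦ : ContDiff ℝ ∞ Φ) (h0 : Φ 0 = 0) : TestFun where
  toFun x := Φ (φ.toFun x)
  smooth := hΦ.comp φ.smooth
  compact := φ.compact.comp_left h0

lemma TestFun.comp_d (φ : TestFun) (Φ : ℂ → ℂ) (hΦ : ContDiff ℝ ∞ Φ) (h0 : Φ 0 = 0) (j : Fin 2)
    (x : Plane) :
    ((φ.comp Φ hΦ h0).d j).toFun x = fderiv ℝ Φ (φ.toFun x) ((φ.d j).toFun x) := by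
  have h := ((hΦ.differentiable (by simp)) (φ.toFun x)).hasFDerivAt.comp x
    (φ.differentiable x).hasFDerivAt
  have e : fderiv ℝ (φ.comp Φ hΦ h0).toFun x
      = (fderiv ℝ Φ (φ.toFun x)).comp (fderiv ℝ φ.toFun x) := h.fderiv
  simp only [TestFun.d, TestFun.lineD]
  rw [e]; rfl

lemma measurable_fderiv_apply_planeL2 {Φ : ℂ → ℂ} (hΦ : ContDiff ℝ ∞ Φ) (v w : PlaneL2) :
    Measurable fun x => fderiv ℝ Φ (v x) (w x) := by
  have h1 : Continuous fun p : ℂ × ℂ => fderiv ℝ Φ p.1 p.2 :=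
    ((hΦ.continuous_fderiv (by simp)).comp continuous_fst).clm_apply continuous_snd
  exact h1.measurable.comp ((measurable_planeL2 v).prodMk (measurable_planeL2 w))

/-- The chain rule in `H¹` for smooth compactly supported maps. -/
lemma comp_mem_sobolevH1 {Φ : ℂ → ℂ} (hΦ : ContDiff ℝ ∞ Φ) (hc : HasCompactSupport Φ)
    (h0 : Φ 0 = 0) (v : sobolevH1) {p : PlaneJet} (hp : p.1 =ᵐ[volume] fun x => Φ (v.1.1 x))
    (hpj : ∀ j, p.2 j =ᵐ[volume] fun x => fderiv ℝ Φ (v.1.1 x) (v.1.2 j x)) :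
    p ∈ sobolevH1 := by
  have hdc : Continuous (fderiv ℝ Φ) := hΦ.continuous_fderiv (by simp)
  obtain ⟨C, hC⟩ := (hc.fderiv (𝕜 := ℝ)).exists_bound_of_continuous hdc
  have hC0 : 0 ≤ C := (norm_nonneg _).trans (hC 0)
  have hlip : ∀ z w : ℂ, ‖Φ z - Φ w‖ ≤ C * ‖z - w‖ := fun z w =>
    Convex.norm_image_sub_le_of_norm_fderiv_le (𝕜 := ℝ)
      (fun x _ => hΦ.differentiable (by simp) x) (fun x _ => hC x) convex_univ
      (mem_univ w) (mem_univ z)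
  obtain ⟨φ, hφ⟩ := exists_seq_testFun v
  have hφ1 : Tendsto (fun n => (φ n).l2) atTop (𝓝 v.1.1) :=
    (continuous_h1_fst.tendsto v).comp hφ
  obtain ⟨ns, hns, hae⟩ := exists_subseq_tendsto_ae hφ1
  have hφ2 : ∀ j, Tendsto (fun n => ((φ (ns n)).d j).l2) atTop (𝓝 (v.1.2 j)) := fun j =>
    (((continuous_h1_snd j).tendsto v).comp hφ).comp hns.tendsto_atTop
  have hφ1' := hφ1.comp hns.tendsto_atTop
  -- The pairs of Φ ∘ φₙ, with φₙ test functions tending to v in H¹ and almost everywhere, converge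
  -- to p.
  refine isClosed_sobolevH1.mem_of_tendsto (b := atTop)
    (f := fun n => ((φ (ns n)).comp Φ hΦ h0).jet) ?_
    (Eventually.of_forall fun n => ((φ (ns n)).comp Φ hΦ h0).jet_mem)
  refine Prod.tendsto_iff _ _ |>.2 ⟨?_, tendsto_pi_nhds.2 fun j => ?_⟩
  · rw [tendsto_iff_norm_sub_tendsto_zero]
    refine squeeze_zero (g := fun n => C * ‖(φ (ns n)).l2 - v.1.1‖) (fun _ => norm_nonneg _)
      (fun n => ?_) ?_
    · refine Lp.norm_le_mul_norm_of_ae_le_mul ?_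
      filter_upwards [Lp.coeFn_sub ((φ (ns n)).comp Φ hΦ h0).jet.1 p.1,
        Lp.coeFn_sub (φ (ns n)).l2 v.1.1, hp, ((φ (ns n)).comp Φ hΦ h0).coeFn_l2,
        (φ (ns n)).coeFn_l2] with x e1 e2 e3 e4 e5
      rw [e1, e2, Pi.sub_apply, Pi.sub_apply, e3, e5]
      change ‖((φ (ns n)).comp Φ hΦ h0).l2 x - _‖ ≤ _
      rw [e4]
      exact hlip _ _
    · simpa using (tendsto_iff_norm_sub_tendsto_zero.1 hφ1').const_mul C
  -- The intermediate function DΦ(φₙ)∂ⱼv separates the two limits: DΦ(φₙ)(∂ⱼφₙ − ∂ⱼv) tends to 0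
  -- because DΦ is bounded, and DΦ(φₙ)∂ⱼv converges by domination.
  · have hmem : ∀ n, MemLp (fun x => fderiv ℝ Φ ((φ (ns n)).l2 x) (v.1.2 j x)) 2 volume :=
      fun n => MemLp.of_le_mul (c := C) (Lp.memLp (v.1.2 j))
        (measurable_fderiv_apply_planeL2 hΦ _ _).aestronglyMeasurable
        (Eventually.of_forall fun x => ((fderiv ℝ Φ _).le_opNorm _).trans
          (mul_le_mul_of_nonneg_right (hC _) (norm_nonneg _)))
    have hlim : Tendsto (fun n => (hmem n).toLp _) atTop (𝓝 (p.2 j)) := by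
      refine tendsto_planeL2_of_dominated (g := fun x => ENNReal.ofReal C * ‖v.1.2 j x‖ₑ)
        ?_ (fun n => ?_) ?_
      · simp_rw [mul_pow]
        rw [lintegral_const_mul' _ _ (by simp), ← enorm_sq_planeL2]
        exact ENNReal.mul_ne_top (by simp) (by simp)
      · filter_upwards [(hmem n).coeFn_toLp] with x hx
        rw [hx, ← ofReal_norm, ← ofReal_norm, ← ENNReal.ofReal_mul hC0]
        exact ENNReal.ofReal_le_ofReal (((fderiv ℝ Φ _).le_opNorm _).trans
          (mul_le_mul_of_nonneg_right (hC _) (norm_nonneg _)))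
      · filter_upwards [ae_all_iff.2 fun n => (hmem n).coeFn_toLp, hae, hpj j] with x h1 h2 h3
        simp_rw [h1, h3]
        have h4 : Continuous fun z => fderiv ℝ Φ z (v.1.2 j x) := hdc.clm_apply continuous_const
        exact (h4.tendsto _).comp h2
    have hdiff : Tendsto (fun n => ((φ (ns n)).comp Φ hΦ h0).jet.2 j - (hmem n).toLp _) atTop
        (𝓝 0) := by
      rw [tendsto_zero_iff_norm_tendsto_zero]
      refine squeeze_zero (g := fun n => C * ‖((φ (ns n)).d j).l2 - v.1.2 j‖)
        (fun _ => norm_nonneg _) (fun n => ?_) ?_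
      · refine Lp.norm_le_mul_norm_of_ae_le_mul ?_
        filter_upwards [Lp.coeFn_sub (((φ (ns n)).comp Φ hΦ h0).jet.2 j) ((hmem n).toLp _),
          Lp.coeFn_sub ((φ (ns n)).d j).l2 (v.1.2 j), (hmem n).coeFn_toLp,
          (((φ (ns n)).comp Φ hΦ h0).d j).coeFn_l2, (φ (ns n)).coeFn_l2,
          ((φ (ns n)).d j).coeFn_l2] with x e1 e2 e3 e4 e5 e6
        rw [e1, e2, Pi.sub_apply, Pi.sub_apply, e3, e6, e5]
        change ‖(((φ (ns n)).comp Φ hΦ h0).d j).l2 x - _‖ ≤ _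
        rw [e4, TestFun.comp_d, ← map_sub]
        exact ((fderiv ℝ Φ _).le_opNorm _).trans
          (mul_le_mul_of_nonneg_right (hC _) (norm_nonneg _))
      · simpa using (tendsto_iff_norm_sub_tendsto_zero.1 (hφ2 j)).const_mul C
    simpa using hdiff.add hlim

/-- A majorant of the nonlinearity and of its derivative. -/
def nlsMaj (z : ℂ) : ℝ :=
  Real.exp (4 * Real.pi * ‖z‖ ^ 2) * (Real.exp (4 * Real.pi * ‖z‖ ^ 2) - 1)

lemma nlsMaj_nonneg (z : ℂ) : 0 ≤ nlsMaj z :=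
  mul_nonneg (Real.exp_pos _).le (by linarith [one_le_exp_sq z])

lemma continuous_nlsMaj : Continuous nlsMaj := by unfold nlsMaj; fun_prop

/-- With a = e^{4π|z|²}: (a(a − 1))⁴ ≤ a⁸ − 1. The fourth power is what Hölder L⁴ · L⁴ ⊆ L² asks of
the factor multiplying ∇v. -/
lemma nlsMaj_pow_four_le (z : ℂ) : nlsMaj z ^ 4 ≤ expExcess (8 * (4 * Real.pi)) z := by
  have h := exp_pow_sub_one 8 z
  push_cast at h
  rw [h, nlsMaj]
  have h3 := one_le_exp_sq z
  set a := Real.exp (4 * Real.pi * ‖z‖ ^ 2)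
  have h4 : 0 ≤ a - 1 := by linarith
  have h5 : (a - 1) ^ 4 ≤ a ^ 4 - 1 := by
    have : a ^ 4 - 1 - (a - 1) ^ 4 = 4 * (a - 1) ^ 3 + 6 * (a - 1) ^ 2 + 4 * (a - 1) := by ring
    have : 0 ≤ 4 * (a - 1) ^ 3 + 6 * (a - 1) ^ 2 + 4 * (a - 1) := by positivity
    linarith
  have h6 : 1 ≤ a ^ 4 := one_le_pow₀ h3
  calc (a * (a - 1)) ^ 4 = a ^ 4 * (a - 1) ^ 4 := by ring
    _ ≤ a ^ 4 * (a ^ 4 - 1) := by gcongr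
    _ ≤ a ^ 8 - 1 := by nlinarith

lemma norm_nlsF_le_nlsMaj (z : ℂ) : ‖nlsF z‖ ≤ nlsMaj z := by
  rw [norm_nlsF, nlsMaj, mul_comm (Real.exp _)]
  have h1 := nlsC_le (sq_nonneg ‖z‖)
  have h2 := le_exp_sub_one (sq_nonneg ‖z‖)
  have h3 := one_le_exp_sq z
  refine mul_le_mul h1 ?_ (norm_nonneg _) (by linarith)
  nlinarith [sq_nonneg (‖z‖ - 1)]

lemma hasDerivAt_nlsC (s : ℝ) :
    HasDerivAt nlsC (4 * Real.pi * (Real.exp (4 * Real.pi * s) - 1)) s := by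
  have h1 : HasDerivAt (fun s : ℝ => 4 * Real.pi * s) (4 * Real.pi) s := by
    simpa using (hasDerivAt_id s).const_mul (4 * Real.pi)
  refine ((h1.exp.sub_const 1).sub h1).congr_deriv ?_
  ring

/-- The derivative is h ↦ c h + 2c'⟨z, h⟩z with c' = 4π(a − 1), a = e^{4π|z|²}. Since c ≤ a − 1 and
4π|z|² ≤ a − 1, its norm is at most (a − 1)(1 + 2(a − 1)) ≤ 2a(a − 1). -/
lemma norm_fderiv_nlsF_le (z : ℂ) : ‖fderiv ℝ nlsF z‖ ≤ 2 * nlsMaj z := by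
  have h1 := (hasDerivAt_nlsC (‖z‖ ^ 2)).comp_hasFDerivAt z
    (hasStrictFDerivAt_norm_sq z).hasFDerivAt
  have h2 := h1.smul (hasFDerivAt_id (𝕜 := ℝ) z)
  have e2 : HasFDerivAt nlsF _ z := h2.congr_of_eventuallyEq (Eventually.of_forall nlsF_eq)
  have h3 := one_le_exp_sq z
  have h4 := nlsC_le (sq_nonneg ‖z‖)
  have h5 := four_pi_mul_le (‖z‖ ^ 2)
  refine ContinuousLinearMap.opNorm_le_bound _ (by have := nlsMaj_nonneg z; positivity) fun h => ?_
  rw [e2.fderiv]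
  have h6 : ‖inner ℝ z h‖ ≤ ‖z‖ * ‖h‖ := norm_inner_le_norm _ _
  set a := Real.exp (4 * Real.pi * ‖z‖ ^ 2)
  have hp := Real.pi_pos
  have key : ‖nlsC (‖z‖ ^ 2) • h + (4 * Real.pi * (a - 1) * (2 * inner ℝ z h)) • z‖
      ≤ 2 * nlsMaj z * ‖h‖ := by
    calc _ ≤ nlsC (‖z‖ ^ 2) * ‖h‖ + 4 * Real.pi * (a - 1) * (2 * ‖inner ℝ z h‖) * ‖z‖ := by
          refine (norm_add_le _ _).trans ?_
          have h7 : 0 ≤ 4 * Real.pi * (a - 1) := mul_nonneg (by positivity) (by linarith)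
          rw [norm_smul, norm_smul, Real.norm_of_nonneg (nlsC_nonneg _),
            norm_mul (4 * Real.pi * (a - 1)), Real.norm_of_nonneg h7, norm_mul 2, Real.norm_two]
      _ ≤ (a - 1) * ‖h‖ + 4 * Real.pi * (a - 1) * (2 * (‖z‖ * ‖h‖)) * ‖z‖ := by
          have : 0 ≤ a - 1 := by linarith
          gcongr
      _ = (a - 1) * ‖h‖ * (1 + 2 * (4 * Real.pi * ‖z‖ ^ 2)) := by ring
      _ ≤ (a - 1) * ‖h‖ * (2 * a) := by
          have : 0 ≤ (a - 1) * ‖h‖ := mul_nonneg (by linarith) (norm_nonneg _)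
          refine mul_le_mul_of_nonneg_left (by linarith) this
      _ = _ := by unfold nlsMaj; ring
  refine le_trans (le_of_eq ?_) key
  congr 1
  simp only [add_apply, smul_apply, ContinuousLinearMap.smulRight_apply,
    ContinuousLinearMap.id_apply, innerSL_apply_apply, id_eq, nsmul_eq_mul, smul_eq_mul,
    Function.comp_apply]
  norm_num

/-- A uniform bound for the derivatives of the truncated nonlinearities. -/
lemma exists_norm_fderiv_nlsTrunc_le :
    ∃ C : ℝ, 0 ≤ C ∧ ∀ (n : ℕ) (z : ℂ), ‖fderiv ℝ (nlsTrunc n) z‖ ≤ C * nlsMaj z := by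
  obtain ⟨C, hC0, hC⟩ := exists_norm_fderiv_cutoff_le ℂ
  refine ⟨2 + C, by positivity, fun n z => ?_⟩
  have h1 : DifferentiableAt ℝ (cutoff ℂ n) z := (contDiff_cutoff n).differentiable (by simp) z
  have h2 : DifferentiableAt ℝ nlsF z := (contDiff_nlsF (n := 1)).differentiable (by simp) z
  have h3 : fderiv ℝ (nlsTrunc n) z = cutoff ℂ n z • fderiv ℝ nlsF z
      + (fderiv ℝ (cutoff ℂ n) z).smulRight (nlsF z) := fderiv_fun_smul h1 h2
  rw [h3]
  refine (norm_add_le _ _).trans ?_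
  rw [norm_smul, ContinuousLinearMap.norm_smulRight_apply, Real.norm_of_nonneg (cutoff_nonneg _ _)]
  have h4 : C * ((n : ℝ) + 1)⁻¹ ≤ C :=
    mul_le_of_le_one_right hC0 (inv_le_one_of_one_le₀ (by linarith [n.cast_nonneg (α := ℝ)]))
  calc _ ≤ 1 * (2 * nlsMaj z) + C * nlsMaj z := by
        have := cutoff_le_one n z
        have := norm_fderiv_nlsF_le z
        have := norm_nlsF_le_nlsMaj z
        have := (hC n z).trans h4
        gcongr
    _ = _ := by ring

lemma fderiv_nlsTrunc_eventually (z : ℂ) :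
    ∀ᶠ n in atTop, fderiv ℝ (nlsTrunc n) z = fderiv ℝ nlsF z := by
  obtain ⟨N, hN⟩ := exists_nat_ge ‖z‖
  filter_upwards [eventually_ge_atTop N] with n hn
  refine Filter.EventuallyEq.fderiv_eq ?_
  have h1 : ‖z‖ < n + 1 := by
    have : (N : ℝ) ≤ n := by exact_mod_cast hn
    linarith
  filter_upwards [continuous_norm.continuousAt.eventually_lt continuousAt_const h1] with w hw
  rw [nlsTrunc, cutoff_eq_one hw.le, one_smul]

lemma norm_nlsTrunc_le (n : ℕ) (z : ℂ) : ‖nlsTrunc n z‖ ≤ ‖nlsF z‖ := by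
  rw [nlsTrunc, norm_smul, Real.norm_of_nonneg (cutoff_nonneg _ _)]
  exact mul_le_of_le_one_left (norm_nonneg _) (cutoff_le_one _ _)

/-- If `∇v ∈ L⁴` then `f(v) ∈ H¹`, with a bound. -/
lemma exists_nlsL2_mem_sobolevH1 : ∃ K : ℝ≥0∞, K ≠ ⊤ ∧ ∀ v : sobolevH1,
    (∀ j, ∫⁻ x, ‖v.1.2 j x‖ₑ ^ 4 ≠ ⊤) → ∃ w : Fin 2 → PlaneL2, (nlsL2 v, w) ∈ sobolevH1 ∧
      ∀ j, ‖w j‖ₑ ^ 4 ≤ K * (∫⁻ x, ENNReal.ofReal (expExcess (8 * (4 * Real.pi)) (v.1.1 x)))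
        * ∫⁻ x, ‖v.1.2 j x‖ₑ ^ 4 := by
  obtain ⟨C, hC0, hC⟩ := exists_norm_fderiv_nlsTrunc_le
  refine ⟨ENNReal.ofReal C ^ 4, by simp, fun v hv => ?_⟩
  have hE := lintegral_expExcess_ne_top (β := 8 * (4 * Real.pi)) (by positivity) v
  set E := ∫⁻ x, ENNReal.ofReal (expExcess (8 * (4 * Real.pi)) (v.1.1 x))
  let g : Fin 2 → Plane → ℝ≥0∞ := fun j x =>
    ENNReal.ofReal C * (ENNReal.ofReal (nlsMaj (v.1.1 x)) * ‖v.1.2 j x‖ₑ)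
  have hmm : Measurable fun x => ENNReal.ofReal (nlsMaj (v.1.1 x)) ^ 2 :=
    ((continuous_nlsMaj.measurable.comp (measurable_planeL2 v.1.1)).ennreal_ofReal).pow_const 2
  -- Cauchy–Schwarz separates the exponential factor from |∂ⱼv|⁴. The function g dominates the
  -- derivatives for all truncations at once.
  have hg : ∀ j, (∫⁻ x, g j x ^ 2) ^ 2 ≤ ENNReal.ofReal C ^ 4 * E * ∫⁻ x, ‖v.1.2 j x‖ₑ ^ 4 := by
    intro j
    simp only [g, mul_pow]
    rw [lintegral_const_mul' _ _ (by simp), mul_pow, ← pow_mul, mul_assoc]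
    refine mul_le_mul_right ?_ _
    refine (lintegral_mul_sq_le_mul hmm.aemeasurable
      ((measurable_planeL2 (v.1.2 j)).enorm.pow_const 2).aemeasurable).trans ?_
    simp only [← pow_mul]
    refine mul_le_mul_left (lintegral_mono fun x => ?_) _
    rw [← ENNReal.ofReal_pow (nlsMaj_nonneg _)]
    exact ENNReal.ofReal_le_ofReal (nlsMaj_pow_four_le _)
  have hg2 : ∀ j, ∫⁻ x, g j x ^ 2 ≠ ⊤ := fun j h => by
    have := (hg j).trans_lt (ENNReal.mul_lt_top (ENNReal.mul_lt_top (by simp) hE.lt_top)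
      (hv j).lt_top)
    simp [h] at this
  have hb : ∀ n j x, ‖fderiv ℝ (nlsTrunc n) (v.1.1 x) (v.1.2 j x)‖ₑ ≤ g j x := by
    intro n j x
    simp only [g]
    rw [← ofReal_norm, ← ofReal_norm, ← ENNReal.ofReal_mul (nlsMaj_nonneg _),
      ← ENNReal.ofReal_mul hC0, ← mul_assoc]
    exact ENNReal.ofReal_le_ofReal ((ContinuousLinearMap.le_opNorm _ _).trans
      (mul_le_mul_of_nonneg_right (hC _ _) (norm_nonneg _)))
  have hb' : ∀ j x, ‖fderiv ℝ nlsF (v.1.1 x) (v.1.2 j x)‖ₑ ≤ g j x := fun j x => by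
    obtain ⟨n, hn⟩ := (fderiv_nlsTrunc_eventually (v.1.1 x)).exists
    rw [← hn]
    exact hb n j x
  have hmem : ∀ {f : Plane → ℂ} {j}, Measurable f → (∀ x, ‖f x‖ₑ ≤ g j x) → MemLp f 2 volume := by
    intro f j hf h
    refine ⟨hf.aestronglyMeasurable, ?_⟩
    have : eLpNorm f 2 volume ^ 2 < ⊤ := by
      rw [eLpNorm_two_sq]
      exact (lintegral_mono fun x => pow_le_pow_left' (h x) 2).trans_lt (hg2 j).lt_top
    exact lt_top_iff_ne_top.2 fun h => by simp [h] at this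
  have hmn : ∀ n j, MemLp (fun x => fderiv ℝ (nlsTrunc n) (v.1.1 x) (v.1.2 j x)) 2 volume :=
    fun n j => hmem (measurable_fderiv_apply_planeL2 (contDiff_nlsTrunc n) _ _) (hb n j)
  have hml : ∀ j, MemLp (fun x => fderiv ℝ nlsF (v.1.1 x) (v.1.2 j x)) 2 volume :=
    fun j => hmem (measurable_fderiv_apply_planeL2 contDiff_nlsF _ _) (hb' j)
  refine ⟨fun j => (hml j).toLp _, ?_, fun j => ?_⟩
  -- The truncated nonlinearities satisfy the chain rule; their pairs converge by domination, and H¹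
  -- is closed.
  · refine isClosed_sobolevH1.mem_of_tendsto (b := atTop)
      (f := fun n => (truncL2 n v.1.1, fun j => (hmn n j).toLp _)) ?_
      (Eventually.of_forall fun n => comp_mem_sobolevH1 (contDiff_nlsTrunc n)
        (hasCompactSupport_nlsTrunc n) (nlsTrunc_zero n) v (coeFn_truncL2 n _)
        fun j => (hmn n j).coeFn_toLp)
    refine Prod.tendsto_iff _ _ |>.2 ⟨?_, tendsto_pi_nhds.2 fun j => ?_⟩
    · refine tendsto_planeL2_of_dominated (g := fun x => ‖nlsL2 v x‖ₑ) ?_ (fun n => ?_) ?_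
      · rw [← enorm_sq_planeL2]; simp
      · filter_upwards [coeFn_truncL2 n v.1.1, coeFn_nlsL2 v] with x h1 h2
        rw [h1, h2, ← ofReal_norm, ← ofReal_norm]
        exact ENNReal.ofReal_le_ofReal (norm_nlsTrunc_le _ _)
      · filter_upwards [ae_all_iff.2 fun n => coeFn_truncL2 n v.1.1, coeFn_nlsL2 v] with x h1 h2
        simp_rw [h1, h2]
        simpa [nlsTrunc] using (tendsto_cutoff (E := ℂ) (v.1.1 x)).smul_const (nlsF (v.1.1 x))
    · refine tendsto_planeL2_of_dominated (hg2 j) (fun n => ?_) ?_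
      · filter_upwards [(hmn n j).coeFn_toLp] with x h1
        rw [h1]
        exact hb n j x
      · filter_upwards [ae_all_iff.2 fun n => (hmn n j).coeFn_toLp, (hml j).coeFn_toLp] with x h1 h2
        simp_rw [h1, h2]
        refine tendsto_const_nhds.congr' ?_
        filter_upwards [fderiv_nlsTrunc_eventually (v.1.1 x)] with n hn
        rw [hn]
  · refine le_trans ?_ (hg j)
    rw [show 4 = 2 * 2 from rfl, pow_mul, enorm_sq_planeL2]
    refine pow_le_pow_left' (lintegral_mono_ae ?_) 2
    filter_upwards [(hml j).coeFn_toLp] with x h1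
    rw [h1]
    exact pow_le_pow_left' (hb' j x) 2

/-! ### Comparison of the potential F with G. -/

/-- `F ≤ G / 2`. -/
lemma nlsPotential_le_half_nlsG (z : ℂ) : nlsPotential z ≤ nlsG z / 2 := by
  have hA : 0 ≤ 4 * Real.pi * ‖z‖ ^ 2 := by positivity
  have e1 : 4 * Real.pi * nlsPotential z = Real.exp (4 * Real.pi * ‖z‖ ^ 2) - 1
      - 4 * Real.pi * ‖z‖ ^ 2 - (4 * Real.pi * ‖z‖ ^ 2) ^ 2 / 2 := by
    unfold nlsPotential
    have := Real.pi_ne_zero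
    field_simp
    ring
  have e2 : 4 * Real.pi * nlsG z = (Real.exp (4 * Real.pi * ‖z‖ ^ 2) - 1 - 4 * Real.pi * ‖z‖ ^ 2)
      * (4 * Real.pi * ‖z‖ ^ 2) := by
    unfold nlsG; ring
  set A := 4 * Real.pi * ‖z‖ ^ 2
  -- The expression is 4π(G − 2F) with A = 4π|z|². It vanishes at A = 0, and its derivative 1 + (A −
  -- 1)e^A is nonnegative because 1 − A ≤ e^{−A}.
  have key : 0 ≤ A * Real.exp A + A - 2 * Real.exp A + 2 := by
    have hd : ∀ x, HasDerivAt (fun A : ℝ => A * Real.exp A + A - 2 * Real.exp A + 2)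
        (1 + (x - 1) * Real.exp x) x := fun x => by
      refine (((((hasDerivAt_id x).mul (Real.hasDerivAt_exp x)).add (hasDerivAt_id x)).sub
        ((Real.hasDerivAt_exp x).const_mul 2)).add_const 2).congr_deriv ?_
      simp
      ring
    have hm : MonotoneOn (fun A : ℝ => A * Real.exp A + A - 2 * Real.exp A + 2) (Ici 0) := by
      refine monotoneOn_of_deriv_nonneg (convex_Ici 0)
        (fun x _ => (hd x).continuousAt.continuousWithinAt)
        (fun x _ => (hd x).differentiableAt.differentiableWithinAt) fun x _ => ?_
      rw [(hd x).deriv]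
      have h1 := Real.add_one_le_exp (-x)
      have h2 : Real.exp (-x) * Real.exp x = 1 := by rw [← Real.exp_add]; simp
      nlinarith [Real.exp_pos x]
    have := hm (mem_Ici.2 le_rfl) (mem_Ici.2 hA) hA
    simpa using this
  have : 4 * Real.pi * nlsPotential z ≤ 4 * Real.pi * (nlsG z / 2) := by
    have : 4 * Real.pi * (nlsG z / 2) = 4 * Real.pi * nlsG z / 2 := by ring
    rw [this, e1, e2]
    nlinarith
  exact le_of_mul_le_mul_left this (by positivity)

lemma nlsG_eq_inner (z : ℂ) : nlsG z = inner ℝ (nlsF z) z := by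
  rw [nlsF_eq, real_inner_smul_left, real_inner_self_eq_norm_sq]
  rfl

lemma nlsG_nonneg (z : ℂ) : 0 ≤ nlsG z := mul_nonneg (nlsC_nonneg _) (sq_nonneg _)

/-! ### From weak gradients to a continuous trajectory in H¹. -/

lemma isWeakGradient_weakGradient {v : Plane → ℂ} (h : ∃ g, IsWeakGradient v g) :
    IsWeakGradient v (weakGradient v) := by
  rw [weakGradient, dif_pos h]
  exact h.choose_spec

lemma IsWeakGradient.sub {v w : Plane → ℂ} {g h : Plane → EuclideanSpace ℂ (Fin 2)}
    (hg : IsWeakGradient v g) (hh : IsWeakGradient w h) : IsWeakGradient (v - w) (g - h) := by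
  refine ⟨hg.1.sub hh.1, hg.2.1.sub hh.2.1, fun i φ hφ hc => ?_⟩
  have hcf : Continuous fun x => fderiv ℝ φ x (EuclideanSpace.single i 1) :=
    (hφ.continuous_fderiv (by simp)).clm_apply continuous_const
  have hcc : HasCompactSupport fun x => fderiv ℝ φ x (EuclideanSpace.single i 1) :=
    hc.fderiv_apply (𝕜 := ℝ) _
  have proj : ∀ k : Plane → EuclideanSpace ℂ (Fin 2), LocallyIntegrable k →
      LocallyIntegrable fun x => k x i := by
    intro k hk x
    obtain ⟨s, hs, hi⟩ := hk x
    exact ⟨s, hs, (EuclideanSpace.proj (𝕜 := ℂ) i).integrable_comp hi⟩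
  simp only [Pi.sub_apply, smul_sub, PiLp.sub_apply]
  rw [integral_sub (hg.1.integrable_smul_left_of_hasCompactSupport hcf hcc)
    (hh.1.integrable_smul_left_of_hasCompactSupport hcf hcc),
    integral_sub ((proj _ hg.2.1).integrable_smul_left_of_hasCompactSupport hφ.continuous hc)
    ((proj _ hh.2.1).integrable_smul_left_of_hasCompactSupport hφ.continuous hc),
    hg.2.2 i φ hφ hc, hh.2.2 i φ hφ hc]
  ring

lemma MemLp.coord {p : ℝ≥0∞} {g : Plane → EuclideanSpace ℂ (Fin 2)} (hg : MemLp g p volume)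
    (j : Fin 2) : MemLp (fun x => g x j) p volume :=
  ((EuclideanSpace.proj j : EuclideanSpace ℂ (Fin 2) →L[ℂ] ℂ)).comp_memLp' hg

/-- The real part of a test function. -/
def TestFun.re (φ : TestFun) : Plane → ℝ := fun x => (φ.toFun x).re

/-- The imaginary part of a test function. -/
def TestFun.im (φ : TestFun) : Plane → ℝ := fun x => (φ.toFun x).im

lemma TestFun.contDiff_re (φ : TestFun) : ContDiff ℝ ∞ φ.re := Complex.reCLM.contDiff.comp φ.smooth

lemma TestFun.contDiff_im (φ : TestFun) : ContDiff ℝ ∞ φ.im := Complex.imCLM.contDiff.comp φ.smooth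

lemma TestFun.compact_re (φ : TestFun) : HasCompactSupport φ.re :=
  φ.compact.comp_left (g := Complex.re) rfl

lemma TestFun.compact_im (φ : TestFun) : HasCompactSupport φ.im :=
  φ.compact.comp_left (g := Complex.im) rfl

/-- A test function with real values, seen as a complex one. -/
def TestFun.reFun (φ : TestFun) : TestFun := TestFun.ofReal φ.re φ.contDiff_re φ.compact_re

/-- The imaginary part of a test function, seen as a complex function. -/
def TestFun.imFun (φ : TestFun) : TestFun := TestFun.ofReal φ.im φ.contDiff_im φ.compact_im

lemma TestFun.fderiv_re (φ : TestFun) (x y : Plane) :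
    fderiv ℝ φ.re x y = (fderiv ℝ φ.toFun x y).re := by
  have h := (Complex.reCLM.hasFDerivAt.comp x (φ.differentiable x).hasFDerivAt).fderiv
  have e : fderiv ℝ φ.re x = Complex.reCLM.comp (fderiv ℝ φ.toFun x) := h
  rw [e]; rfl

lemma TestFun.fderiv_im (φ : TestFun) (x y : Plane) :
    fderiv ℝ φ.im x y = (fderiv ℝ φ.toFun x y).im := by
  have h := (Complex.imCLM.hasFDerivAt.comp x (φ.differentiable x).hasFDerivAt).fderiv
  have e : fderiv ℝ φ.im x = Complex.imCLM.comp (fderiv ℝ φ.toFun x) := h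
  rw [e]; rfl

lemma TestFun.l2_eq (φ : TestFun) : φ.l2 = φ.reFun.l2 + Complex.I • φ.imFun.l2 := by
  refine Lp.ext ?_
  filter_upwards [φ.coeFn_l2, φ.reFun.coeFn_l2, φ.imFun.coeFn_l2,
    Lp.coeFn_add φ.reFun.l2 (Complex.I • φ.imFun.l2), Lp.coeFn_smul Complex.I φ.imFun.l2]
    with x h1 h2 h3 h4 h5
  rw [h4, Pi.add_apply, h5, Pi.smul_apply, h1, h2, h3]
  simp only [TestFun.reFun, TestFun.imFun, TestFun.ofReal, TestFun.re, TestFun.im, smul_eq_mul]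
  rw [mul_comm]
  exact (Complex.re_add_im _).symm

lemma TestFun.reFun_d (φ : TestFun) (j : Fin 2) (x : Plane) :
    (φ.reFun.d j).toFun x = (((φ.d j).toFun x).re : ℂ) := by
  rw [TestFun.reFun, TestFun.ofReal_d, TestFun.fderiv_re]; rfl

lemma TestFun.imFun_d (φ : TestFun) (j : Fin 2) (x : Plane) :
    (φ.imFun.d j).toFun x = (((φ.d j).toFun x).im : ℂ) := by
  rw [TestFun.imFun, TestFun.ofReal_d, TestFun.fderiv_im]; rfl

lemma TestFun.d_l2_eq (φ : TestFun) (j : Fin 2) :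
    (φ.d j).l2 = (φ.reFun.d j).l2 + Complex.I • (φ.imFun.d j).l2 := by
  refine Lp.ext ?_
  filter_upwards [(φ.d j).coeFn_l2, (φ.reFun.d j).coeFn_l2, (φ.imFun.d j).coeFn_l2,
    Lp.coeFn_add (φ.reFun.d j).l2 (Complex.I • (φ.imFun.d j).l2),
    Lp.coeFn_smul Complex.I (φ.imFun.d j).l2] with x h1 h2 h3 h4 h5
  rw [h4, Pi.add_apply, h5, Pi.smul_apply, h1, h2, h3, TestFun.reFun_d, TestFun.imFun_d,
    smul_eq_mul, mul_comm]
  exact (Complex.re_add_im _).symm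

lemma TestFun.h1_eq (φ : TestFun) : φ.h1 = φ.reFun.h1 + Complex.I • φ.imFun.h1 :=
  Subtype.ext (Prod.ext φ.l2_eq (funext φ.d_l2_eq))

/-- `IsWeakGradient` tests only with real functions; splitting a complex test function into real and
imaginary parts recovers the complex condition. -/
lemma mem_sobolevH1_of_real {p : PlaneJet}
    (h : ∀ (φ : Plane → ℝ) (hφ : ContDiff ℝ ∞ φ) (hc : HasCompactSupport φ) (j : Fin 2),
      inner ℂ ((TestFun.ofReal φ hφ hc).d j).l2 p.1 = - inner ℂ (TestFun.ofReal φ hφ hc).l2 (p.2 j)) :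
    p ∈ sobolevH1 := by
  intro φ j
  have h1 := h φ.re φ.contDiff_re φ.compact_re j
  have h2 := h φ.im φ.contDiff_im φ.compact_im j
  rw [φ.l2_eq, φ.d_l2_eq, inner_add_left, inner_add_left, inner_smul_left, inner_smul_left,
    TestFun.reFun, TestFun.imFun, h1, h2]
  ring

/-- The element of `H¹` given by a function in `W^{1,2}`. -/
def MemW1.toH1 {v : Plane → ℂ} (hv : MemW1 2 v) : sobolevH1 :=
  ⟨(hv.1.toLp v, fun j => (MemLp.coord hv.2.2 j).toLp _), mem_sobolevH1_of_real fun φ hφ hc j => by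
    have h := (isWeakGradient_weakGradient hv.2.1).2.2 j φ hφ hc
    rw [inner_testFun, inner_testFun]
    refine Eq.trans (integral_congr_ae ?_) (h.trans (congrArg _ (integral_congr_ae ?_)))
    · filter_upwards [hv.1.coeFn_toLp] with x hx
      rw [hx, TestFun.ofReal_d, Complex.conj_ofReal, Complex.real_smul, mul_comm]
      rfl
    · filter_upwards [(MemLp.coord hv.2.2 j).coeFn_toLp] with x hx
      rw [hx]
      simp only [TestFun.ofReal, Complex.conj_ofReal, Complex.real_smul]
      rw [mul_comm]⟩

lemma MemW1.coeFn_toH1 {v : Plane → ℂ} (hv : MemW1 2 v) : hv.toH1.1.1 =ᵐ[volume] v :=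
  hv.1.coeFn_toLp

lemma MemW1.coeFn_toH1_snd {v : Plane → ℂ} (hv : MemW1 2 v) (j : Fin 2) :
    hv.toH1.1.2 j =ᵐ[volume] fun x => weakGradient v x j :=
  (MemLp.coord hv.2.2 j).coeFn_toLp

lemma eLpNorm_coord_le (p : ℝ≥0∞) (g : Plane → EuclideanSpace ℂ (Fin 2)) (j : Fin 2) :
    eLpNorm (fun x => g x j) p volume ≤ eLpNorm g p volume :=
  eLpNorm_mono fun x => PiLp.norm_apply_le (g x) j

lemma MemW1.enorm_toH1_sub_le {v w : Plane → ℂ} (hv : MemW1 2 v) (hw : MemW1 2 w) :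
    ‖hv.toH1 - hw.toH1‖ₑ ≤ w1Norm 2 (v - w) := by
  have h1 : ‖(hv.toH1 - hw.toH1).1.1‖ₑ ≤ w1Norm 2 (v - w) := by
    refine le_trans (le_of_eq ?_) le_self_add
    rw [Lp.enorm_def]
    refine eLpNorm_congr_ae ?_
    filter_upwards [Lp.coeFn_sub hv.toH1.1.1 hw.toH1.1.1, hv.coeFn_toH1, hw.coeFn_toH1]
      with x e1 e2 e3
    change (hv.toH1.1.1 - hw.toH1.1.1) x = _
    rw [e1, Pi.sub_apply, e2, e3, Pi.sub_apply]
  have h2 : ∀ j, ‖(hv.toH1 - hw.toH1).1.2 j‖ₑ ≤ w1Norm 2 (v - w) := by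
    intro j
    refine le_trans ?_ le_add_self
    -- The chosen gradient of v − w need not be the difference of the chosen gradients, but
    -- uniqueness makes them equal almost everywhere.
    have hs := (isWeakGradient_weakGradient hv.2.1).sub (isWeakGradient_weakGradient hw.2.1)
    have hae := (isWeakGradient_weakGradient ⟨_, hs⟩).ae_eq hs
    refine le_trans (le_of_eq ?_) (eLpNorm_coord_le 2 _ j)
    rw [Lp.enorm_def]
    refine eLpNorm_congr_ae ?_
    filter_upwards [Lp.coeFn_sub (hv.toH1.1.2 j) (hw.toH1.1.2 j), hv.coeFn_toH1_snd j,
      hw.coeFn_toH1_snd j, hae] with x e1 e2 e3 e4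
    change (hv.toH1.1.2 j - hw.toH1.1.2 j) x = _
    rw [e1, Pi.sub_apply, e2, e3, e4, Pi.sub_apply, PiLp.sub_apply]
  have h3 : ‖hv.toH1 - hw.toH1‖ₑ = ‖(hv.toH1 - hw.toH1).1‖ₑ := rfl
  by_cases ht : w1Norm 2 (v - w) = ⊤
  · rw [ht]; exact le_top
  have key : ∀ {E : Type} [NormedAddCommGroup E] (x : E), ‖x‖ₑ ≤ w1Norm 2 (v - w) →
      ‖x‖ ≤ (w1Norm 2 (v - w)).toReal := fun x hx => by
    rw [← toReal_enorm]
    exact ENNReal.toReal_mono ht hx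
  rw [h3, ← ofReal_norm]
  refine ENNReal.ofReal_le_of_le_toReal ?_
  rw [Prod.norm_def]
  exact max_le (key _ h1) ((pi_norm_le_iff_of_nonneg ENNReal.toReal_nonneg).2 fun j => key _ (h2 j))

/-- The trajectory of a solution in `H¹`. -/
def IsNLSSolution.toH1 {u : ℝ → Plane → ℂ} (hu : IsNLSSolution u) (t : ℝ) : sobolevH1 :=
  (hu.memH1 t).toH1

lemma IsNLSSolution.continuous_toH1 {u : ℝ → Plane → ℂ} (hu : IsNLSSolution u) :
    Continuous hu.toH1 := by
  rw [continuous_iff_continuousAt]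
  intro t
  rw [ContinuousAt, tendsto_iff_edist_tendsto_0]
  refine tendsto_of_tendsto_of_tendsto_of_le_of_le tendsto_const_nhds (hu.continuousH1 t)
    (fun _ => zero_le) fun s => ?_
  rw [edist_eq_enorm_sub]
  exact (hu.memH1 s).enorm_toH1_sub_le (hu.memH1 t)

lemma lintegral_toH1_snd_le {v : Plane → ℂ} (hv : MemW1 2 v) (j : Fin 2) :
    ∫⁻ x, ‖hv.toH1.1.2 j x‖ₑ ^ 4 ≤ w1Norm 4 v ^ 4 := by
  have h1 : ∫⁻ x, ‖hv.toH1.1.2 j x‖ₑ ^ 4 = eLpNorm (fun x => weakGradient v x j) 4 volume ^ 4 := by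
    have h := eLpNorm_nnreal_pow_eq_lintegral (μ := (volume : Measure Plane))
      (f := fun x => weakGradient v x j) (p := 4) (by norm_num)
    simp only [NNReal.coe_ofNat, ENNReal.coe_ofNat, ENNReal.rpow_ofNat] at h
    rw [h]
    refine lintegral_congr_ae ?_
    filter_upwards [hv.coeFn_toH1_snd j] with x hx
    rw [hx]
  rw [h1]
  exact pow_le_pow_left' ((eLpNorm_coord_le 4 _ j).trans le_add_self) 4

/-! ### The equation as a differential equation in the dual of H¹. -/

/-- du Bois-Reymond: a continuous function with continuous distributional derivative. -/
lemma sub_eq_integral_of_distributional {A D : ℝ → ℂ} (hA : Continuous A) (hD : Continuous D)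
    (h : ∀ θ : ℝ → ℝ, ContDiff ℝ ∞ θ → HasCompactSupport θ →
      ∫ t, deriv θ t • A t = - ∫ t, θ t • D t) (a b : ℝ) : A b - A a = ∫ t in a..b, D t := by
  let I : ℝ → ℂ := fun t => ∫ s in (0 : ℝ)..t, D s
  have hI : ∀ t, HasDerivAt I (D t) t := fun t =>
    intervalIntegral.integral_hasDerivAt_right (hD.intervalIntegrable _ _)
      (hD.stronglyMeasurableAtFilter _ _) hD.continuousAt
  have hIc : Continuous I := continuous_iff_continuousAt.2 fun t => (hI t).continuousAt
  -- A − I has zero distributional derivative, where I is a primitive of D.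
  have hB : ∀ θ : ℝ → ℝ, ContDiff ℝ ∞ θ → HasCompactSupport θ →
      ∫ t, deriv θ t • (A t - I t) = 0 := by
    intro θ hθ hc
    have hd : Continuous (deriv θ) := hθ.continuous_deriv (by simp)
    have hp : ∫ t, deriv θ t • I t = - ∫ t, θ t • D t := by
      have hint := integral_bilinear_hasDerivAt_right_eq_neg_left_of_integrable
        (L := ContinuousLinearMap.lsmul ℝ ℝ) (u := θ) (v := I) (u' := deriv θ) (v' := D)
        (fun t _ => (hθ.differentiable (by simp) t).hasDerivAt) (fun t _ => hI t)
        ((hθ.continuous.smul hD).integrable_of_hasCompactSupport hc.smul_right)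
        ((hd.smul hIc).integrable_of_hasCompactSupport hc.deriv.smul_right)
        ((hθ.continuous.smul hIc).integrable_of_hasCompactSupport hc.smul_right)
      simp only [ContinuousLinearMap.lsmul_apply] at hint
      rw [hint, neg_neg]
    simp_rw [smul_sub]
    have i1 : Integrable fun t => deriv θ t • A t :=
      (hd.smul hA).integrable_of_hasCompactSupport hc.deriv.smul_right
    have i2 : Integrable fun t => deriv θ t • I t :=
      (hd.smul hIc).integrable_of_hasCompactSupport hc.deriv.smul_right
    rw [integral_sub i1 i2, h θ hθ hc, hp, sub_self]
  let η₀ : ContDiffBump (0 : ℝ) := ⟨1, 2, by norm_num, by norm_num⟩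
  let η : ℝ → ℝ := η₀.normed volume
  have hη1 : ∫ t, η t = 1 := η₀.integral_normed
  have hηs : ContDiff ℝ ∞ η := η₀.contDiff_normed
  have hηc : HasCompactSupport η := η₀.hasCompactSupport_normed
  have hBc : Continuous fun t => A t - I t := hA.sub hIc
  have hconst : ∀ᵐ t : ℝ, A t - I t = ∫ s, η s • (A s - I s) := by
    refine ae_eq_of_integral_contDiff_smul_eq hBc.locallyIntegrable
      (continuous_const.locallyIntegrable) fun g hg hgc => ?_
    -- Subtracting a multiple of η gives k mean zero, so its primitive θ has compact support and may
    -- be tested against A − I. The outcome is that A − I equals its η-average.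
    let k : ℝ → ℝ := fun t => g t - (∫ s, g s) * η t
    have hk : ContDiff ℝ ∞ k := hg.sub (contDiff_const.mul hηs)
    have hkc : HasCompactSupport k := hgc.sub (hηc.mul_left)
    have hgi : Integrable g := hg.continuous.integrable_of_hasCompactSupport hgc
    have hηi : Integrable η := hηs.continuous.integrable_of_hasCompactSupport hηc
    have hki : Integrable k := hk.continuous.integrable_of_hasCompactSupport hkc
    have hk0 : ∫ t, k t = 0 := by
      simp only [k]
      rw [integral_sub hgi (hηi.const_mul _), integral_const_mul, hη1, mul_one, sub_self]
    obtain ⟨R, hR⟩ := hkc.isCompact.isBounded.subset_closedBall 0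
    let θ : ℝ → ℝ := fun t => ∫ s in (-(|R| + 1))..t, k s
    have hθd : ∀ t, HasDerivAt θ (k t) t := fun t =>
      intervalIntegral.integral_hasDerivAt_right (hk.continuous.intervalIntegrable _ _)
        (hk.continuous.stronglyMeasurableAtFilter _ _) hk.continuous.continuousAt
    have hθe : deriv θ = k := funext fun t => (hθd t).deriv
    have hθs : ContDiff ℝ ∞ θ := by
      rw [contDiff_infty_iff_deriv]
      exact ⟨fun t => (hθd t).differentiableAt, hθe ▸ hk⟩
    have hk00 : ∀ t, |R| + 1 ≤ |t| → k t = 0 := fun t ht => by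
      by_contra hne
      have := hR (subset_tsupport k hne)
      rw [mem_closedBall_zero_iff, Real.norm_eq_abs] at this
      linarith [le_abs_self R]
    have hθc : HasCompactSupport θ := by
      refine HasCompactSupport.intro (isCompact_Icc (a := -(|R| + 1)) (b := |R| + 1)) fun t ht => ?_
      have h0 : 0 ≤ |R| := abs_nonneg R
      rcases lt_or_ge t (-(|R| + 1)) with h1 | h1
      · refine intervalIntegral.integral_zero_ae (Eventually.of_forall fun s hs => hk00 s ?_)
        rw [uIoc_of_ge h1.le] at hs
        rw [abs_of_nonpos (a := s) (by linarith [hs.2])]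
        linarith [hs.2]
      · have h2 : |R| + 1 < t := by
          by_contra h3
          exact ht ⟨h1, not_lt.1 h3⟩
        have : θ t = ∫ s, k s := by
          refine intervalIntegral.integral_eq_integral_of_support_subset fun s hs => ?_
          by_contra h3
          rw [mem_Ioc, not_and_or, not_lt, not_le] at h3
          refine hs (hk00 s ?_)
          rcases h3 with h3 | h3
          · rw [abs_of_nonpos (a := s) (by linarith)]; linarith
          · rw [abs_of_nonneg (a := s) (by linarith)]; linarith
        rw [this, hk0]
    have := hB θ hθs hθc
    rw [hθe] at this
    have hi1 : Integrable fun t => g t • (A t - I t) :=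
      (hg.continuous.smul hBc).integrable_of_hasCompactSupport hgc.smul_right
    have hi2 : Integrable fun t => ((∫ s, g s) * η t) • (A t - I t) :=
      ((continuous_const.mul hηs.continuous).smul hBc).integrable_of_hasCompactSupport
        (hηc.mul_left).smul_right
    simp only [k, sub_smul] at this
    rw [integral_sub hi1 hi2, sub_eq_zero] at this
    rw [this, integral_smul_const]
    simp_rw [mul_smul]
    rw [integral_smul]
  -- Continuity upgrades equality almost everywhere to equality everywhere.
  have hall := (hBc.ae_eq_iff_eq volume continuous_const).1 hconst
  have e1 := congrFun hall a
  have e2 := congrFun hall b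
  have e3 : I b - I a = ∫ t in a..b, D t :=
    intervalIntegral.integral_interval_sub_left (hD.intervalIntegrable _ _)
      (hD.intervalIntegrable _ _)
  rw [← e3]
  linear_combination e2 - e1

/-- The inclusion `H¹ → L²`. -/
def h1Fst : sobolevH1 →L[ℂ] PlaneL2 := (ContinuousLinearMap.fst ℂ _ _).comp sobolevH1.subtypeL

/-- The partial derivative `∂ⱼ : H¹ → L²`. -/
def h1Snd (j : Fin 2) : sobolevH1 →L[ℂ] PlaneL2 :=
  ((ContinuousLinearMap.proj j).comp (ContinuousLinearMap.snd ℂ _ _)).comp sobolevH1.subtypeL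

/-- The dual of `H¹`. -/
def DualH1 : Type := sobolevH1 →L[ℂ] ℂ

instance : NormedAddCommGroup DualH1 := inferInstanceAs (NormedAddCommGroup (sobolevH1 →L[ℂ] ℂ))

instance : NormedSpace ℂ DualH1 := inferInstanceAs (NormedSpace ℂ (sobolevH1 →L[ℂ] ℂ))

instance : CompleteSpace DualH1 := inferInstanceAs (CompleteSpace (sobolevH1 →L[ℂ] ℂ))

namespace DualH1

/-- The underlying continuous linear functional. -/
def clm (L : DualH1) : sobolevH1 →L[ℂ] ℂ := L

lemma norm_clm (L : DualH1) : ‖L.clm‖ = ‖L‖ := rfl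

lemma clm_sub (L M : DualH1) : (L - M).clm = L.clm - M.clm := rfl

/-- Evaluation at `ψ`. -/
def eval (ψ : sobolevH1) : DualH1 →L[ℂ] ℂ :=
  LinearMap.mkContinuous ⟨⟨fun L => L.clm ψ, fun _ _ => rfl⟩,
    fun _ _ => rfl⟩ ‖ψ‖ fun L => by
      rw [mul_comm, ← norm_clm]; exact L.clm.le_opNorm ψ

lemma eval_apply (ψ : sobolevH1) (L : DualH1) : eval ψ L = L.clm ψ := rfl

/-- Composition with an operator on `H¹`. -/
def pull (T : sobolevH1 →L[ℂ] sobolevH1) : DualH1 →L[ℂ] DualH1 :=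
  LinearMap.mkContinuous ⟨⟨fun L => L.clm.comp T, fun _ _ => rfl⟩,
    fun _ _ => rfl⟩ ‖T‖ fun L => by
      rw [mul_comm, ← norm_clm]; exact L.clm.opNorm_comp_le T

lemma pull_clm (T : sobolevH1 →L[ℂ] sobolevH1) (L : DualH1) (ψ : sobolevH1) :
    (pull T L).clm ψ = L.clm (T ψ) := rfl

lemma ext {L M : DualH1} (h : ∀ ψ, L.clm ψ = M.clm ψ) : L = M :=
  ContinuousLinearMap.ext h

/-- The functional `ψ ↦ ⟪v, T ψ⟫`. -/
def ofL2 (T : sobolevH1 →L[ℂ] PlaneL2) (v : PlaneL2) : DualH1 := (innerSL ℂ v).comp T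

lemma continuous_ofL2 (T : sobolevH1 →L[ℂ] PlaneL2) : Continuous (ofL2 T) :=
  (innerSL ℂ).continuous.clm_comp continuous_const

end DualH1

/-- The functional `ψ ↦ ⟪v, ψ⟫` on `H¹`. -/
def dualL2 (v : PlaneL2) : DualH1 := DualH1.ofL2 h1Fst v

lemma dualL2_clm (v : PlaneL2) (ψ : sobolevH1) : (dualL2 v).clm ψ = inner ℂ v ψ.1.1 := rfl

/-- The functional `ψ ↦ ⟪∇v, ∇ψ⟫ + ⟪f, ψ⟫` on `H¹`. -/
def schrForm (v : sobolevH1) (f : PlaneL2) : DualH1 :=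
  DualH1.ofL2 (h1Snd 0) (v.1.2 0) + DualH1.ofL2 (h1Snd 1) (v.1.2 1) + DualH1.ofL2 h1Fst f

lemma schrForm_clm (v : sobolevH1) (f : PlaneL2) (ψ : sobolevH1) :
    (schrForm v f).clm ψ = inner ℂ (v.1.2 0) (ψ.1.2 0) + inner ℂ (v.1.2 1) (ψ.1.2 1)
      + inner ℂ f ψ.1.1 := rfl

lemma Continuous.schrForm {X : Type*} [TopologicalSpace X] {u : X → sobolevH1} {f : X → PlaneL2}
    (hu : Continuous u) (hf : Continuous f) : Continuous fun t => schrForm (u t) (f t) :=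
  (((DualH1.continuous_ofL2 _).comp ((continuous_h1_snd 0).comp hu)).add
    ((DualH1.continuous_ofL2 _).comp ((continuous_h1_snd 1).comp hu))).add
    ((DualH1.continuous_ofL2 _).comp hf)

/-- `u` solves `i∂ₜu + Δu = f` in the dual of `H¹`. -/
structure Evolves (u : ℝ → sobolevH1) (f : ℝ → PlaneL2) : Prop where
  continuous_fst : Continuous u
  continuous_snd : Continuous f
  -- ∂ₜu = −i(−Δu + f) appears with +i because the inner product is antilinear in its first entry,
  -- where u stands.
  hasDerivAt : ∀ t, HasDerivAt (fun t => dualL2 (u t).1.1) (Complex.I • schrForm (u t) (f t)) t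

lemma sum_fderiv_eq_laplacian {ψ : Plane → ℝ} (h : ContDiff ℝ ∞ ψ) (hc : HasCompactSupport ψ)
    (x : Plane) : ((Δ ψ x : ℝ) : ℂ) = (((TestFun.ofReal ψ h hc).d 0).d 0).toFun x
      + (((TestFun.ofReal ψ h hc).d 1).d 1).toFun x := by
  have hd : ∀ j : Fin 2, (((TestFun.ofReal ψ h hc).d j).d j).toFun x
      = ((iteratedFDeriv ℝ 2 ψ x ![planeBasis j, planeBasis j] : ℝ) : ℂ) := by
    intro j
    have hs : ContDiff ℝ ∞ fun y => fderiv ℝ ψ y (planeBasis j) :=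
      (h.fderiv_right (m := ∞) (by simp)).clm_apply contDiff_const
    have hcj : HasCompactSupport fun y => fderiv ℝ ψ y (planeBasis j) := hc.fderiv_apply (𝕜 := ℝ) _
    have e : (TestFun.ofReal ψ h hc).d j = TestFun.ofReal _ hs hcj := by
      have : ((TestFun.ofReal ψ h hc).d j).toFun = (TestFun.ofReal _ hs hcj).toFun :=
        funext fun y => TestFun.ofReal_d ψ h hc j y
      cases h1 : (TestFun.ofReal ψ h hc).d j
      rw [h1] at this
      simp only [TestFun.ofReal] at this ⊢
      congr 1
    rw [e, TestFun.ofReal_d, iteratedFDeriv_two_apply]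
    congr 1
    have hdiff : DifferentiableAt ℝ (fderiv ℝ ψ) x :=
      (h.fderiv_right (m := ∞) (by simp)).differentiable (by simp) x
    have := (hdiff.hasFDerivAt.clm_apply (hasFDerivAt_const (planeBasis j) x)).fderiv
    rw [this]
    simp
  rw [hd, hd, congrFun (InnerProductSpace.laplacian_eq_iteratedFDeriv_orthonormalBasis ψ
    (EuclideanSpace.basisFun (Fin 2) ℝ)) x, Fin.sum_univ_two]
  push_cast
  simp [planeBasis]

lemma inner_ofReal_testFun {ψ : Plane → ℝ} (h : ContDiff ℝ ∞ ψ) (hc : HasCompactSupport ψ)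
    {v : PlaneL2} {w : Plane → ℂ} (hv : v =ᵐ[volume] w) :
    ∫ x, (ψ x : ℂ) * w x = inner ℂ (TestFun.ofReal ψ h hc).l2 v := by
  rw [inner_testFun]
  refine integral_congr_ae ?_
  filter_upwards [hv] with x hx
  rw [hx]
  simp only [TestFun.ofReal, Complex.conj_ofReal]
  ring

namespace IsNLSSolution

variable {u : ℝ → Plane → ℂ}

lemma continuous_nls (hu : IsNLSSolution u) : Continuous fun t => nlsL2 (hu.toH1 t) :=
  continuous_nlsL2.comp hu.continuous_toH1

/-- The space-time equation is tested with θ(t)ψ(x), and one spatial derivative is moved from Δψ to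
u. The conjugate arises because u now stands in the second entry of the inner product. -/
lemma distributional (hu : IsNLSSolution u) {ψ : Plane → ℝ} (h : ContDiff ℝ ∞ ψ)
    (hc : HasCompactSupport ψ) {θ : ℝ → ℝ} (hθ : ContDiff ℝ ∞ θ) (hθc : HasCompactSupport θ) :
    ∫ t, deriv θ t • inner ℂ (TestFun.ofReal ψ h hc).l2 (hu.toH1 t).1.1
      = - ∫ t, θ t • (-Complex.I * (starRingEnd ℂ)
        ((schrForm (hu.toH1 t) (nlsL2 (hu.toH1 t))).clm (TestFun.ofReal ψ h hc).h1)) := by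
  set Ψ := TestFun.ofReal ψ h hc with hΨ
  have hφ : ContDiff ℝ ∞ fun p : ℝ × Plane => θ p.1 * ψ p.2 :=
    (hθ.comp contDiff_fst).mul (h.comp contDiff_snd)
  have hφc : HasCompactSupport fun p : ℝ × Plane => θ p.1 * ψ p.2 := by
    refine HasCompactSupport.intro (hθc.isCompact.prod hc.isCompact) fun p hp => ?_
    rw [mem_prod, not_and_or] at hp
    rcases hp with hp | hp
    · simp [image_eq_zero_of_notMem_tsupport hp]
    · simp [image_eq_zero_of_notMem_tsupport hp]
  have key := hu.equation _ hφ hφc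
  have hint : ∀ (φ : TestFun) (w : PlaneL2), Integrable fun x => φ.toFun x * w x := fun φ w =>
    (locallyIntegrable_planeL2 w).integrable_smul_left_of_hasCompactSupport φ.continuous φ.compact
  have hL : ∀ t, ∫ x, (-Complex.I * deriv (fun s => ((θ s * ψ x : ℝ) : ℂ)) t
        + ((Δ (fun y => θ t * ψ y) x : ℝ) : ℂ)) * u t x
      = -Complex.I * (deriv θ t * inner ℂ Ψ.l2 (hu.toH1 t).1.1)
        - θ t * (inner ℂ (Ψ.d 0).l2 ((hu.toH1 t).1.2 0)
          + inner ℂ (Ψ.d 1).l2 ((hu.toH1 t).1.2 1)) := by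
    intro t
    have hae : (hu.toH1 t).1.1 =ᵐ[volume] u t := (hu.memH1 t).coeFn_toH1
    have e1 : ∀ x, (Δ (fun y => θ t * ψ y) x : ℝ) = θ t * Δ ψ x := fun x =>
      InnerProductSpace.laplacian_smul (θ t) (contDiff_infty.1 h 2).contDiffAt
    have e2 : ∀ x, deriv (fun s => ((θ s * ψ x : ℝ) : ℂ)) t = ((deriv θ t * ψ x : ℝ) : ℂ) :=
      fun x => (((hθ.differentiable (by simp) t).hasDerivAt.mul_const (ψ x)).ofReal_comp).deriv
    have hreal : ∀ j x, (starRingEnd ℂ) (((Ψ.d j).d j).toFun x) = ((Ψ.d j).d j).toFun x := by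
      intro j x
      have hs : ∀ x, (starRingEnd ℂ) ((Ψ.d j).toFun x) = (Ψ.d j).toFun x := fun x => by
        rw [hΨ, TestFun.ofReal_d, Complex.conj_ofReal]
      have h3 := ((Complex.conjCLE.toContinuousLinearMap.hasFDerivAt.comp x
        ((Ψ.d j).differentiable x).hasFDerivAt)).fderiv
      have h4 : (Complex.conjCLE.toContinuousLinearMap : ℂ → ℂ) ∘ (Ψ.d j).toFun
          = (Ψ.d j).toFun := funext fun x => hs x
      rw [h4] at h3
      have h5 := congrArg (fun L : Plane →L[ℝ] ℂ => L (planeBasis j)) h3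
      exact h5.symm
    -- The weak-gradient relation tested with ∂ⱼψ.
    have e3 : ∀ j, inner ℂ (Ψ.d j).l2 ((hu.toH1 t).1.2 j)
        = - ∫ x, ((Ψ.d j).d j).toFun x * (hu.toH1 t).1.1 x := by
      intro j
      have := (hu.toH1 t).2 (Ψ.d j) j
      rw [← neg_eq_iff_eq_neg] at this
      rw [← this, inner_testFun]
      congr 1
      refine integral_congr_ae (Eventually.of_forall fun x => ?_)
      change (hu.toH1 t).1.1 x * (starRingEnd ℂ) (((Ψ.d j).d j).toFun x) = _
      rw [hreal]
      ring
    rw [e3, e3, ← inner_ofReal_testFun h hc (EventuallyEq.refl _ _)]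
    have i0 : Integrable fun x => (ψ x : ℂ) * (hu.toH1 t).1.1 x := hint Ψ _
    calc _ = ∫ x, (-Complex.I * deriv θ t) * ((ψ x : ℂ) * (hu.toH1 t).1.1 x)
          + (θ t : ℂ) * (((Ψ.d 0).d 0).toFun x * (hu.toH1 t).1.1 x
            + ((Ψ.d 1).d 1).toFun x * (hu.toH1 t).1.1 x) := by
          refine integral_congr_ae ?_
          filter_upwards [hae] with x hx
          rw [hx, e1, e2]
          push_cast
          rw [sum_fderiv_eq_laplacian h hc]
          ring
      _ = _ := by
          have i4 : Integrable fun x => (θ t : ℂ) * (((Ψ.d 0).d 0).toFun x * (hu.toH1 t).1.1 x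
              + ((Ψ.d 1).d 1).toFun x * (hu.toH1 t).1.1 x) :=
            ((hint _ _).add (hint _ _)).const_mul _
          rw [integral_add (i0.const_mul _) i4,
            integral_const_mul, integral_const_mul, integral_add (hint _ _) (hint _ _)]
          ring
  have hR : ∀ t, ∫ x, ((θ t * ψ x : ℝ) : ℂ) * nlsF (u t x)
      = θ t * inner ℂ Ψ.l2 (nlsL2 (hu.toH1 t)) := by
    intro t
    have hae : (hu.toH1 t).1.1 =ᵐ[volume] u t := (hu.memH1 t).coeFn_toH1
    have hae2 : nlsL2 (hu.toH1 t) =ᵐ[volume] fun x => nlsF (u t x) := by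
      filter_upwards [coeFn_nlsL2 (hu.toH1 t), hae] with x h1 h2
      rw [h1, h2]
    rw [← inner_ofReal_testFun h hc hae2, ← integral_const_mul]
    refine integral_congr_ae (Eventually.of_forall fun x => ?_)
    push_cast
    ring
  simp only [hL, hR] at key
  have hθ' : Continuous (deriv θ) := hθ.continuous_deriv (by simp)
  have cu := hu.continuous_toH1
  have c0 : Continuous fun t => inner ℂ Ψ.l2 (hu.toH1 t).1.1 :=
    continuous_const.inner (continuous_h1_fst.comp cu)
  have cj : ∀ j, Continuous fun t => inner ℂ (Ψ.d j).l2 ((hu.toH1 t).1.2 j) := fun j =>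
    continuous_const.inner ((continuous_h1_snd j).comp cu)
  have cf : Continuous fun t => inner ℂ Ψ.l2 (nlsL2 (hu.toH1 t)) :=
    continuous_const.inner hu.continuous_nls
  have hcs : ∀ {k : ℝ → ℝ} {g : ℝ → ℂ}, Continuous k → HasCompactSupport k → Continuous g →
      Integrable fun t => (k t : ℂ) * g t := fun {k g} hk hkc hg => by
    have : Integrable fun t => k t • g t :=
      (hk.smul hg).integrable_of_hasCompactSupport hkc.smul_right
    exact this
  have i1 := (hcs hθ' hθc.deriv c0).const_mul (-Complex.I)
  have i2 := hcs hθ.continuous hθc ((cj 0).add (cj 1))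
  have i3 := hcs hθ.continuous hθc cf
  simp only [Pi.add_apply] at i2
  rw [integral_sub i1 i2, integral_const_mul] at key
  have e4 : ∀ t, θ t • (-Complex.I * (starRingEnd ℂ)
        ((schrForm (hu.toH1 t) (nlsL2 (hu.toH1 t))).clm Ψ.h1))
      = -Complex.I * ((θ t : ℂ) * (inner ℂ (Ψ.d 0).l2 ((hu.toH1 t).1.2 0)
          + inner ℂ (Ψ.d 1).l2 ((hu.toH1 t).1.2 1))
        + (θ t : ℂ) * inner ℂ Ψ.l2 (nlsL2 (hu.toH1 t))) := by
    intro t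
    rw [schrForm_clm]
    simp only [map_add, inner_conj_symm, Complex.real_smul]
    change θ t * (-Complex.I * (inner ℂ (Ψ.d 0).l2 _ + inner ℂ (Ψ.d 1).l2 _ + inner ℂ Ψ.l2 _)) = _
    ring
  simp_rw [e4]
  rw [integral_const_mul, integral_add i2 i3]
  simp_rw [Complex.real_smul]
  linear_combination Complex.I * key
    + (∫ t, ((deriv θ t : ℝ) : ℂ) * inner ℂ Ψ.l2 (hu.toH1 t).1.1) * Complex.I_mul_I

/-- `sub_eq_integral_of_distributional` turns the weak equation into an integral equation, tested
first with real functions. The integrand is continuous in the dual norm, so the fundamental theorem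
of calculus gives differentiability there. -/
lemma evolves (hu : IsNLSSolution u) : Evolves hu.toH1 fun t => nlsL2 (hu.toH1 t) := by
  have cu := hu.continuous_toH1
  have cR : Continuous fun t => Complex.I • schrForm (hu.toH1 t) (nlsL2 (hu.toH1 t)) := by
    have h := Continuous.schrForm cu hu.continuous_nls
    fun_prop
  have key : ∀ a b, dualL2 (hu.toH1 b).1.1 - dualL2 (hu.toH1 a).1.1
      = ∫ t in a..b, Complex.I • schrForm (hu.toH1 t) (nlsL2 (hu.toH1 t)) := by
    intro a b
    have hreal : ∀ (ψ : Plane → ℝ) (h : ContDiff ℝ ∞ ψ) (hc : HasCompactSupport ψ),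
        (dualL2 (hu.toH1 b).1.1 - dualL2 (hu.toH1 a).1.1).clm (TestFun.ofReal ψ h hc).h1
        = (∫ t in a..b, Complex.I • schrForm (hu.toH1 t) (nlsL2 (hu.toH1 t))).clm
          (TestFun.ofReal ψ h hc).h1 := by
      intro ψ h hc
      set Ψ := TestFun.ofReal ψ h hc
      have cs : Continuous fun t => (schrForm (hu.toH1 t) (nlsL2 (hu.toH1 t))).clm Ψ.h1 :=
        (DualH1.eval Ψ.h1).continuous.comp (Continuous.schrForm cu hu.continuous_nls)
      have := sub_eq_integral_of_distributional
        (A := fun t => inner ℂ Ψ.l2 (hu.toH1 t).1.1)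
        (continuous_const.inner (continuous_h1_fst.comp cu))
        (continuous_const.mul (Complex.continuous_conj.comp cs))
        (fun θ hθ hθc => hu.distributional h hc hθ hθc) a b
      have h2 := congrArg (starRingEnd ℂ) this
      rw [map_sub, inner_conj_symm, inner_conj_symm] at h2
      rw [← DualH1.eval_apply, ← DualH1.eval_apply,
        ← ContinuousLinearMap.intervalIntegral_comp_comm _ (cR.intervalIntegrable _ _)]
      refine Eq.trans h2 ?_
      have h3 := Complex.conjCLE.toContinuousLinearMap.intervalIntegral_comp_comm
        ((continuous_const.mul (Complex.continuous_conj.comp cs)).intervalIntegrable (μ := volume)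
          (E := ℂ) (u := fun t => -Complex.I * (starRingEnd ℂ)
          ((schrForm (hu.toH1 t) (nlsL2 (hu.toH1 t))).clm Ψ.h1)) a b)
      refine Eq.trans h3.symm ?_
      refine intervalIntegral.integral_congr fun t _ => ?_
      simp [DualH1.eval_apply]
    -- Real and imaginary parts, then density, extend the identity to all of H¹.
    refine DualH1.ext fun ψ => congrFun (denseRange_testFun.equalizer
      (ContinuousLinearMap.continuous _) (ContinuousLinearMap.continuous _)
      (funext fun φ => ?_)) ψ
    simp only [Function.comp_apply]
    rw [φ.h1_eq, map_add, map_add, map_smul, map_smul]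
    simp only [TestFun.reFun, TestFun.imFun, hreal]
  refine ⟨cu, hu.continuous_nls, fun t => ?_⟩
  have h1 := (intervalIntegral.integral_hasDerivAt_right (cR.intervalIntegrable 0 t)
    (cR.stronglyMeasurableAtFilter _ _) cR.continuousAt).add_const (dualL2 (hu.toH1 0).1.1)
  refine h1.congr_of_eventuallyEq (Eventually.of_forall fun s => ?_)
  beta_reduce
  rw [← key, sub_add_cancel]

end IsNLSSolution

/-! ### Evolution of bilinear quantities and conservation of mass. -/

lemma DualH1.tendsto_clm {ι : Type*} {l : Filter ι} {L : ι → DualH1} {ψ : ι → sobolevH1}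
    {L₀ : DualH1} {ψ₀ : sobolevH1} (hL : Tendsto L l (𝓝 L₀)) (hψ : Tendsto ψ l (𝓝 ψ₀)) :
    Tendsto (fun i => (L i).clm (ψ i)) l (𝓝 (L₀.clm ψ₀)) := by
  have h : Continuous fun p : (sobolevH1 →L[ℂ] ℂ) × sobolevH1 => p.1 p.2 :=
    isBoundedBilinearMap_apply.continuous
  exact (h.tendsto (L₀, ψ₀)).comp (hL.prodMk_nhds hψ)

lemma DualH1.real_smul_clm (c : ℝ) (L : DualH1) (ψ : sobolevH1) :
    (c • L).clm ψ = c * L.clm ψ := by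
  rw [← DualH1.eval_apply, ContinuousLinearMap.map_smul_of_tower, Complex.real_smul]
  rfl

lemma dualL2_shiftL2 (y : Plane) (v : PlaneL2) :
    dualL2 (shiftL2 y v) = DualH1.pull (shiftH1 (-y)) (dualL2 v) :=
  DualH1.ext fun ψ => inner_shiftL2_left y v ψ.1.1

lemma schrForm_shift (y : Plane) (v : sobolevH1) (f : PlaneL2) :
    schrForm (shiftH1 y v) (shiftL2 y f) = DualH1.pull (shiftH1 (-y)) (schrForm v f) := by
  refine DualH1.ext fun ψ => ?_
  rw [DualH1.pull_clm, schrForm_clm, schrForm_clm]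
  simp only [shiftH1_snd, shiftH1_fst, inner_shiftL2_left]

lemma real_smul_planeL2 (r : ℝ) (v : PlaneL2) : r • v = (r : ℂ) • v := by
  refine Lp.ext ?_
  filter_upwards [Lp.coeFn_smul r v, Lp.coeFn_smul (r : ℂ) v] with x h1 h2
  rw [h1, h2, Pi.smul_apply, Pi.smul_apply, Complex.real_smul, smul_eq_mul]

namespace Evolves

variable {u v : ℝ → sobolevH1} {f g : ℝ → PlaneL2}

lemma shift (h : Evolves u f) (y : Plane) :
    Evolves (fun t => shiftH1 y (u t)) fun t => shiftL2 y (f t) := by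
  refine ⟨(shiftH1 y).continuous.comp h.continuous_fst,
    (shiftL2 y).continuous.comp h.continuous_snd, fun t => ?_⟩
  have := (((DualH1.pull (shiftH1 (-y))).restrictScalars ℝ).hasFDerivAt).comp_hasDerivAt t
    (h.hasDerivAt t)
  simp only [shiftH1_fst, dualL2_shiftL2, schrForm_shift]
  rw [← map_smul]
  exact this

/-- u and v are differentiable only in the dual of H¹. The slope splits into the slope of ⟨u, ·⟩ at
A v(s), which converges in H¹ as s → t, plus the conjugate slope of ⟨v, ·⟩ at the fixed element B
u(t). The L² adjointness of A and B makes the splitting exact. -/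
lemma hasDerivAt_inner (hu : Evolves u f) (hv : Evolves v g) {A B : sobolevH1 →L[ℂ] sobolevH1}
    (hAB : ∀ x y : sobolevH1, inner ℂ x.1.1 (A y).1.1 = inner ℂ (B x).1.1 y.1.1) (t : ℝ) :
    HasDerivAt (fun t => inner ℂ (u t).1.1 (A (v t)).1.1)
      (Complex.I * (schrForm (u t) (f t)).clm (A (v t))
        + (starRingEnd ℂ) (Complex.I * (schrForm (v t) (g t)).clm (B (u t)))) t := by
  rw [hasDerivAt_iff_tendsto_slope]
  have h1 := DualH1.tendsto_clm (hasDerivAt_iff_tendsto_slope.1 (hu.hasDerivAt t))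
    (((A.continuous.comp hv.continuous_fst).tendsto t).mono_left (nhdsWithin_le_nhds (s := {t}ᶜ)))
  have h2 := (Complex.continuous_conj.tendsto _).comp
    (DualH1.tendsto_clm (hasDerivAt_iff_tendsto_slope.1 (hv.hasDerivAt t))
    (tendsto_const_nhds (x := B (u t))))
  refine (h1.add h2).congr fun s => ?_
  simp only [Function.comp_apply, slope, vsub_eq_sub, DualH1.real_smul_clm, DualH1.clm_sub,
    sub_apply, dualL2_clm, map_mul, map_sub, inner_conj_symm, Complex.conj_ofReal,
    Complex.real_smul]
  rw [← hAB, ← hAB]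
  ring

/-- Evolution of `⟪u, b u(· + y)⟫`. -/
lemma hasDerivAt_inner_mul_shift (hu : Evolves u f) (b : Multiplier) (y : Plane) (t : ℝ) :
    HasDerivAt (fun t => inner ℂ (u t).1.1 (mulL2 b.fn (shiftL2 y (u t).1.1)))
      (Complex.I * ((∑ j, (inner ℂ ((u t).1.2 j) (mulL2 (b.grad j) (shiftL2 y (u t).1.1))
          - inner ℂ (mulL2 (b.grad j) (u t).1.1) (shiftL2 y ((u t).1.2 j))))
        + (inner ℂ (f t) (mulL2 b.fn (shiftL2 y (u t).1.1))
          - inner ℂ (mulL2 b.fn (u t).1.1) (shiftL2 y (f t))))) t := by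
  have h := hu.hasDerivAt_inner (hu.shift y) (A := b.mulH1) (B := b.mulH1) (fun x y => by
    simp only [Multiplier.mulH1_fst, inner_mulL2]) t
  refine h.congr_deriv ?_
  -- The terms pairing ∂ⱼu with b ∂ⱼu(· + y) cancel; only the commutators with ∂ⱼb survive.
  simp only [schrForm_clm, Multiplier.mulH1_fst, Multiplier.mulH1_snd, shiftH1_fst, shiftH1_snd,
    map_mul, map_add, inner_conj_symm, Complex.conj_I, inner_add_right,
    Fin.sum_univ_two, inner_mulL2]
  ring

/-- Evolution of `⟪u, u(· + y)⟫`. -/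
lemma hasDerivAt_inner_shift (hu : Evolves u f) (y : Plane) (t : ℝ) :
    HasDerivAt (fun t => inner ℂ (u t).1.1 (shiftL2 y (u t).1.1))
      (Complex.I * (inner ℂ (f t) (shiftL2 y (u t).1.1)
        - inner ℂ (u t).1.1 (shiftL2 y (f t)))) t := by
  have h := hu.hasDerivAt_inner (hu.shift y) (A := ContinuousLinearMap.id ℂ _)
    (B := ContinuousLinearMap.id ℂ _) (fun x y => rfl) t
  refine h.congr_deriv ?_
  simp only [schrForm_clm, shiftH1_fst, shiftH1_snd, ContinuousLinearMap.id_apply,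
    map_mul, map_add, inner_conj_symm, Complex.conj_I]
  ring

/-- Conservation of the `L²` norm when `⟪f, u⟫` is real. -/
lemma norm_sq_eq (hu : Evolves u f) (hr : ∀ t, (inner ℂ (f t) (u t).1.1).im = 0) (a b : ℝ) :
    ‖(u a).1.1‖ = ‖(u b).1.1‖ := by
  have hd : ∀ t, HasDerivAt (fun t => inner ℂ (u t).1.1 (u t).1.1) 0 t := fun t => by
    have h := hu.hasDerivAt_inner_shift 0 t
    simp only [shiftL2_zero] at h
    refine h.congr_deriv ?_
    have e : inner ℂ (f t) (u t).1.1 - inner ℂ (u t).1.1 (f t) = 0 := by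
      rw [← inner_conj_symm (u t).1.1 (f t), Complex.sub_conj, hr]
      simp
    rw [e, mul_zero]
  have := is_const_of_deriv_eq_zero (fun t => (hd t).differentiableAt) (fun t => (hd t).deriv) a b
  rw [inner_self_eq_norm_sq_to_K, inner_self_eq_norm_sq_to_K] at this
  have h2 : ‖(u a).1.1‖ ^ 2 = ‖(u b).1.1‖ ^ 2 := by exact_mod_cast this
  exact (pow_left_inj₀ (norm_nonneg _) (norm_nonneg _) two_ne_zero).1 h2

/-- Evolution of the norm of a difference quotient. -/
lemma hasDerivAt_norm_diffQuot_sq (hu : Evolves u f)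
    (hr : ∀ t, (inner ℂ (f t) (u t).1.1).im = 0) (j : Fin 2) (h : ℝ) (t : ℝ) :
    HasDerivAt (fun t => ‖diffQuot j h (u t).1.1‖ ^ 2)
      (2 * (inner ℂ (diffQuot j h (u t).1.1) (diffQuot j h (f t))).im) t := by
  have hsq : ∀ w : PlaneL2, ‖w‖ ^ 2 = (inner ℂ w w).re := fun w =>
    (inner_self_eq_norm_sq (𝕜 := ℂ) w).symm
  -- Mass conservation and translation invariance freeze the squared norms, so only ⟨u, u(· + heⱼ)⟩
  -- depends on time.
  have hn : ∀ s, ‖diffQuot j h (u s).1.1‖ ^ 2 = h⁻¹ ^ 2 * (2 * ‖(u 0).1.1‖ ^ 2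
      - 2 * (inner ℂ (u s).1.1 (shiftL2 (h • planeBasis j) (u s).1.1)).re) := by
    intro s
    rw [diffQuot, norm_smul, mul_pow, Real.norm_eq_abs, sq_abs, hu.norm_sq_eq hr 0 s]
    congr 1
    rw [norm_sub_rev, norm_sub_sq (𝕜 := ℂ), LinearIsometry.norm_map]
    simp only [RCLike.re_to_complex]
    ring
  simp_rw [hn]
  have h1 := (hu.hasDerivAt_inner_shift (h • planeBasis j) t)
  have h2 := Complex.reCLM.hasFDerivAt.comp_hasDerivAt t h1
  have h3 := (h2.const_mul 2).const_sub (2 * ‖(u 0).1.1‖ ^ 2) |>.const_mul (h⁻¹ ^ 2)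
  refine h3.congr_deriv ?_
  have hr' := hr t
  have e1 : (inner ℂ (u t).1.1 (f t)).im = 0 := by
    rw [← inner_conj_symm, Complex.conj_im, hr', neg_zero]
  have e2 : inner ℂ (diffQuot j h (u t).1.1) (diffQuot j h (f t)) = ((h⁻¹ ^ 2 : ℝ) : ℂ)
      * (inner ℂ (u t).1.1 (f t) - inner ℂ (shiftL2 (h • planeBasis j) (u t).1.1) (f t)
        - inner ℂ (u t).1.1 (shiftL2 (h • planeBasis j) (f t)) + inner ℂ (u t).1.1 (f t)) := by
    simp only [diffQuot]
    rw [real_smul_planeL2, real_smul_planeL2, inner_smul_left, inner_smul_right, inner_sub_left,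
      inner_sub_right, inner_sub_right, LinearIsometry.inner_map_map, Complex.conj_ofReal]
    push_cast
    ring
  rw [e2, Complex.im_ofReal_mul, ← inner_conj_symm (shiftL2 (h • planeBasis j) (u t).1.1) (f t)]
  simp only [Complex.reCLM_apply, Complex.mul_re, Complex.I_re, Complex.I_im, Complex.sub_im,
    Complex.add_im, Complex.conj_im, e1]
  ring

end Evolves

/-! ### Conservation of energy. -/

/-- Pointwise reality of `⟪f(v), b v⟫`. -/
lemma inner_nlsL2_mul (v : sobolevH1) (b : BoundedContinuousFunction Plane ℝ) :
    inner ℂ (nlsL2 v) (mulL2 b v.1.1) = ((∫ x, b x * nlsG (v.1.1 x) : ℝ) : ℂ) := by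
  rw [inner_planeL2, ← integral_complex_ofReal]
  refine integral_congr_ae ?_
  filter_upwards [coeFn_nlsL2 v, coeFn_mulL2 b v.1.1] with x h1 h2
  rw [h1, h2, nlsF, nlsG, map_mul, Complex.conj_ofReal]
  have := Complex.mul_conj (v.1.1 x)
  rw [Complex.normSq_eq_norm_sq] at this
  push_cast at this ⊢
  linear_combination (b x : ℂ) * (Complex.exp (4 * Real.pi * ‖v.1.1 x‖ ^ 2) - 1
    - 4 * Real.pi * ‖v.1.1 x‖ ^ 2) * this

lemma im_inner_nlsL2 (v : sobolevH1) : (inner ℂ (nlsL2 v) v.1.1).im = 0 := by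
  have h := inner_nlsL2_mul v (BoundedContinuousFunction.const Plane 1)
  have e : mulL2 (BoundedContinuousFunction.const Plane 1) v.1.1 = v.1.1 := by
    refine Lp.ext ?_
    filter_upwards [coeFn_mulL2 (BoundedContinuousFunction.const Plane 1) v.1.1] with x hx
    rw [hx]; simp
  rw [e] at h
  rw [h, Complex.ofReal_im]

/-- The local bounds are patched together by compactness; this is applied to the image of a time
interval under the trajectory. -/
lemma exists_lintegral_expExcess_le_of_isCompact {β : ℝ} (hβ : 0 < β) {S : Set sobolevH1}
    (hS : IsCompact S) : ∃ B : ℝ≥0∞, B ≠ ⊤ ∧ ∀ v ∈ S,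
      ∫⁻ x, ENNReal.ofReal (expExcess β (v.1.1 x)) ≤ B := by
  refine hS.induction_on (p := fun S => ∃ B : ℝ≥0∞, B ≠ ⊤ ∧ ∀ v ∈ S,
      ∫⁻ x, ENNReal.ofReal (expExcess β (v.1.1 x)) ≤ B) ⟨0, by simp, by simp⟩ ?_ ?_ ?_
  · rintro s t hst ⟨B, hB, h⟩
    exact ⟨B, hB, fun v hv => h v (hst hv)⟩
  · rintro s t ⟨B, hB, h⟩ ⟨B', hB', h'⟩
    refine ⟨max B B', (max_lt hB.lt_top hB'.lt_top).ne, fun v hv => ?_⟩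
    rcases hv with hv | hv
    · exact (h v hv).trans (le_max_left _ _)
    · exact (h' v hv).trans (le_max_right _ _)
  · intro v _
    obtain ⟨δ, hδ, B, hB, h⟩ := exists_lintegral_expExcess_near_le hβ v
    refine ⟨Metric.ball v δ, mem_nhdsWithin_of_mem_nhds (Metric.ball_mem_nhds v hδ), B, hB,
      fun w hw => h w ?_⟩
    rwa [mem_ball_iff_norm] at hw

lemma ENNReal.le_one_add_pow_four (x : ℝ≥0∞) : x ≤ 1 + x ^ 4 := by
  rcases le_total x 1 with h | h
  · exact h.trans le_self_add
  · exact (le_self_pow h (by norm_num)).trans le_add_self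

/-- The sequence `1 / (n + 1)` in the punctured neighbourhood of `0`. -/
lemma tendsto_one_div_nhdsNE :
    Tendsto (fun n : ℕ => 1 / ((n : ℝ) + 1)) atTop (𝓝[≠] 0) := by
  refine tendsto_nhdsWithin_iff.2 ⟨tendsto_one_div_add_atTop_nhds_zero_nat, ?_⟩
  filter_upwards with n
  simp only [mem_compl_iff, mem_singleton_iff]
  positivity

lemma continuous_diffQuot (j : Fin 2) (h : ℝ) : Continuous (diffQuot j h) := by
  have : Continuous fun v : PlaneL2 => h⁻¹ • (shiftL2 (h • planeBasis j) v - v) := by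
    have h1 := (shiftL2 (h • planeBasis j)).continuous
    fun_prop
  exact this

namespace IsNLSSolution

variable {u : ℝ → Plane → ℂ}

/-- u(t) ∈ W^{1,4} for almost every t, so f(u(t)) has an L² gradient G(t). Its fourth power is
bounded on compact intervals by a constant times ‖u(t)‖⁴ in W^{1,4}, which is integrable in time. -/
lemma exists_grad_nls (hu : IsNLSSolution u) : ∃ G : ℝ → Fin 2 → PlaneL2,
    (∀ᵐ t, (nlsL2 (hu.toH1 t), G t) ∈ sobolevH1) ∧
    ∀ j a b, IntervalIntegrable (fun t => G t j) volume a b := by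
  classical
  obtain ⟨K, hK, HK⟩ := exists_nlsL2_mem_sobolevH1
  have hae : ∀ᵐ t : ℝ, ∃ w : Fin 2 → PlaneL2, (nlsL2 (hu.toH1 t), w) ∈ sobolevH1 ∧
      ∀ j, ‖w j‖ₑ ^ 4 ≤ K * (∫⁻ x, ENNReal.ofReal (expExcess (8 * (4 * Real.pi))
        ((hu.toH1 t).1.1 x))) * w1Norm 4 (u t) ^ 4 := by
    filter_upwards [hu.memW14] with t ht
    have hfin : w1Norm 4 (u t) ^ 4 ≠ ⊤ :=
      ENNReal.pow_ne_top (ENNReal.add_ne_top.2 ⟨ht.1.eLpNorm_ne_top, ht.2.2.eLpNorm_ne_top⟩)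
    obtain ⟨w, hw, hb⟩ := HK (hu.toH1 t) fun j =>
      ((lintegral_toH1_snd_le (hu.memH1 t) j).trans_lt hfin.lt_top).ne
    refine ⟨w, hw, fun j => (hb j).trans ?_⟩
    gcongr
    exact lintegral_toH1_snd_le (hu.memH1 t) j
  let G : ℝ → Fin 2 → PlaneL2 := fun t =>
    if h : ∃ w : Fin 2 → PlaneL2, (nlsL2 (hu.toH1 t), w) ∈ sobolevH1 ∧
      ∀ j, ‖w j‖ₑ ^ 4 ≤ K * (∫⁻ x, ENNReal.ofReal (expExcess (8 * (4 * Real.pi))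
        ((hu.toH1 t).1.1 x))) * w1Norm 4 (u t) ^ 4 then h.choose else 0
  have hG : ∀ᵐ t : ℝ, (nlsL2 (hu.toH1 t), G t) ∈ sobolevH1 ∧
      ∀ j, ‖G t j‖ₑ ^ 4 ≤ K * (∫⁻ x, ENNReal.ofReal (expExcess (8 * (4 * Real.pi))
        ((hu.toH1 t).1.1 x))) * w1Norm 4 (u t) ^ 4 := by
    filter_upwards [hae] with t ht
    simp only [G]
    rw [dif_pos ht]
    exact ht.choose_spec
  refine ⟨G, hG.mono fun t ht => ht.1, fun j a b => ?_⟩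
  -- G is chosen pointwise in t; measurability comes from its being almost everywhere a limit of
  -- difference quotients of f(u), which are continuous in t.
  have hm : AEStronglyMeasurable (fun t => G t j) volume := by
    refine aestronglyMeasurable_of_tendsto_ae atTop
      (f := fun (n : ℕ) t => diffQuot j (1 / ((n : ℝ) + 1)) (nlsL2 (hu.toH1 t)))
      (fun n => ((continuous_diffQuot j _).comp hu.continuous_nls).aestronglyMeasurable) ?_
    filter_upwards [hG] with t ht
    exact (tendsto_diffQuot ⟨_, ht.1⟩ j).comp tendsto_one_div_nhdsNE
  obtain ⟨B, hB, HB⟩ := exists_lintegral_expExcess_le_of_isCompact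
    (β := 8 * (4 * Real.pi)) (by positivity)
    ((isCompact_uIcc (a := a) (b := b)).image hu.continuous_toH1)
  rw [intervalIntegrable_iff]
  refine IntegrableOn.mono_set (t := Icc (min a b) (max a b)) ⟨hm.restrict, ?_⟩ Ioc_subset_Icc_self
  have hlt : ∫⁻ t in Icc (min a b) (max a b), (1 + K * B * w1Norm 4 (u t) ^ 4) < ⊤ := by
    rw [lintegral_add_left measurable_const,
      lintegral_const_mul' _ _ (ENNReal.mul_ne_top hK hB)]
    refine ENNReal.add_lt_top.2 ⟨by simp, ENNReal.mul_lt_top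
      (ENNReal.mul_ne_top hK hB).lt_top (hu.locL4W14 _ _)⟩
  refine lt_of_le_of_lt (lintegral_mono_ae ?_) hlt
  filter_upwards [ae_restrict_of_ae hG, ae_restrict_mem measurableSet_Icc] with t ht hmem
  refine (ENNReal.le_one_add_pow_four _).trans (add_le_add le_rfl ((ht.2 j).trans ?_))
  gcongr
  exact HB _ (mem_image_of_mem _ hmem)

lemma im_inner_nlsL2_eq_zero (hu : IsNLSSolution u) (t : ℝ) :
    (inner ℂ (nlsL2 (hu.toH1 t)) (hu.toH1 t).1.1).im = 0 := im_inner_nlsL2 _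

/-- Evolution of the kinetic energy. -/
lemma kinetic_sub (hu : IsNLSSolution u) {G : ℝ → Fin 2 → PlaneL2}
    (hG : ∀ᵐ t, (nlsL2 (hu.toH1 t), G t) ∈ sobolevH1)
    (hGi : ∀ j a b, IntervalIntegrable (fun t => G t j) volume a b) (j : Fin 2) (a b : ℝ) :
    IntervalIntegrable (fun t => (inner ℂ ((hu.toH1 t).1.2 j) (G t j)).im) volume a b ∧
    ‖(hu.toH1 b).1.2 j‖ ^ 2 - ‖(hu.toH1 a).1.2 j‖ ^ 2
      = ∫ t in a..b, 2 * (inner ℂ ((hu.toH1 t).1.2 j) (G t j)).im := by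
  have cu := hu.continuous_toH1
  have cj : Continuous fun t => (hu.toH1 t).1.2 j := (continuous_h1_snd j).comp cu
  obtain ⟨B, hB⟩ := (isCompact_uIcc (a := a) (b := b)).exists_bound_of_continuousOn cj.continuousOn
  have hB0 : 0 ≤ B := (norm_nonneg _).trans (hB a left_mem_uIcc)
  have hcont : ∀ h : ℝ, Continuous fun t =>
      2 * (inner ℂ (diffQuot j h (hu.toH1 t).1.1) (diffQuot j h (nlsL2 (hu.toH1 t)))).im := fun h =>
    continuous_const.mul (Complex.continuous_im.comp
      (((continuous_diffQuot j h).comp (continuous_h1_fst.comp cu)).inner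
        ((continuous_diffQuot j h).comp hu.continuous_nls)))
  have hlim : ∀ᵐ t : ℝ, Tendsto (fun n : ℕ => 2 * (inner ℂ
      (diffQuot j (1 / ((n : ℝ) + 1)) (hu.toH1 t).1.1)
      (diffQuot j (1 / ((n : ℝ) + 1)) (nlsL2 (hu.toH1 t)))).im) atTop
      (𝓝 (2 * (inner ℂ ((hu.toH1 t).1.2 j) (G t j)).im)) := by
    filter_upwards [hG] with t ht
    have h1 := (tendsto_diffQuot (hu.toH1 t) j).comp tendsto_one_div_nhdsNE
    have h2 := (tendsto_diffQuot ⟨_, ht⟩ j).comp tendsto_one_div_nhdsNE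
    exact ((Complex.continuous_im.tendsto _).comp (h1.inner h2)).const_mul 2
  -- Difference quotients are bounded by derivatives, so the majorant is independent of the step and
  -- integrable because G is.
  have hbound : ∀ (n : ℕ), ∀ᵐ t : ℝ, t ∈ uIoc a b → ‖2 * (inner ℂ
      (diffQuot j (1 / ((n : ℝ) + 1)) (hu.toH1 t).1.1)
      (diffQuot j (1 / ((n : ℝ) + 1)) (nlsL2 (hu.toH1 t)))).im‖ ≤ 2 * (B * ‖G t j‖) := by
    intro n
    filter_upwards [hG] with t ht hmem
    rw [norm_mul, Real.norm_two, Real.norm_eq_abs]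
    refine mul_le_mul_of_nonneg_left ?_ (by norm_num)
    refine (Complex.abs_im_le_norm _).trans ((norm_inner_le_norm _ _).trans ?_)
    exact mul_le_mul ((norm_diffQuot_le (hu.toH1 t) j _).trans (hB t (uIoc_subset_uIcc hmem)))
      (norm_diffQuot_le ⟨_, ht⟩ j _) (norm_nonneg _) hB0
  have hbi : IntervalIntegrable (fun t => 2 * (B * ‖G t j‖)) volume a b :=
    ((hGi j a b).norm.const_mul B).const_mul 2
  have key := intervalIntegral.tendsto_integral_filter_of_dominated_convergence (l := atTop)
    (a := a) (b := b) (μ := volume) (fun t => 2 * (B * ‖G t j‖))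
    (Eventually.of_forall fun n : ℕ => (hcont (1 / ((n : ℝ) + 1))).aestronglyMeasurable)
    (Eventually.of_forall hbound) hbi (hlim.mono fun t ht _ => ht)
  have hm : AEStronglyMeasurable (fun t => 2 * (inner ℂ ((hu.toH1 t).1.2 j) (G t j)).im) volume :=
    aestronglyMeasurable_of_tendsto_ae atTop (fun n => (hcont _).aestronglyMeasurable) hlim
  refine ⟨?_, ?_⟩
  · have h2 : IntervalIntegrable (fun t => 2 * (inner ℂ ((hu.toH1 t).1.2 j) (G t j)).im)
        volume a b := by
      refine hbi.mono_fun hm.restrict ?_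
      filter_upwards [ae_restrict_mem measurableSet_uIoc, ae_restrict_of_ae hlim,
        ae_restrict_of_ae (ae_all_iff.2 hbound)] with t hmem h1 h2
      refine (le_of_tendsto h1.norm (Eventually.of_forall fun n => h2 n hmem)).trans ?_
      exact le_abs_self _
    refine (h2.const_mul (1 / 2)).congr ?_
    intro t _
    simp only
    ring
  · refine tendsto_nhds_unique ?_ key
    have e : ∀ h : ℝ, ∫ t in a..b, 2 * (inner ℂ (diffQuot j h (hu.toH1 t).1.1)
        (diffQuot j h (nlsL2 (hu.toH1 t)))).im
        = ‖diffQuot j h (hu.toH1 b).1.1‖ ^ 2 - ‖diffQuot j h (hu.toH1 a).1.1‖ ^ 2 := fun h =>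
      intervalIntegral.integral_eq_sub_of_hasDerivAt
        (fun t _ => hu.evolves.hasDerivAt_norm_diffQuot_sq hu.im_inner_nlsL2_eq_zero j h t)
        ((hcont h).intervalIntegrable _ _)
    simp_rw [e]
    have h1 : ∀ t, Tendsto (fun n : ℕ => ‖diffQuot j (1 / ((n : ℝ) + 1)) (hu.toH1 t).1.1‖ ^ 2)
        atTop (𝓝 (‖(hu.toH1 t).1.2 j‖ ^ 2)) := fun t =>
      ((tendsto_diffQuot (hu.toH1 t) j).comp tendsto_one_div_nhdsNE).norm.pow 2
    exact (h1 b).sub (h1 a)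

/-- Lipschitz continuity of the trajectory in the dual of `H¹`. -/
lemma exists_norm_dualL2_sub_le (hu : IsNLSSolution u) (a b : ℝ) : ∃ B : ℝ, 0 ≤ B ∧
    ∀ s ∈ Icc a b, ∀ t ∈ Icc a b, ‖dualL2 (hu.toH1 t).1.1 - dualL2 (hu.toH1 s).1.1‖
      ≤ B * |t - s| := by
  have cR := Continuous.schrForm hu.continuous_toH1 hu.continuous_nls
  obtain ⟨B, hB⟩ := (isCompact_Icc (a := a) (b := b)).exists_bound_of_continuousOn cR.continuousOn
  refine ⟨max B 0, le_max_right _ _, fun s hs t ht => ?_⟩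
  refine (convex_Icc a b).norm_image_sub_le_of_norm_hasDerivWithin_le
    (f := fun t => dualL2 (hu.toH1 t).1.1)
    (f' := fun t => Complex.I • schrForm (hu.toH1 t) (nlsL2 (hu.toH1 t)))
    (fun x _ => (hu.evolves.hasDerivAt x).hasDerivWithinAt) (fun x hx => ?_) hs ht
  rw [norm_smul, Complex.norm_I, one_mul]
  exact (hB x hx).trans (le_max_left _ _)

/-- Convergence of the difference quotients of the action on the nonlinearity. -/
lemma tendsto_integral_diffQuot_time (hu : IsNLSSolution u) {G : ℝ → Fin 2 → PlaneL2}
    (hG : ∀ᵐ t, (nlsL2 (hu.toH1 t), G t) ∈ sobolevH1)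
    (hGi : ∀ j a b, IntervalIntegrable (fun t => G t j) volume a b) (a b : ℝ) :
    Tendsto (fun k : ℝ => ∫ s in a..b, k⁻¹ *
      (inner ℂ (nlsL2 (hu.toH1 s)) ((hu.toH1 (s + k)).1.1 - (hu.toH1 s).1.1)).re) (𝓝[≠] 0)
      (𝓝 (∫ s in a..b, - ((inner ℂ ((hu.toH1 s).1.2 0) (G s 0)).im
        + (inner ℂ ((hu.toH1 s).1.2 1) (G s 1)).im))) := by
  have cu := hu.continuous_toH1
  -- The interval is enlarged by 1 to contain s + k for |k| ≤ 1.
  obtain ⟨B, hB0, hB⟩ := hu.exists_norm_dualL2_sub_le (min a b - 1) (max a b + 1)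
  have hswap : ∀ s k, (inner ℂ (nlsL2 (hu.toH1 s)) ((hu.toH1 (s + k)).1.1 - (hu.toH1 s).1.1)).re
      = (inner ℂ ((hu.toH1 (s + k)).1.1 - (hu.toH1 s).1.1) (nlsL2 (hu.toH1 s))).re := fun s k => by
    rw [← inner_conj_symm, Complex.conj_re]
  refine intervalIntegral.tendsto_integral_filter_of_dominated_convergence
    (fun s => B * (‖nlsL2 (hu.toH1 s)‖ + (‖G s 0‖ + ‖G s 1‖))) ?_ ?_ ?_ ?_
  · refine Eventually.of_forall fun k => Continuous.aestronglyMeasurable ?_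
    refine continuous_const.mul (Complex.continuous_re.comp (hu.continuous_nls.inner ?_))
    exact ((continuous_h1_fst.comp cu).comp (continuous_id.add continuous_const)).sub
      (continuous_h1_fst.comp cu)
  · have h1 : ∀ᶠ k : ℝ in 𝓝[≠] 0, |k| ≤ 1 := by
      refine eventually_nhdsWithin_of_eventually_nhds ?_
      have := (continuous_abs.tendsto (0 : ℝ)).eventually_le_const (u := 1) (by simp)
      exact this
    filter_upwards [h1, self_mem_nhdsWithin] with k hk hk0
    filter_upwards [hG] with s hs hmem
    have hmem' := uIoc_subset_uIcc hmem
    rw [uIcc, mem_Icc] at hmem'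
    have hk' := abs_le.1 hk
    have h2 := hB s ⟨by linarith [hmem'.1], by linarith [hmem'.2]⟩ (s + k)
      ⟨by linarith [hmem'.1], by linarith [hmem'.2]⟩
    rw [add_sub_cancel_left] at h2
    let ψ : sobolevH1 := ⟨_, hs⟩
    -- f(u(s)) is itself an element of H¹, so the dual Lipschitz bound applies to its pairing with
    -- the increment.
    have h3 : ‖inner ℂ ((hu.toH1 (s + k)).1.1 - (hu.toH1 s).1.1) (nlsL2 (hu.toH1 s))‖
        ≤ B * |k| * ‖ψ‖ := by
      have h4 := (dualL2 (hu.toH1 (s + k)).1.1 - dualL2 (hu.toH1 s).1.1).clm.le_opNorm ψ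
      rw [DualH1.norm_clm] at h4
      rw [inner_sub_left]
      exact h4.trans (mul_le_mul_of_nonneg_right h2 (norm_nonneg _))
    have h5 : ‖ψ‖ ≤ ‖nlsL2 (hu.toH1 s)‖ + (‖G s 0‖ + ‖G s 1‖) := by
      change ‖(nlsL2 (hu.toH1 s), G s)‖ ≤ _
      rw [Prod.norm_def]
      refine max_le (le_add_of_nonneg_right (by positivity))
        (le_trans ?_ (le_add_of_nonneg_left (norm_nonneg _)))
      refine (pi_norm_le_iff_of_nonneg (by positivity)).2 fun j => ?_
      fin_cases j
      · exact le_add_of_nonneg_right (norm_nonneg _)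
      · exact le_add_of_nonneg_left (norm_nonneg _)
    have hk1 : 0 < |k| := abs_pos.2 hk0
    rw [norm_mul, norm_inv, Real.norm_eq_abs k, inv_mul_le_iff₀ hk1, hswap, Real.norm_eq_abs]
    refine (Complex.abs_re_le_norm _).trans (h3.trans ?_)
    calc B * |k| * ‖ψ‖ ≤ B * |k| * (‖nlsL2 (hu.toH1 s)‖ + (‖G s 0‖ + ‖G s 1‖)) := by gcongr
      _ = _ := by ring
  · exact ((hu.continuous_nls.norm.intervalIntegrable _ _).add
      ((hGi 0 a b).norm.add (hGi 1 a b).norm)).const_mul B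
  · filter_upwards [hG] with s hs _
    let ψ : sobolevH1 := ⟨_, hs⟩
    have h1 : HasDerivAt (fun t => inner ℂ (hu.toH1 t).1.1 (nlsL2 (hu.toH1 s)))
        (Complex.I * (schrForm (hu.toH1 s) (nlsL2 (hu.toH1 s))).clm ψ) s := by
      have := (((DualH1.eval ψ).restrictScalars ℝ).hasFDerivAt).comp_hasDerivAt s
        (hu.evolves.hasDerivAt s)
      refine this.congr_deriv ?_
      change DualH1.eval ψ _ = _
      rw [map_smul]; rfl
    have h2 := (Complex.continuous_re.tendsto _).comp (hasDerivAt_iff_tendsto_slope_zero.1 h1)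
    have e : (Complex.I * (schrForm (hu.toH1 s) (nlsL2 (hu.toH1 s))).clm ψ).re
        = - ((inner ℂ ((hu.toH1 s).1.2 0) (G s 0)).im
          + (inner ℂ ((hu.toH1 s).1.2 1) (G s 1)).im) := by
      rw [schrForm_clm]
      change (Complex.I * (inner ℂ ((hu.toH1 s).1.2 0) (G s 0)
        + inner ℂ ((hu.toH1 s).1.2 1) (G s 1)
        + inner ℂ (nlsL2 (hu.toH1 s)) (nlsL2 (hu.toH1 s)))).re = _
      -- ⟨f, f⟩ is real and drops out, leaving the gradient terms that will cancel the kinetic ones.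
      have h3 : (inner ℂ (nlsL2 (hu.toH1 s)) (nlsL2 (hu.toH1 s))).im = 0 :=
        inner_self_im (𝕜 := ℂ) _
      simp only [Complex.mul_re, Complex.I_re, Complex.I_im, Complex.add_im, h3]
      ring
    rw [e] at h2
    refine h2.congr fun k => ?_
    simp only [Function.comp_apply]
    rw [hswap, inner_sub_left, Complex.smul_re, smul_eq_mul]

/-- No chain rule in time is used. Convexity bounds the time-averaged increment of the potential
energy from below, and dividing by k > 0 and by k < 0 bounds the limit from both sides. -/
lemma potEnergy_sub (hu : IsNLSSolution u) {G : ℝ → Fin 2 → PlaneL2}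
    (hG : ∀ᵐ t, (nlsL2 (hu.toH1 t), G t) ∈ sobolevH1)
    (hGi : ∀ j a b, IntervalIntegrable (fun t => G t j) volume a b) {a b : ℝ} (hab : a ≤ b) :
    potEnergy (hu.toH1 b) - potEnergy (hu.toH1 a)
      = 2 * ∫ s in a..b, - ((inner ℂ ((hu.toH1 s).1.2 0) (G s 0)).im
        + (inner ℂ ((hu.toH1 s).1.2 1) (G s 1)).im) := by
  have cu := hu.continuous_toH1
  have cΦ : Continuous fun t => potEnergy (hu.toH1 t) := continuous_potEnergy.comp cu
  set Φ : ℝ → ℝ := fun t => potEnergy (hu.toH1 t) with hΦ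
  have hlim := (hu.tendsto_integral_diffQuot_time hG hGi a b).const_mul 2
  let P : ℝ → ℝ := fun x => ∫ s in (0 : ℝ)..x, Φ s
  have hP : ∀ x, HasDerivAt P (Φ x) x := fun x =>
    intervalIntegral.integral_hasDerivAt_right (cΦ.intervalIntegrable _ _)
      (cΦ.stronglyMeasurableAtFilter _ _) cΦ.continuousAt
  have hI : ∀ x y, ∫ s in x..y, Φ s = P y - P x := fun x y =>
    (intervalIntegral.integral_interval_sub_left (cΦ.intervalIntegrable _ _)
      (cΦ.intervalIntegrable _ _)).symm
  -- The shifted integrals telescope to slopes of the primitive P at b and at a.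
  have hΦlim : Tendsto (fun k : ℝ => k⁻¹ * ∫ s in a..b, (Φ (s + k) - Φ s)) (𝓝[≠] 0)
      (𝓝 (Φ b - Φ a)) := by
    refine ((hasDerivAt_iff_tendsto_slope_zero.1 (hP b)).sub
      (hasDerivAt_iff_tendsto_slope_zero.1 (hP a))).congr fun k => ?_
    have ck : Continuous fun s => Φ (s + k) := cΦ.comp (continuous_id.add continuous_const)
    rw [intervalIntegral.integral_sub (ck.intervalIntegrable _ _) (cΦ.intervalIntegrable _ _),
      intervalIntegral.integral_comp_add_right, hI, hI]
    simp only [smul_eq_mul]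
    ring
  have hcmp : ∀ k : ℝ, ∫ s in a..b,
      2 * (inner ℂ (nlsL2 (hu.toH1 s)) ((hu.toH1 (s + k)).1.1 - (hu.toH1 s).1.1)).re
      ≤ ∫ s in a..b, (Φ (s + k) - Φ s) := by
    intro k
    have ck : Continuous fun s => hu.toH1 (s + k) := cu.comp (continuous_id.add continuous_const)
    refine intervalIntegral.integral_mono_on hab ?_ ?_ fun s _ => potEnergy_sub_ge _ _
    · refine Continuous.intervalIntegrable ?_ _ _
      exact continuous_const.mul (Complex.continuous_re.comp (hu.continuous_nls.inner
        ((continuous_h1_fst.comp ck).sub (continuous_h1_fst.comp cu))))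
    · exact (((continuous_potEnergy.comp ck)).sub cΦ).intervalIntegrable _ _
  have e : ∀ k : ℝ, 2 * ∫ s in a..b, k⁻¹ *
      (inner ℂ (nlsL2 (hu.toH1 s)) ((hu.toH1 (s + k)).1.1 - (hu.toH1 s).1.1)).re
      = k⁻¹ * ∫ s in a..b,
      2 * (inner ℂ (nlsL2 (hu.toH1 s)) ((hu.toH1 (s + k)).1.1 - (hu.toH1 s).1.1)).re := fun k => by
    rw [intervalIntegral.integral_const_mul, intervalIntegral.integral_const_mul]
    ring
  simp_rw [e] at hlim
  have hgt : 𝓝[>] (0 : ℝ) ≤ 𝓝[≠] 0 := nhdsWithin_mono _ fun x hx => ne_of_gt hx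
  have hlt : 𝓝[<] (0 : ℝ) ≤ 𝓝[≠] 0 := nhdsWithin_mono _ fun x hx => ne_of_lt hx
  refine le_antisymm ?_ ?_
  · refine le_of_tendsto_of_tendsto (hΦlim.mono_left hlt) (hlim.mono_left hlt) ?_
    filter_upwards [self_mem_nhdsWithin] with k hk
    exact mul_le_mul_of_nonpos_left (hcmp k) (inv_nonpos.2 (le_of_lt hk))
  · refine le_of_tendsto_of_tendsto (hlim.mono_left hgt) (hΦlim.mono_left hgt) ?_
    filter_upwards [self_mem_nhdsWithin] with k hk
    exact mul_le_mul_of_nonneg_left (hcmp k) (inv_nonneg.2 (le_of_lt hk))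

/-- Conservation of the energy. -/
lemma energy_eq (hu : IsNLSSolution u) (a b : ℝ) :
    ‖(hu.toH1 a).1.2 0‖ ^ 2 + ‖(hu.toH1 a).1.2 1‖ ^ 2 + potEnergy (hu.toH1 a)
      = ‖(hu.toH1 b).1.2 0‖ ^ 2 + ‖(hu.toH1 b).1.2 1‖ ^ 2 + potEnergy (hu.toH1 b) := by
  wlog hab : a ≤ b generalizing a b
  · exact (this b a (le_of_not_ge hab)).symm
  obtain ⟨G, hG, hGi⟩ := hu.exists_grad_nls
  obtain ⟨i0, h0⟩ := hu.kinetic_sub hG hGi 0 a b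
  obtain ⟨i1, h1⟩ := hu.kinetic_sub hG hGi 1 a b
  have h2 := hu.potEnergy_sub hG hGi hab
  -- The potential contribution is minus the sum of the two kinetic ones.
  rw [intervalIntegral.integral_neg, intervalIntegral.integral_add i0 i1] at h2
  rw [intervalIntegral.integral_const_mul] at h0 h1
  linarith

/-- Conservation of the mass. -/
lemma norm_eq (hu : IsNLSSolution u) (a b : ℝ) : ‖(hu.toH1 a).1.1‖ = ‖(hu.toH1 b).1.1‖ :=
  hu.evolves.norm_sq_eq hu.im_inner_nlsL2_eq_zero a b

end IsNLSSolution

/-! ### The virial identity in one direction. -/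

/-- The multiplier `x ↦ φ(x₀)`. -/
def Multiplier.ofFst (φ φ' : ℝ → ℝ) (hφ : ContDiff ℝ ∞ φ) (hd : ∀ s, HasDerivAt φ (φ' s) s)
    (hc : Continuous φ') (C C' : ℝ) (hC : ∀ s, ‖φ s‖ ≤ C) (hC' : ∀ s, ‖φ' s‖ ≤ C') :
    Multiplier where
  fn := BoundedContinuousFunction.ofNormedAddCommGroup (fun x : Plane => φ (x 0))
    (hφ.continuous.comp (EuclideanSpace.proj (𝕜 := ℝ) (0 : Fin 2)).continuous) C fun x => hC _
  grad j := if j = 0 then BoundedContinuousFunction.ofNormedAddCommGroup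
    (fun x : Plane => φ' (x 0)) (hc.comp (EuclideanSpace.proj (𝕜 := ℝ) (0 : Fin 2)).continuous) C'
    fun x => hC' _ else 0
  smooth := hφ.comp (EuclideanSpace.proj (𝕜 := ℝ) (0 : Fin 2)).contDiff
  fderiv_eq x j := by
    have h := (hd (x 0)).hasFDerivAt.comp x
      (EuclideanSpace.proj (𝕜 := ℝ) (0 : Fin 2) : Plane →L[ℝ] ℝ).hasFDerivAt
    have e : fderiv ℝ (fun x : Plane => φ (x 0)) x = _ := h.fderiv
    change fderiv ℝ (fun x : Plane => φ (x 0)) x (planeBasis j) = _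
    rw [e]
    fin_cases j
    · simp [planeBasis]
    · simp [planeBasis]

lemma hasDerivAt_inv_one_add_sq (s : ℝ) :
    HasDerivAt (fun s : ℝ => 1 / (1 + s ^ 2)) (-(2 * s) / (1 + s ^ 2) ^ 2) s := by
  have h1 : HasDerivAt (fun s : ℝ => 1 + s ^ 2) (2 * s) s := by
    simpa using (hasDerivAt_pow 2 s).const_add 1
  simp_rw [one_div]
  exact h1.fun_inv (by positivity)

lemma contDiff_inv_one_add_sq : ContDiff ℝ ∞ fun s : ℝ => 1 / (1 + s ^ 2) := by
  refine contDiff_const.div (by fun_prop) fun s => ?_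
  positivity

/-- The multiplier `1 / (1 + x₀²)`. -/
def virialWeight : Multiplier :=
  Multiplier.ofFst (fun s => 1 / (1 + s ^ 2)) (fun s => -(2 * s) / (1 + s ^ 2) ^ 2)
    contDiff_inv_one_add_sq hasDerivAt_inv_one_add_sq
    (Continuous.div (by fun_prop) (by fun_prop) fun s => by positivity) 1 1
    (fun s => by
      rw [Real.norm_of_nonneg (by positivity), div_le_one (by positivity)]
      nlinarith [sq_nonneg s])
    (fun s => by
      rw [norm_div, norm_neg, norm_mul, Real.norm_two, Real.norm_eq_abs,
        Real.norm_of_nonneg (by positivity), div_le_one (by positivity)]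
      nlinarith [sq_nonneg (|s| - 1), sq_abs s, sq_nonneg s, sq_nonneg (s ^ 2)])

/-- The multiplier `arctan x₀`. -/
def virialFun : Multiplier :=
  Multiplier.ofFst Real.arctan (fun s => 1 / (1 + s ^ 2)) Real.contDiff_arctan
    Real.hasDerivAt_arctan contDiff_inv_one_add_sq.continuous (Real.pi / 2) 1
    (fun s => abs_le.2 ⟨(Real.neg_pi_div_two_lt_arctan s).le, (Real.arctan_lt_pi_div_two s).le⟩)
    (fun s => by
      rw [Real.norm_of_nonneg (by positivity), div_le_one (by positivity)]
      nlinarith [sq_nonneg s])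

lemma virialFun_grad_zero : virialFun.grad 0 = virialWeight.fn := rfl

lemma virialFun_grad_one : virialFun.grad 1 = 0 := rfl

lemma virialWeight_apply (x : Plane) : virialWeight.fn x = 1 / (1 + (x 0) ^ 2) := rfl

lemma virialWeight_nonneg (x : Plane) : 0 ≤ virialWeight.fn x := by
  rw [virialWeight_apply]; positivity

lemma half_le_virialWeight {x : Plane} (hx : ‖x‖ ≤ 1) : 1 / 2 ≤ virialWeight.fn x := by
  have h1 : |x 0| ≤ 1 := (PiLp.norm_apply_le x 0).trans hx
  have h2 : (x 0) ^ 2 ≤ 1 := (sq_le_one_iff_abs_le_one _).2 h1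
  rw [virialWeight_apply]
  exact one_div_le_one_div_of_le (by positivity) (by linarith)

/-- Discrete integration by parts: adding and subtracting Re⟨p, mq⟩ and moving the translation off p
gives difference quotients of q and mq only. Thus p may be merely in L². -/
lemma re_inner_shift_sub (m : BoundedContinuousFunction Plane ℝ) (j : Fin 2) (h : ℝ)
    (p q : PlaneL2) :
    h⁻¹ * (inner ℂ p (mulL2 m (shiftL2 (h • planeBasis j) q))
      - inner ℂ (mulL2 m q) (shiftL2 (h • planeBasis j) p)).re
      = (inner ℂ p (mulL2 m (diffQuot j h q))).re
        + (inner ℂ (diffQuot j (-h) (mulL2 m q)) p).re := by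
  have e1 : inner ℂ p (mulL2 m (diffQuot j h q)) = ((h⁻¹ : ℝ) : ℂ)
      * (inner ℂ p (mulL2 m (shiftL2 (h • planeBasis j) q)) - inner ℂ p (mulL2 m q)) := by
    rw [diffQuot, real_smul_planeL2, map_smul, map_sub, inner_smul_right, inner_sub_right]
  have e2 : inner ℂ (diffQuot j (-h) (mulL2 m q)) p = ((-h⁻¹ : ℝ) : ℂ)
      * (inner ℂ (mulL2 m q) (shiftL2 (h • planeBasis j) p) - inner ℂ (mulL2 m q) p) := by
    rw [diffQuot, real_smul_planeL2, inner_smul_left, inner_sub_left, inner_shiftL2_left,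
      Complex.conj_ofReal, neg_smul, neg_neg, inv_neg]
  rw [e1, e2, Complex.re_ofReal_mul, Complex.re_ofReal_mul, ← inner_conj_symm p (mulL2 m q)]
  simp only [Complex.sub_re, Complex.conj_re]
  ring

/-- ⟨q, mq⟩ is real, so subtracting it does not change the imaginary part. -/
lemma im_inner_mul_shift (m : BoundedContinuousFunction Plane ℝ) (j : Fin 2) (h : ℝ)
    (q : PlaneL2) :
    h⁻¹ * (inner ℂ q (mulL2 m (shiftL2 (h • planeBasis j) q))).im
      = (inner ℂ q (mulL2 m (diffQuot j h q))).im := by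
  have e0 : (inner ℂ q (mulL2 m q)).im = 0 := by
    have := inner_conj_symm (𝕜 := ℂ) q (mulL2 m q)
    rw [inner_mulL2] at this
    exact Complex.conj_eq_iff_im.1 this
  rw [diffQuot, real_smul_planeL2, map_smul, map_sub, inner_smul_right, inner_sub_right,
    Complex.im_ofReal_mul, Complex.sub_im, e0, sub_zero]

namespace Evolves

variable {u : ℝ → sobolevH1} {f : ℝ → PlaneL2}

/-- The virial identity in the direction of `x₀`. -/
lemma virial (hu : Evolves u f) (b b' : Multiplier) (h0 : b.grad 0 = b'.fn) (h1 : b.grad 1 = 0)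
    (s t : ℝ) :
    (inner ℂ (u t).1.1 (mulL2 b.fn ((u t).1.2 0))).im
        - (inner ℂ (u s).1.1 (mulL2 b.fn ((u s).1.2 0))).im
      = ∫ r in s..t, (((inner ℂ ((u r).1.2 0) (mulL2 b'.fn ((u r).1.2 0))).re
          + (inner ℂ ((b'.mulH1 (u r)).1.2 0) ((u r).1.2 0)).re)
        + ((inner ℂ (f r) (mulL2 b.fn ((u r).1.2 0))).re
          + (inner ℂ ((b.mulH1 (u r)).1.2 0) (f r)).re)) := by
  have cu := hu.continuous_fst
  have c1 : Continuous fun r => (u r).1.1 := continuous_h1_fst.comp cu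
  have c2 : Continuous fun r => (u r).1.2 0 := (continuous_h1_snd 0).comp cu
  have cf := hu.continuous_snd
  have cm : ∀ m : Multiplier, Continuous fun r => (m.mulH1 (u r)).1.2 0 := fun m =>
    (continuous_h1_snd 0).comp (m.mulH1.continuous.comp cu)
  -- The time derivative of Im⟨u, b D_h u⟩, where D_h is the difference quotient; the identity is
  -- proved for h ≠ 0 by integrating it and then letting h → 0.
  let D : ℝ → ℝ → ℝ := fun h r =>
    ((inner ℂ ((u r).1.2 0) (mulL2 b'.fn (diffQuot 0 h (u r).1.1))).re
      + (inner ℂ (diffQuot 0 (-h) (mulL2 b'.fn (u r).1.1)) ((u r).1.2 0)).re)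
    + ((inner ℂ (f r) (mulL2 b.fn (diffQuot 0 h (u r).1.1))).re
      + (inner ℂ (diffQuot 0 (-h) (mulL2 b.fn (u r).1.1)) (f r)).re)
  have cD : ∀ h, Continuous (D h) := by
    intro h
    have k1 : Continuous fun r => diffQuot 0 h (u r).1.1 := (continuous_diffQuot 0 h).comp c1
    have k2 : ∀ m : BoundedContinuousFunction Plane ℝ,
        Continuous fun r => diffQuot 0 (-h) (mulL2 m (u r).1.1) := fun m =>
      (continuous_diffQuot 0 (-h)).comp ((mulL2 m).continuous.comp c1)
    exact ((Complex.continuous_re.comp (c2.inner ((mulL2 b'.fn).continuous.comp k1))).add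
      (Complex.continuous_re.comp ((k2 _).inner c2))).add
      ((Complex.continuous_re.comp (cf.inner ((mulL2 b.fn).continuous.comp k1))).add
      (Complex.continuous_re.comp ((k2 _).inner cf)))
  have hderiv : ∀ h r, HasDerivAt
      (fun r => (inner ℂ (u r).1.1 (mulL2 b.fn (diffQuot 0 h (u r).1.1))).im) (D h r) r := by
    intro h r
    have h2 := hu.hasDerivAt_inner_mul_shift b (h • planeBasis 0) r
    have h3 := (Complex.imCLM.hasFDerivAt.comp_hasDerivAt r h2).const_mul h⁻¹
    simp_rw [← im_inner_mul_shift]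
    refine h3.congr_deriv ?_
    -- The weight does not vary in x₁, so only the x₀ commutator contributes.
    have hz : ∀ w : PlaneL2, mulL2 (b.grad 1) w = 0 := by
      intro w
      refine Lp.ext ?_
      filter_upwards [coeFn_mulL2 (b.grad 1) w, Lp.coeFn_zero ℂ 2 (volume : Measure Plane)]
        with x e1 e2
      rw [e1, e2, h1]; simp
    simp only [Fin.sum_univ_two, hz, inner_zero_left, inner_zero_right, sub_zero, add_zero, h0, D]
    rw [← re_inner_shift_sub, ← re_inner_shift_sub]
    simp only [Complex.imCLM_apply, Complex.mul_im, Complex.I_re, Complex.I_im, Complex.add_re]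
    ring
  have hint : ∀ h, ∫ r in s..t, D h r
      = (inner ℂ (u t).1.1 (mulL2 b.fn (diffQuot 0 h (u t).1.1))).im
        - (inner ℂ (u s).1.1 (mulL2 b.fn (diffQuot 0 h (u s).1.1))).im := fun h =>
    intervalIntegral.integral_eq_sub_of_hasDerivAt (fun r _ => hderiv h r)
      ((cD h).intervalIntegrable _ _)
  have hneg : Tendsto (fun h : ℝ => -h) (𝓝[≠] 0) (𝓝[≠] 0) := by
    refine tendsto_nhdsWithin_iff.2 ⟨?_, ?_⟩
    · have := (continuous_neg (G := ℝ)).tendsto 0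
      rw [neg_zero] at this
      exact this.mono_left nhdsWithin_le_nhds
    · filter_upwards [self_mem_nhdsWithin] with h hh
      exact neg_ne_zero.2 hh
  have hd : ∀ v : sobolevH1, Tendsto (fun h => diffQuot 0 h v.1.1) (𝓝[≠] 0) (𝓝 (v.1.2 0)) :=
    fun v => tendsto_diffQuot v 0
  have hlim1 : ∀ r, Tendsto (fun h => (inner ℂ (u r).1.1
      (mulL2 b.fn (diffQuot 0 h (u r).1.1))).im) (𝓝[≠] 0)
      (𝓝 (inner ℂ (u r).1.1 (mulL2 b.fn ((u r).1.2 0))).im) := fun r =>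
    (Complex.continuous_im.tendsto _).comp
      (tendsto_const_nhds.inner (((mulL2 b.fn).continuous.tendsto _).comp (hd _)))
  have hlimD : ∀ r, Tendsto (fun h => D h r) (𝓝[≠] 0)
      (𝓝 (((inner ℂ ((u r).1.2 0) (mulL2 b'.fn ((u r).1.2 0))).re
          + (inner ℂ ((b'.mulH1 (u r)).1.2 0) ((u r).1.2 0)).re)
        + ((inner ℂ (f r) (mulL2 b.fn ((u r).1.2 0))).re
          + (inner ℂ ((b.mulH1 (u r)).1.2 0) (f r)).re))) := by
    intro r
    have l1 : ∀ (m : BoundedContinuousFunction Plane ℝ) (w : PlaneL2), Tendsto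
        (fun h => (inner ℂ w (mulL2 m (diffQuot 0 h (u r).1.1))).re) (𝓝[≠] 0)
        (𝓝 (inner ℂ w (mulL2 m ((u r).1.2 0))).re) := fun m w =>
      (Complex.continuous_re.tendsto _).comp
        (tendsto_const_nhds.inner (((mulL2 m).continuous.tendsto _).comp (hd _)))
    have l2 : ∀ (m : Multiplier) (w : PlaneL2), Tendsto
        (fun h => (inner ℂ (diffQuot 0 (-h) (mulL2 m.fn (u r).1.1)) w).re) (𝓝[≠] 0)
        (𝓝 (inner ℂ ((m.mulH1 (u r)).1.2 0) w).re) := fun m w =>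
      (Complex.continuous_re.tendsto _).comp
        (((hd (m.mulH1 (u r))).comp hneg).inner tendsto_const_nhds)
    exact ((l1 _ _).add (l2 _ _)).add ((l1 _ _).add (l2 _ _))
  -- The majorant replaces each difference quotient by the norm of the corresponding derivative,
  -- uniformly in h and continuously in time.
  have key := intervalIntegral.tendsto_integral_filter_of_dominated_convergence (l := 𝓝[≠] (0 : ℝ))
    (a := s) (b := t) (μ := volume) (F := D)
    (fun r => (‖(u r).1.2 0‖ * (‖b'.fn‖ * ‖(u r).1.2 0‖)
      + ‖(b'.mulH1 (u r)).1.2 0‖ * ‖(u r).1.2 0‖)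
      + (‖f r‖ * (‖b.fn‖ * ‖(u r).1.2 0‖) + ‖(b.mulH1 (u r)).1.2 0‖ * ‖f r‖))
    (Eventually.of_forall fun h => (cD h).aestronglyMeasurable)
    (Eventually.of_forall fun h => Eventually.of_forall fun r _ => by
      have l1 : ∀ (m : BoundedContinuousFunction Plane ℝ) (w : PlaneL2),
          ‖(inner ℂ w (mulL2 m (diffQuot 0 h (u r).1.1))).re‖
            ≤ ‖w‖ * (‖m‖ * ‖(u r).1.2 0‖) := fun m w =>
        (Complex.abs_re_le_norm _).trans ((norm_inner_le_norm _ _).trans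
          (mul_le_mul_of_nonneg_left ((norm_mulL2_le _ _).trans
            (mul_le_mul_of_nonneg_left (norm_diffQuot_le _ _ _) (norm_nonneg _))) (norm_nonneg _)))
      have l2 : ∀ (m : Multiplier) (w : PlaneL2),
          ‖(inner ℂ (diffQuot 0 (-h) (mulL2 m.fn (u r).1.1)) w).re‖
            ≤ ‖(m.mulH1 (u r)).1.2 0‖ * ‖w‖ := fun m w =>
        (Complex.abs_re_le_norm _).trans ((norm_inner_le_norm _ _).trans
          (mul_le_mul_of_nonneg_right (norm_diffQuot_le (m.mulH1 (u r)) 0 (-h)) (norm_nonneg _)))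
      exact (norm_add_le _ _).trans (add_le_add
        ((norm_add_le _ _).trans (add_le_add (l1 _ _) (l2 _ _)))
        ((norm_add_le _ _).trans (add_le_add (l1 _ _) (l2 _ _)))))
    (Continuous.intervalIntegrable (by
      have := cm b
      have := cm b'
      fun_prop) _ _)
    (Eventually.of_forall fun r _ => hlimD r)
  simp_rw [hint] at key
  exact tendsto_nhds_unique ((hlim1 t).sub (hlim1 s)) key

end Evolves

/-! ### The virial density and its bounds. -/

lemma integrable_mul_nlsG (g : BoundedContinuousFunction Plane ℝ) (v : sobolevH1) :
    Integrable fun x => g x * nlsG (v.1.1 x) := by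
  refine (integrable_inner_real (nlsL2 v) (mulL2 g v.1.1)).congr ?_
  filter_upwards [coeFn_nlsL2 v, coeFn_mulL2 g v.1.1] with x h1 h2
  rw [h1, h2, ← Complex.real_smul, real_inner_smul_right, nlsG_eq_inner]

/-- The weighted density controlled by the virial identity. -/
def virialDensity (v : sobolevH1) : ℝ :=
  (inner ℂ (nlsL2 v) (mulL2 virialWeight.fn v.1.1)).re - potWeighted virialWeight.fn v

lemma virialDensity_eq (v : sobolevH1) : virialDensity v
    = ∫ x, virialWeight.fn x * (nlsG (v.1.1 x) - nlsPotential (v.1.1 x)) := by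
  rw [virialDensity, inner_nlsL2_mul, Complex.ofReal_re, potWeighted,
    ← integral_sub (integrable_mul_nlsG _ _) (integrable_potWeighted _ _)]
  simp_rw [mul_sub]

lemma virialDensity_nonneg (v : sobolevH1) : 0 ≤ virialDensity v := by
  rw [virialDensity_eq]
  refine integral_nonneg fun x => mul_nonneg (virialWeight_nonneg _) ?_
  linarith [nlsPotential_le_half_nlsG (v.1.1 x), nlsG_nonneg (v.1.1 x)]

lemma continuous_virialDensity : Continuous virialDensity :=
  (Complex.continuous_re.comp (continuous_nlsL2.inner
    ((mulL2 virialWeight.fn).continuous.comp continuous_h1_fst))).sub (continuous_potWeighted _)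

/-- The factor 4 is 2 · 2: the weight is at least 1/2 on the unit disc, and G − F ≥ G/2. -/
lemma lintegral_nlsG_le (v : sobolevH1) :
    ∫⁻ x in Metric.closedBall (0 : Plane) 1, ENNReal.ofReal (nlsG (v.1.1 x))
      ≤ ENNReal.ofReal (4 * virialDensity v) := by
  have hi : Integrable fun x =>
      4 * (virialWeight.fn x * (nlsG (v.1.1 x) - nlsPotential (v.1.1 x))) := by
    simp_rw [mul_sub (virialWeight.fn _)]
    exact ((integrable_mul_nlsG _ _).sub (integrable_potWeighted _ _)).const_mul 4
  have hge : ∀ x, 0 ≤ nlsG (v.1.1 x) - nlsPotential (v.1.1 x) := fun x => by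
    linarith [nlsPotential_le_half_nlsG (v.1.1 x), nlsG_nonneg (v.1.1 x)]
  rw [virialDensity_eq, ← integral_const_mul, ofReal_integral_eq_lintegral_ofReal hi
    (Eventually.of_forall fun x => mul_nonneg (by norm_num)
      (mul_nonneg (virialWeight_nonneg _) (hge x)))]
  refine le_trans (setLIntegral_mono' measurableSet_closedBall fun x hx => ?_)
    (setLIntegral_le_lintegral _ _)
  refine ENNReal.ofReal_le_ofReal ?_
  have h1 := half_le_virialWeight (mem_closedBall_zero_iff.1 hx)
  have h2 := nlsPotential_le_half_nlsG (v.1.1 x)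
  have h3 := mul_le_mul_of_nonneg_right h1 (hge x)
  linarith

/-- Lower bound for the virial density by the virial integrand. -/
lemma virialDensity_le (v : sobolevH1) :
    virialDensity v ≤ (((inner ℂ (v.1.2 0) (mulL2 virialWeight.fn (v.1.2 0))).re
          + (inner ℂ ((virialWeight.mulH1 v).1.2 0) (v.1.2 0)).re)
        + ((inner ℂ (nlsL2 v) (mulL2 virialFun.fn (v.1.2 0))).re
          + (inner ℂ ((virialFun.mulH1 v).1.2 0) (nlsL2 v)).re))
      + ‖virialWeight.grad 0‖ * ‖v.1.1‖ * ‖v.1.2 0‖ := by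
  -- The pairing of f with b ∂₀v contributes −∫ wF; the term ⟨w v, f⟩ from ∂₀(b v) contributes ∫ wG.
  have h1 := two_mul_re_inner_nlsL2 virialFun v 0
  rw [virialFun_grad_zero] at h1
  -- The kinetic term 2 ∫ w|∂₀v|² has a favourable sign and is discarded.
  have hpos : 0 ≤ (inner ℂ (v.1.2 0) (mulL2 virialWeight.fn (v.1.2 0))).re := by
    rw [re_inner_planeL2]
    refine integral_nonneg_of_ae ?_
    filter_upwards [coeFn_mulL2 virialWeight.fn (v.1.2 0)] with x hx
    rw [hx, ← Complex.real_smul, real_inner_smul_right]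
    exact mul_nonneg (virialWeight_nonneg _) real_inner_self_nonneg
  -- The only error term comes from the derivative of the weight.
  have h2 : ‖inner ℂ (mulL2 (virialWeight.grad 0) v.1.1) (v.1.2 0)‖
      ≤ ‖virialWeight.grad 0‖ * ‖v.1.1‖ * ‖v.1.2 0‖ :=
    (norm_inner_le_norm _ _).trans (mul_le_mul_of_nonneg_right (norm_mulL2_le _ _) (norm_nonneg _))
  have h3 := (abs_le.1 ((Complex.abs_re_le_norm _).trans h2)).1
  have e1 : (inner ℂ (mulL2 virialFun.fn (v.1.2 0)) (nlsL2 v)).re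
      = (inner ℂ (nlsL2 v) (mulL2 virialFun.fn (v.1.2 0))).re := by
    rw [← inner_conj_symm, Complex.conj_re]
  have e2 : (inner ℂ (mulL2 virialWeight.fn v.1.1) (nlsL2 v)).re
      = (inner ℂ (nlsL2 v) (mulL2 virialWeight.fn v.1.1)).re := by
    rw [← inner_conj_symm, Complex.conj_re]
  simp only [Multiplier.mulH1_snd, inner_add_left, Complex.add_re, virialFun_grad_zero, e1, e2,
    inner_mulL2 virialWeight.fn (v.1.2 0)]
  unfold virialDensity
  linarith

lemma integrable_norm_sq_planeL2 (v : PlaneL2) : Integrable fun x => ‖v x‖ ^ 2 :=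
  (Lp.memLp v).norm.integrable_sq

lemma norm_sq_planeL2 (v : PlaneL2) : ‖v‖ ^ 2 = ∫ x, ‖v x‖ ^ 2 := by
  rw [← inner_self_eq_norm_sq (𝕜 := ℂ) v]
  refine (re_inner_planeL2 v v).trans ?_
  simp_rw [real_inner_self_eq_norm_sq]

/-! ### Bounds from mass and energy, and the conclusion. -/

namespace IsNLSSolution

variable {u : ℝ → Plane → ℂ}

lemma mass_eq (hu : IsNLSSolution u) : mass (u 0) = ENNReal.ofReal (‖(hu.toH1 0).1.1‖ ^ 2) := by
  rw [ENNReal.ofReal_pow (norm_nonneg _), ofReal_norm, enorm_sq_planeL2, mass]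
  refine lintegral_congr_ae ?_
  filter_upwards [(hu.memH1 0).coeFn_toH1] with x hx
  have : (hu.toH1 0).1.1 x = u 0 x := hx
  rw [this, ENNReal.ofReal_pow (norm_nonneg _), ofReal_norm]

lemma hamiltonian_eq (hu : IsNLSSolution u) : hamiltonian (u 0) = ENNReal.ofReal
    (‖(hu.toH1 0).1.2 0‖ ^ 2 + ‖(hu.toH1 0).1.2 1‖ ^ 2 + potEnergy (hu.toH1 0)) := by
  have i0 := integrable_norm_sq_planeL2 ((hu.toH1 0).1.2 0)
  have i1 := integrable_norm_sq_planeL2 ((hu.toH1 0).1.2 1)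
  have i2 := integrable_nlsPotential (hu.toH1 0)
  have i3 : Integrable fun x => ‖(hu.toH1 0).1.2 0 x‖ ^ 2 + ‖(hu.toH1 0).1.2 1 x‖ ^ 2 := i0.add i1
  have i4 : Integrable fun x => ‖(hu.toH1 0).1.2 0 x‖ ^ 2 + ‖(hu.toH1 0).1.2 1 x‖ ^ 2
      + nlsPotential ((hu.toH1 0).1.1 x) := i3.add i2
  rw [norm_sq_planeL2, norm_sq_planeL2, potEnergy, ← integral_add i0 i1,
    ← integral_add i3 i2,
    ofReal_integral_eq_lintegral_ofReal i4 (Eventually.of_forall fun x => by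
      have := nlsPotential_nonneg ((hu.toH1 0).1.1 x)
      simp only [Pi.zero_apply]
      positivity), hamiltonian]
  refine lintegral_congr_ae ?_
  filter_upwards [(hu.memH1 0).coeFn_toH1, (hu.memH1 0).coeFn_toH1_snd 0,
    (hu.memH1 0).coeFn_toH1_snd 1] with x hx h0 h1
  have hx' : (hu.toH1 0).1.1 x = u 0 x := hx
  have h0' : (hu.toH1 0).1.2 0 x = weakGradient (u 0) x 0 := h0
  have h1' : (hu.toH1 0).1.2 1 x = weakGradient (u 0) x 1 := h1
  rw [hx', h0', h1', EuclideanSpace.norm_sq_eq, Fin.sum_univ_two]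

lemma norm_fst_eq (hu : IsNLSSolution u) {M : ℝ≥0} (hM : mass (u 0) = M) (t : ℝ) :
    ‖(hu.toH1 t).1.1‖ = √M := by
  rw [hu.norm_eq t 0, eq_comm, Real.sqrt_eq_iff_eq_sq M.coe_nonneg (norm_nonneg _)]
  rw [hu.mass_eq, ← ENNReal.ofReal_coe_nnreal,
    ENNReal.ofReal_eq_ofReal_iff (by positivity) M.coe_nonneg] at hM
  exact hM.symm

/-- Energy conservation together with F ≥ 0: the kinetic energy never exceeds H ≤ 1. -/
lemma norm_snd_le_one (hu : IsNLSSolution u) {H : ℝ≥0} (hH : H ≤ 1) (h : hamiltonian (u 0) = H)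
    (t : ℝ) : ‖(hu.toH1 t).1.2 0‖ ≤ 1 := by
  have hpot : ∀ s, 0 ≤ potEnergy (hu.toH1 s) := fun s => integral_nonneg fun x =>
    nlsPotential_nonneg _
  have h0 := hpot 0
  have ht := hpot t
  rw [hu.hamiltonian_eq, ← ENNReal.ofReal_coe_nnreal,
    ENNReal.ofReal_eq_ofReal_iff (by positivity) H.coe_nonneg, hu.energy_eq 0 t] at h
  have h1 : (H : ℝ) ≤ 1 := by exact_mod_cast hH
  have h2 : ‖(hu.toH1 t).1.2 0‖ ^ 2 ≤ 1 := by nlinarith [sq_nonneg ‖(hu.toH1 t).1.2 1‖]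
  exact (sq_le_one_iff₀ (norm_nonneg _)).1 h2

/-- Each boundary value of V is at most sup|b| √M, and the weight's commutator costs at most
sup|∂₀w| √M per unit time. -/
lemma integral_virialDensity_le (hu : IsNLSSolution u) {M H : ℝ≥0} (hH : H ≤ 1)
    (hM : mass (u 0) = M) (hE : hamiltonian (u 0) = H) {a b : ℝ} (hab : a ≤ b) :
    ∫ s in a..b, virialDensity (hu.toH1 s)
      ≤ 2 * (‖virialFun.fn‖ * √M) + (b - a) * (‖virialWeight.grad 0‖ * √M) := by
  have cu := hu.continuous_toH1
  have hv := hu.evolves.virial virialFun virialWeight virialFun_grad_zero virialFun_grad_one a b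
  set W : ℝ → ℝ := fun r =>
    (((inner ℂ ((hu.toH1 r).1.2 0) (mulL2 virialWeight.fn ((hu.toH1 r).1.2 0))).re
          + (inner ℂ ((virialWeight.mulH1 (hu.toH1 r)).1.2 0) ((hu.toH1 r).1.2 0)).re)
        + ((inner ℂ (nlsL2 (hu.toH1 r)) (mulL2 virialFun.fn ((hu.toH1 r).1.2 0))).re
          + (inner ℂ ((virialFun.mulH1 (hu.toH1 r)).1.2 0) (nlsL2 (hu.toH1 r))).re)) with hW
  have c2 : Continuous fun r => (hu.toH1 r).1.2 0 := (continuous_h1_snd 0).comp cu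
  have cm : ∀ m : Multiplier, Continuous fun r => (m.mulH1 (hu.toH1 r)).1.2 0 := fun m =>
    (continuous_h1_snd 0).comp (m.mulH1.continuous.comp cu)
  have cW : Continuous W :=
    ((Complex.continuous_re.comp (c2.inner ((mulL2 _).continuous.comp c2))).add
      (Complex.continuous_re.comp ((cm _).inner c2))).add
      ((Complex.continuous_re.comp (hu.continuous_nls.inner ((mulL2 _).continuous.comp c2))).add
      (Complex.continuous_re.comp ((cm _).inner hu.continuous_nls)))
  have hVb : ∀ t, |(inner ℂ (hu.toH1 t).1.1 (mulL2 virialFun.fn ((hu.toH1 t).1.2 0))).im|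
      ≤ ‖virialFun.fn‖ * √M := by
    intro t
    refine (Complex.abs_im_le_norm _).trans ((norm_inner_le_norm _ _).trans ?_)
    rw [hu.norm_fst_eq hM, mul_comm]
    refine mul_le_mul_of_nonneg_right ((norm_mulL2_le _ _).trans ?_) (Real.sqrt_nonneg _)
    exact mul_le_of_le_one_right (norm_nonneg _) (hu.norm_snd_le_one hH hE t)
  have hle : ∀ r, virialDensity (hu.toH1 r) ≤ W r + ‖virialWeight.grad 0‖ * √M := by
    intro r
    refine (virialDensity_le _).trans (add_le_add le_rfl ?_)
    rw [hu.norm_fst_eq hM]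
    exact mul_le_of_le_one_right (by positivity) (hu.norm_snd_le_one hH hE r)
  have h1 : ∫ s in a..b, virialDensity (hu.toH1 s)
      ≤ ∫ s in a..b, (W s + ‖virialWeight.grad 0‖ * √M) :=
    intervalIntegral.integral_mono_on hab
      ((continuous_virialDensity.comp cu).intervalIntegrable _ _)
      ((cW.add continuous_const).intervalIntegrable _ _) fun s _ => hle s
  rw [intervalIntegral.integral_add (cW.intervalIntegrable _ _)
    (continuous_const.intervalIntegrable _ _), ← hv, intervalIntegral.integral_const,
    smul_eq_mul] at h1
  have h2 := (abs_le.1 (hVb b)).2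
  have h3 := (abs_le.1 (hVb a)).1
  linarith

end IsNLSSolution

end

theorem mainTheorem6 (M H : ℝ≥0) (hH : H ≤ 1) :
    ∃ C : ℝ, ∀ u : ℝ → Plane → ℂ, IsNLSSolution u →
      mass (u 0) = (M : ℝ≥0∞) → hamiltonian (u 0) = (H : ℝ≥0∞) →
      ∀ t τ : ℝ, 0 < τ →
        ∫⁻ s in Ioc t (t + τ), ∫⁻ x in Metric.closedBall (0 : Plane) 1,
            ENNReal.ofReal (nlsG (u s x))
          ≤ ENNReal.ofReal (C * √(1 + τ ^ 2)) := by
  -- Twice the bound on V plus the commutator rate, times the factor 4 of `lintegral_nlsG_le`.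
  refine ⟨4 * (2 * (‖virialFun.fn‖ * √M) + ‖virialWeight.grad 0‖ * √M), ?_⟩
  intro u hu hM hE t τ hτ
  have h1 : ∀ s, ∫⁻ x in Metric.closedBall (0 : Plane) 1, ENNReal.ofReal (nlsG (u s x))
      ≤ ENNReal.ofReal (4 * virialDensity (hu.toH1 s)) := by
    intro s
    refine le_trans (le_of_eq (lintegral_congr_ae (ae_restrict_of_ae ?_)))
      (lintegral_nlsG_le (hu.toH1 s))
    filter_upwards [(hu.memH1 s).coeFn_toH1] with x hx
    have hx' : (hu.toH1 s).1.1 x = u s x := hx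
    rw [hx']
  have hc : Continuous fun s => 4 * virialDensity (hu.toH1 s) :=
    continuous_const.mul (continuous_virialDensity.comp hu.continuous_toH1)
  refine (lintegral_mono h1).trans ?_
  rw [← ofReal_integral_eq_lintegral_ofReal
    ((intervalIntegrable_iff_integrableOn_Ioc_of_le (by linarith)).1 (hc.intervalIntegrable _ _))
    (Eventually.of_forall fun s => mul_nonneg (by norm_num) (virialDensity_nonneg _)),
    ← intervalIntegral.integral_of_le (by linarith), intervalIntegral.integral_const_mul]
  refine ENNReal.ofReal_le_ofReal ?_
  have h2 := hu.integral_virialDensity_le hH hM hE (a := t) (b := t + τ) (by linarith)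
  rw [add_sub_cancel_left] at h2
  -- The boundary terms are absorbed by 1 ≤ ⟨τ⟩ and the linear growth by τ ≤ ⟨τ⟩.
  have h3 : 1 ≤ √(1 + τ ^ 2) := Real.one_le_sqrt.2 (by nlinarith)
  have h4 : τ ≤ √(1 + τ ^ 2) := Real.le_sqrt_of_sq_le (by linarith)
  have h5 : 0 ≤ ‖virialFun.fn‖ * √M := by positivity
  have h6 : 0 ≤ ‖virialWeight.grad 0‖ * √M := by positivity
  have h7 := mul_le_mul_of_nonneg_right h4 h6
  have h8 := mul_le_mul_of_nonneg_right h3 h5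
  linarith
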